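/- Let $\mathbb F$ be a field, $S\subseteq\mathbb F$ a non-empty finite set, $k,s\ge 1$ and $d\ge 0$ integers. Put $E=\{e\in\mathbb Z_{\ge0}^k : \|e\|_1<s\}$. For $f\in\mathbb F[x_1,\dots,x_k]$ and $e\in\mathbb Z_{\ge 0}^k$, the Hasse derivative $\partial_e f$ is the coefficient of $z^e$ in $f(x+z)$. The encoding of $f$ is the word $\mathrm{Enc}(f)\colon S^k\to\mathbb F^{E}$, $a\mapsto(\partial_e f(a))_{e\in E}$, and the $k$-variate order-$s$ multiplicity code of degree-$d$ polynomials on $S^k$ is $\{\mathrm{Enc}(f) : \deg f\le d\}$, where $\deg$ is total degree. The agreement of two words $S^k\to\mathbb F^E$ is the fraction of points of $S^k$ at which they are equal. Put $\delta=1-\frac{d}{s|S|}$. An arithmetic random access program is a fixed finite program, not mentioning any field, that works on arrays of natural numbers and arrays of field elements. It is built from assignments by sequencing, branching and while loops; the basic operations, each costing one step, are access to a computed array cell, constants, addition and truncated subtraction of natural numbers, the field operations $+,-,\cdot,{}^{-1}$ (with $0^{-1}=0$), comparison of natural numbers and equality tests of field elements. Such programs are deterministic and can be run over every field. **Theorem.**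 For every real $\epsilon\in(0,1)$ and every integer $k\ge1$ there are integers $s_0$ and $C$ and an arithmetic random access program $\mathcal A$, depending only on $\epsilon$ and $k$, such that the following holds for all integers $s\ge s_0$ and $d\ge 0$, every field $\mathbb F$ whose characteristic is zero or larger than $d$, every finite set $S\subseteq\mathbb F$ with $d<s|S|$, and every word $P\colon S^k\to\mathbb F^{E}$. 1. On input $s$, $d$, $|S|$, the integer agreement threshold $\lceil(1-\delta+\epsilon)|S|^k\rceil$, a list of the elements of $S$ in any order, and the values of $P$, the program $\mathcal A$ halts after at most $C\,(s|S|)^{C}$ steps, and its output is a list of at most $C\,(s|S|)^{C}$ polynomials (given by their coefficients). The polynomials in this list are exactly the $f\in\mathbb F[x_1,\dots,x_k]$ with $\deg f\le d$ such that $\mathrm{Enc}(f)$ and $P$ have agreement at least $1-\delta+\epsilon$. 2. In particular, the number of codewords that have agreement at least $1-\delta+\epsilon$ with $P$ is finite and at most $C\,(s|S|)^{C}$. -/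

import Mathlib

universe u

namespace MultCode

noncomputable section

/-! ### Multiplicity codes -/

/-- The Hasse derivative of type `e` of `f`: the coefficient of `z ^ e` in `f (x + z)`, where
`f (x + z)` is regarded as a polynomial in `z` with coefficients in `F[x]`. -/
def hasseDeriv {k : ℕ} {F : Type*} [Field F] (e : Fin k →₀ ℕ) (f : MvPolynomial (Fin k) F) :
    MvPolynomial (Fin k) F :=
  MvPolynomial.coeff e
    (MvPolynomial.aeval
      (fun i => (MvPolynomial.C (MvPolynomial.X i) + MvPolynomial.X i :
        MvPolynomial (Fin k) (MvPolynomial (Fin k) F))) f)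

/-- The set `E` of exponent vectors of length `k` with sum less than `s`. -/
abbrev Exps (k s : ℕ) : Type := {e : Fin k →₀ ℕ // (∑ i, e i) < s}

/-- Words of length `S ^ k` over the alphabet `F ^ E`. -/
abbrev Word (k s : ℕ) {F : Type*} (S : Finset F) : Type _ :=
  (Fin k → S) → Exps k s → F

/-- The encoding of `f`: all Hasse derivatives of order less than `s`, at all points of `S ^ k`. -/
def enc {k : ℕ} (s : ℕ) {F : Type*} [Field F] (S : Finset F) (f : MvPolynomial (Fin k) F) :
    Word k s S :=
  fun a e => MvPolynomial.eval (fun i => (a i : F)) (hasseDeriv e.1 f)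

/-- The `k`-variate order-`s` multiplicity code of degree-`d` polynomials on the grid `S ^ k`. -/
def code (k s d : ℕ) {F : Type*} [Field F] (S : Finset F) : Set (Word k s S) :=
  {c | ∃ f : MvPolynomial (Fin k) F, f.totalDegree ≤ d ∧ enc s S f = c}

/-- The fraction of the points of `S ^ k` on which two words agree. -/
def agreement {k s : ℕ} {F : Type*} {S : Finset F} (c w : Word k s S) : ℝ :=
  (Set.ncard {a : Fin k → S | c a = w a} : ℝ) / (S.card : ℝ) ^ k

/-- The relative distance `δ = 1 - d / (s n)` of the code, where `n = |S|`. -/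
def relDist (s d n : ℕ) : ℝ := 1 - (d : ℝ) / ((s : ℝ) * (n : ℝ))

/-! ### Arithmetic random access machines

A program works on arrays of natural numbers and arrays of elements of a field. The arrays are
named by numerals in the program text and their cells are addressed by computed natural numbers.
The program text does not mention the field. Every single operation (reading or writing a cell, an
addition or subtraction of natural numbers, a field operation, a comparison) costs one step. -/

/-- Expressions with natural number values; `sub` is truncated subtraction. -/
inductive NatExpr : Type
  | const (n : ℕ)
  | load (arr : ℕ) (idx : NatExpr)
  | add (a b : NatExpr)
  | sub (a b : NatExpr)

/-- Expressions with field values; the value of `inv x` is `x⁻¹`, with `0⁻¹ = 0`. -/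
inductive FldExpr : Type
  | zero
  | one
  | load (arr : ℕ) (idx : NatExpr)
  | add (x y : FldExpr)
  | sub (x y : FldExpr)
  | mul (x y : FldExpr)
  | inv (x : FldExpr)

/-- Tests: comparison of natural numbers, equality of field elements, negation. -/
inductive Test : Type
  | natLt (a b : NatExpr)
  | fldEq (x y : FldExpr)
  | not (t : Test)

/-- Programs. -/
inductive Prog : Type
  | skip
  | setNat (arr : ℕ) (idx val : NatExpr)
  | setFld (arr : ℕ) (idx : NatExpr) (val : FldExpr)
  | seq (p q : Prog)
  | ite (t : Test) (p q : Prog)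
  | while (t : Test) (p : Prog)

/-- A memory state: `nat arr i` is cell `i` of the natural number array `arr`, and `fld arr i` is
cell `i` of the field array `arr`. -/
structure State (F : Type*) where
  nat : ℕ → ℕ → ℕ
  fld : ℕ → ℕ → F

/-- Write the cell `i` of a natural number array. -/
def State.setNat {F : Type*} (σ : State F) (arr i v : ℕ) : State F :=
  { nat := Function.update σ.nat arr (Function.update (σ.nat arr) i v), fld := σ.fld }

/-- Write the cell `i` of a field array. -/
def State.setFld {F : Type*} (σ : State F) (arr i : ℕ) (v : F) : State F :=
  { nat := σ.nat, fld := Function.update σ.fld arr (Function.update (σ.fld arr) i v) }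

/-- The value of an expression. -/
def NatExpr.eval {F : Type*} (σ : State F) : NatExpr → ℕ
  | .const n => n
  | .load arr idx => σ.nat arr (idx.eval σ)
  | .add a b => a.eval σ + b.eval σ
  | .sub a b => a.eval σ - b.eval σ

/-- The number of steps for evaluating an expression. -/
def NatExpr.cost : NatExpr → ℕ
  | .const _ => 1
  | .load _ idx => idx.cost + 1
  | .add a b => a.cost + b.cost + 1
  | .sub a b => a.cost + b.cost + 1

/-- The value of an expression. -/
def FldExpr.eval {F : Type*} [Field F] (σ : State F) : FldExpr → F
  | .zero => 0
  | .one => 1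
  | .load arr idx => σ.fld arr (idx.eval σ)
  | .add x y => x.eval σ + y.eval σ
  | .sub x y => x.eval σ - y.eval σ
  | .mul x y => x.eval σ * y.eval σ
  | .inv x => (x.eval σ)⁻¹

/-- The number of steps for evaluating an expression. -/
def FldExpr.cost : FldExpr → ℕ
  | .zero => 1
  | .one => 1
  | .load _ idx => idx.cost + 1
  | .add x y => x.cost + y.cost + 1
  | .sub x y => x.cost + y.cost + 1
  | .mul x y => x.cost + y.cost + 1
  | .inv x => x.cost + 1

/-- The truth of a test. -/
def Test.Holds {F : Type*} [Field F] (σ : State F) : Test → Prop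
  | .natLt a b => a.eval σ < b.eval σ
  | .fldEq x y => x.eval σ = y.eval σ
  | .not t => ¬ t.Holds σ

/-- The number of steps for a test. -/
def Test.cost : Test → ℕ
  | .natLt a b => a.cost + b.cost + 1
  | .fldEq x y => x.cost + y.cost + 1
  | .not t => t.cost + 1

/-- `Exec p σ τ T`: the program `p`, started in the state `σ`, halts in the state `τ` after exactly
`T` steps. -/
inductive Exec {F : Type*} [Field F] : Prog → State F → State F → ℕ → Prop
  | skip (σ : State F) : Exec .skip σ σ 1
  | setNat (arr : ℕ) (idx val : NatExpr) (σ : State F) :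
      Exec (.setNat arr idx val) σ (σ.setNat arr (idx.eval σ) (val.eval σ))
        (idx.cost + val.cost + 1)
  | setFld (arr : ℕ) (idx : NatExpr) (val : FldExpr) (σ : State F) :
      Exec (.setFld arr idx val) σ (σ.setFld arr (idx.eval σ) (val.eval σ))
        (idx.cost + val.cost + 1)
  | seq {p q : Prog} {σ τ υ : State F} {T U : ℕ} :
      Exec p σ τ T → Exec q τ υ U → Exec (.seq p q) σ υ (T + U)
  | iteTrue {t : Test} {p q : Prog} {σ τ : State F} {T : ℕ} :
      t.Holds σ → Exec p σ τ T → Exec (.ite t p q) σ τ (t.cost + T)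
  | iteFalse {t : Test} {p q : Prog} {σ τ : State F} {T : ℕ} :
      ¬ t.Holds σ → Exec q σ τ T → Exec (.ite t p q) σ τ (t.cost + T)
  | whileTrue {t : Test} {p : Prog} {σ τ υ : State F} {T U : ℕ} :
      t.Holds σ → Exec p σ τ T → Exec (.while t p) τ υ U → Exec (.while t p) σ υ (t.cost + T + U)
  | whileFalse {t : Test} {p : Prog} {σ : State F} :
      ¬ t.Holds σ → Exec (.while t p) σ σ t.cost

/-- Programs are deterministic: the final state and the number of steps are determined by the
initial state. -/
theorem Exec.deterministic {F : Type*} [Field F] {p : Prog} {σ τ : State F} {T : ℕ}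
    (h : Exec p σ τ T) : ∀ {τ' : State F} {T' : ℕ}, Exec p σ τ' T' → τ' = τ ∧ T' = T := by
  induction h with
  | skip σ => intro τ' T' h'; cases h'; exact ⟨rfl, rfl⟩
  | setNat => intro τ' T' h'; cases h'; exact ⟨rfl, rfl⟩
  | setFld => intro τ' T' h'; cases h'; exact ⟨rfl, rfl⟩
  | seq _ _ ih₁ ih₂ =>
    intro τ' T' h'
    cases h' with
    | seq a b =>
      obtain ⟨rfl, rfl⟩ := ih₁ a
      obtain ⟨rfl, rfl⟩ := ih₂ b
      exact ⟨rfl, rfl⟩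
  | iteTrue ht _ ih =>
    intro τ' T' h'
    cases h' with
    | iteTrue _ a => obtain ⟨rfl, rfl⟩ := ih a; exact ⟨rfl, rfl⟩
    | iteFalse hn _ => exact absurd ht hn
  | iteFalse hn _ ih =>
    intro τ' T' h'
    cases h' with
    | iteTrue ht _ => exact absurd ht hn
    | iteFalse _ a => obtain ⟨rfl, rfl⟩ := ih a; exact ⟨rfl, rfl⟩
  | whileTrue ht _ _ ih₁ ih₂ =>
    intro τ' T' h'
    cases h' with
    | whileTrue _ a b =>
      obtain ⟨rfl, rfl⟩ := ih₁ a
      obtain ⟨rfl, rfl⟩ := ih₂ b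
      exact ⟨rfl, rfl⟩
    | whileFalse hn => exact absurd ht hn
  | whileFalse hn =>
    intro τ' T' h'
    cases h' with
    | whileTrue ht _ _ => exact absurd ht hn
    | whileFalse _ => exact ⟨rfl, rfl⟩

/-! ### Input and output of the decoder -/

/-- The number whose base-`b` digits are `v 0, v 1, …, v (k - 1)`, least significant first. -/
def radix (b : ℕ) {k : ℕ} (v : Fin k → ℕ) : ℕ := ∑ i, v i * b ^ (i : ℕ)

/-- The cell that holds coordinate `e` of the symbol at grid point `p` of the received word, where
a grid point is given by the positions of its coordinates in the enumeration of `S`. -/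
def wordCell (k s n : ℕ) (x : (Fin k → Fin n) × Exps k s) : ℕ :=
  radix n (fun i => (x.1 i : ℕ)) * s ^ k + radix s (fun i => x.2.1 i)

theorem radix_lt {b k : ℕ} {v : Fin k → ℕ} (hv : ∀ i, v i < b) : radix b v < b ^ k := by
  have := (finFunctionFinEquiv (m := b) (n := k) (fun i => ⟨v i, hv i⟩)).2
  simpa [radix, finFunctionFinEquiv_apply] using this

theorem radix_inj {b k : ℕ} {v w : Fin k → ℕ} (hv : ∀ i, v i < b) (hw : ∀ i, w i < b)
    (h : radix b v = radix b w) : v = w := by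
  have := (finFunctionFinEquiv (m := b) (n := k)).injective
    (a₁ := fun i => ⟨v i, hv i⟩) (a₂ := fun i => ⟨w i, hw i⟩)
    (Fin.ext (by simpa [radix, finFunctionFinEquiv_apply] using h))
  funext i
  simpa using congrArg Fin.val (congrFun this i)

/-- Different coordinates of the received word are held by different cells. -/
theorem wordCell_injective (k s n : ℕ) : Function.Injective (wordCell k s n) := by
  rintro ⟨p, e⟩ ⟨q, f⟩ h
  have he : ∀ (e : Exps k s) (i : Fin k), e.1 i < s := fun e i =>
    (Finset.single_le_sum (f := fun i => e.1 i) (fun _ _ => Nat.zero_le _)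
      (Finset.mem_univ i)).trans_lt e.2
  have hle := radix_lt (he e)
  have hlf := radix_lt (he f)
  simp only [wordCell] at h
  have hpos : 0 < s ^ k := by omega
  have h₁ := congrArg (· / s ^ k) h
  have h₂ := congrArg (· % s ^ k) h
  simp only [Nat.mul_comm _ (s ^ k), Nat.mul_add_div hpos, Nat.div_eq_of_lt hle,
    Nat.div_eq_of_lt hlf, Nat.add_zero] at h₁
  simp only [Nat.mul_comm _ (s ^ k), Nat.mul_add_mod, Nat.mod_eq_of_lt hle,
    Nat.mod_eq_of_lt hlf] at h₂
  have h₃ := radix_inj (fun i => (p i).2) (fun i => (q i).2) h₁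
  have h₄ := radix_inj (he e) (he f) h₂
  refine Prod.ext (funext fun i => Fin.ext (congrFun h₃ i)) (Subtype.ext (Finsupp.ext ?_))
  exact fun i => congrFun h₄ i

/-- The initial state. Natural number array `0` holds `s`, `d`, `|S|` and the agreement threshold
`t` (a number of grid points). Field array `0` lists the elements of `S`, and field array `1` holds
the received word. All other cells are zero. -/
def inputState {k s : ℕ} (d t : ℕ) {F : Type*} [Field F] {S : Finset F}
    (enum : Fin S.card ≃ S) (P : Word k s S) : State F where
  nat := fun arr i =>
    if arr = 0 then
      if i = 0 then s else if i = 1 then d else if i = 2 then S.card else if i = 3 then t else 0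
    else 0
  fld := fun arr =>
    if arr = 0 then Function.extend (fun i : Fin S.card => (i : ℕ)) (fun i => (enum i : F)) 0
    else if arr = 1 then
      Function.extend (wordCell k s S.card) (fun x => P (fun i => enum (x.1 i)) x.2) 0
    else 0

/-- The polynomial number `j` of the output. Its coefficients are stored in field array `2`, in a
block of `(d + 1) ^ k` cells, one for each exponent vector with entries at most `d`. -/
def outputPoly (k d : ℕ) {F : Type*} [Field F] (σ : State F) (j : ℕ) :
    MvPolynomial (Fin k) F :=
  ∑ u : Fin k → Fin (d + 1),
    MvPolynomial.monomial (Finsupp.equivFunOnFinite.symm (fun i => (u i : ℕ)))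
      (σ.fld 2 (j * (d + 1) ^ k + radix (d + 1) (fun i => (u i : ℕ))))

/-- The list of polynomials that is represented by a final state. Its length is the content of
cell `0` of natural number array `1`. -/
def outputList (k d : ℕ) {F : Type*} [Field F] (σ : State F) : List (MvPolynomial (Fin k) F) :=
  (List.range (σ.nat 1 0)).map (outputPoly k d σ)

end

end MultCode

-- Write n = |S|. Fix M ≥ 2k/ε, put m = M^k - 1 and b = ⌊ns/M⌋ + 1. For every coordinate direction i
-- there are polynomials Q_{i,0}, …, Q_{i,m}, not all zero and of degree less than b in each
-- variable, such that the operator D_i = ∑_j Q_{i,j} ∂_j, with ∂_j the Hasse derivative of order j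
-- in the variable i, formally annihilates the received word to order s - m at every grid point:
-- these are at most (ns)^k linear conditions on (Mb)^k > (ns)^k unknowns (`lt_mul_boxSize`,
-- `interpCmd_spec`). If f has degree at most d and enough agreement, then D_i f has degree at most
-- k(b-1) + d and vanishes to order s - m at all points of agreement. By the multiplicity
-- Schwartz–Zippel lemma (`sum_multiplicity_le`) and the choice of parameters
-- (`degree_lt_of_agreement`), D_i f = 0.
--
-- So every wanted f lies in the linear space V = `solutions`. At a point, over the algebraic
-- closure, where the highest nonzero coefficients Q_{i,μ_i} do not vanish, the equation D_i f = 0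
-- expresses a Taylor coefficient of exponent e with e_i ≥ μ_i through coefficients of lower order;
-- the hypothesis on the characteristic makes the binomial factor invertible. Hence the coefficients
-- with e_i < μ_i for all i determine f, and dim V ≤ r = (m+1)^k, a number that depends only on ε
-- and k (`eq_zero_of_diffOp`, `finrank_solutions_le`).
--
-- An element of V that vanishes to order s at all points where f agrees with the word is zero,
-- again by Schwartz–Zippel, and r of these points suffice for this conclusion
-- (`exists_determining`). The decoder therefore runs through all n^(kr) tuples of r grid points,
-- solves for each a linear system whose solution is f if the tuple is a determining one for f, and
-- keeps the candidate if its agreement is large enough.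
--
-- The algorithm is written in a small language of terms with bounded sums and of commands that loop
-- over field arrays. Commands never write natural number variables, so all numbers stay
-- polynomially bounded and every command compiles to a polynomial time program (`Cmd.good`).
--
-- Layout: variables 0 to 3 hold s, d, n and the threshold. Array 0 holds the points, 1 the word, 2
-- the output, 3 a table of coefficients of powers of binomials, 4 to 6 the workspace of linear
-- algebra, 7 the solution of a system, 8 the candidate, 9 the acceptance flags, and 10 + i the
-- polynomials Q_{i,j}.

namespace MultCode

/-! ### Terms with bounded sums, and straight-line loops over them -/

/-- A memory of field arrays. -/
abbrev Mem (F : Type*) := ℕ → ℕ → F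

mutual
/-- Terms with natural number values. A nonzero value counts as true; `sum v N a` is the sum of `a`
over the values of the variable `v` below `N`. -/
inductive NTm : Type
  | const (n : ℕ)
  | var (v : ℕ)
  | add (a b : NTm)
  | sub (a b : NTm)
  | mul (a b : NTm)
  | div (a b : NTm)
  | mod (a b : NTm)
  | lt (a b : NTm)
  | ite (c a b : NTm)
  | sum (v : ℕ) (N a : NTm)
  | ne (x y : FTm)
/-- Terms with field values. -/
inductive FTm : Type
  | zero
  | one
  | load (a : ℕ) (i : NTm)
  | add (x y : FTm)
  | sub (x y : FTm)
  | mul (x y : FTm)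
  | inv (x : FTm)
  | ite (c : NTm) (x y : FTm)
  | sum (v : ℕ) (N : NTm) (x : FTm)
end

mutual
/-- The value of a term, lifted to the universe of the field. -/
noncomputable def NTm.evalLift {F : Type u} [Field F] : NTm → (ℕ → ℕ) → Mem F → ULift.{u} ℕ
  | .const n, _, _ => ⟨n⟩
  | .var v, ρ, _ => ⟨ρ v⟩
  | .add a b, ρ, μ => ⟨(a.evalLift ρ μ).down + (b.evalLift ρ μ).down⟩
  | .sub a b, ρ, μ => ⟨(a.evalLift ρ μ).down - (b.evalLift ρ μ).down⟩
  | .mul a b, ρ, μ => ⟨(a.evalLift ρ μ).down * (b.evalLift ρ μ).down⟩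
  | .div a b, ρ, μ => ⟨(a.evalLift ρ μ).down / (b.evalLift ρ μ).down⟩
  | .mod a b, ρ, μ => ⟨(a.evalLift ρ μ).down % (b.evalLift ρ μ).down⟩
  | .lt a b, ρ, μ => ⟨if (a.evalLift ρ μ).down < (b.evalLift ρ μ).down then 1 else 0⟩
  | .ite c a b, ρ, μ =>
    ⟨if (c.evalLift ρ μ).down = 0 then (b.evalLift ρ μ).down else (a.evalLift ρ μ).down⟩
  | .sum v N a, ρ, μ =>
    ⟨∑ i ∈ Finset.range (N.evalLift ρ μ).down, (a.evalLift (Function.update ρ v i) μ).down⟩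
  | .ne x y, ρ, μ => ⟨open Classical in if x.eval ρ μ = y.eval ρ μ then 0 else 1⟩
/-- The value of a term, given the values of the variables and the memory. -/
noncomputable def FTm.eval {F : Type u} [Field F] : FTm → (ℕ → ℕ) → Mem F → F
  | .zero, _, _ => 0
  | .one, _, _ => 1
  | .load a i, ρ, μ => μ a (i.evalLift ρ μ).down
  | .add x y, ρ, μ => x.eval ρ μ + y.eval ρ μ
  | .sub x y, ρ, μ => x.eval ρ μ - y.eval ρ μ
  | .mul x y, ρ, μ => x.eval ρ μ * y.eval ρ μ
  | .inv x, ρ, μ => (x.eval ρ μ)⁻¹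
  | .ite c x y, ρ, μ => if (c.evalLift ρ μ).down = 0 then y.eval ρ μ else x.eval ρ μ
  | .sum v N x, ρ, μ =>
    ∑ i ∈ Finset.range (N.evalLift ρ μ).down, x.eval (Function.update ρ v i) μ
end

/-- The value of a term, given the values of the variables and the memory. -/
noncomputable def NTm.eval {F : Type u} [Field F] (a : NTm) (ρ : ℕ → ℕ) (μ : Mem F) : ℕ :=
  (a.evalLift ρ μ).down

section eval

variable {F : Type u} [Field F] (a b c : NTm) (x y : FTm) (ρ : ℕ → ℕ) (μ : Mem F) (n v : ℕ)

@[simp] theorem NTm.eval_const : (NTm.const n).eval ρ μ = n := by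
  simp only [NTm.eval, NTm.evalLift]

@[simp] theorem NTm.eval_var : (NTm.var v).eval ρ μ = ρ v := by
  simp only [NTm.eval, NTm.evalLift]

@[simp] theorem NTm.eval_add : (NTm.add a b).eval ρ μ = a.eval ρ μ + b.eval ρ μ := by
  simp only [NTm.eval, NTm.evalLift]

@[simp] theorem NTm.eval_sub : (NTm.sub a b).eval ρ μ = a.eval ρ μ - b.eval ρ μ := by
  simp only [NTm.eval, NTm.evalLift]

@[simp] theorem NTm.eval_mul : (NTm.mul a b).eval ρ μ = a.eval ρ μ * b.eval ρ μ := by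
  simp only [NTm.eval, NTm.evalLift]

@[simp] theorem NTm.eval_div : (NTm.div a b).eval ρ μ = a.eval ρ μ / b.eval ρ μ := by
  simp only [NTm.eval, NTm.evalLift]

@[simp] theorem NTm.eval_mod : (NTm.mod a b).eval ρ μ = a.eval ρ μ % b.eval ρ μ := by
  simp only [NTm.eval, NTm.evalLift]

@[simp] theorem NTm.eval_lt : (NTm.lt a b).eval ρ μ = if a.eval ρ μ < b.eval ρ μ then 1 else 0 := by
  simp only [NTm.eval, NTm.evalLift]
  congr

@[simp] theorem NTm.eval_ite : (NTm.ite c a b).eval ρ μ =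
    if c.eval ρ μ = 0 then b.eval ρ μ else a.eval ρ μ := by
  simp only [NTm.eval, NTm.evalLift]
  congr

@[simp] theorem NTm.eval_sum : (NTm.sum v a b).eval ρ μ =
    ∑ i ∈ Finset.range (a.eval ρ μ), b.eval (Function.update ρ v i) μ := by
  simp only [NTm.eval, NTm.evalLift]

open Classical in
@[simp] theorem NTm.eval_ne :
    (NTm.ne x y).eval ρ μ = if x.eval ρ μ = y.eval ρ μ then 0 else 1 := by
  simp only [NTm.eval, NTm.evalLift]

@[simp] theorem FTm.eval_zero : (FTm.zero).eval ρ μ = 0 := by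
  simp only [FTm.eval]

@[simp] theorem FTm.eval_one : (FTm.one).eval ρ μ = 1 := by
  simp only [FTm.eval]

@[simp] theorem FTm.eval_load : (FTm.load n a).eval ρ μ = μ n (a.eval ρ μ) := by
  simp only [FTm.eval, NTm.eval]

@[simp] theorem FTm.eval_add : (FTm.add x y).eval ρ μ = x.eval ρ μ + y.eval ρ μ := by
  simp only [FTm.eval]

@[simp] theorem FTm.eval_sub : (FTm.sub x y).eval ρ μ = x.eval ρ μ - y.eval ρ μ := by
  simp only [FTm.eval]

@[simp] theorem FTm.eval_mul : (FTm.mul x y).eval ρ μ = x.eval ρ μ * y.eval ρ μ := by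
  simp only [FTm.eval]

@[simp] theorem FTm.eval_inv : (FTm.inv x).eval ρ μ = (x.eval ρ μ)⁻¹ := by
  simp only [FTm.eval]

@[simp] theorem FTm.eval_ite : (FTm.ite c x y).eval ρ μ =
    if c.eval ρ μ = 0 then y.eval ρ μ else x.eval ρ μ := by
  simp only [FTm.eval, NTm.eval]
  congr

@[simp] theorem FTm.eval_sum : (FTm.sum v a x).eval ρ μ =
    ∑ i ∈ Finset.range (a.eval ρ μ), x.eval (Function.update ρ v i) μ := by
  simp only [FTm.eval, NTm.eval]

end eval

/-- Commands: writing a cell, sequencing, and loops `loop v N c` that run `c` for all values of the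
variable `v` below `N`. -/
inductive Cmd : Type
  | skip
  | set (a : ℕ) (i : NTm) (x : FTm)
  | seq (c d : Cmd)
  | loop (v : ℕ) (N : NTm) (c : Cmd)

/-- Write one cell of a memory. -/
def Mem.set {F : Type*} (μ : Mem F) (a i : ℕ) (x : F) : Mem F :=
  Function.update μ a (Function.update (μ a) i x)

/-- Apply `f 0`, `f 1`, …, `f (n - 1)` successively. -/
def iter {α : Type*} (f : ℕ → α → α) : ℕ → α → α
  | 0, x => x
  | n + 1, x => f n (iter f n x)

/-- The effect of a command on the memory. -/
noncomputable def Cmd.run {F : Type u} [Field F] : Cmd → (ℕ → ℕ) → Mem F → Mem F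
  | .skip, _, μ => μ
  | .set a i x, ρ, μ => Mem.set μ a (i.eval ρ μ) (x.eval ρ μ)
  | .seq c d, ρ, μ => d.run ρ (c.run ρ μ)
  | .loop v N c, ρ, μ => iter (fun i μ' => c.run (Function.update ρ v i) μ') (N.eval ρ μ) μ

/-! ### Running programs with time bounds -/

/-- `Runs p σ B Q`: the program `p`, started in `σ`, halts after at most `B` steps in a state with
the property `Q`. -/
def Runs {F : Type*} [Field F] (p : Prog) (σ : State F) (B : ℕ) (Q : State F → Prop) : Prop :=
  ∃ τ T, Exec p σ τ T ∧ T ≤ B ∧ Q τ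

section Runs

variable {F : Type*} [Field F] {p q : Prog} {σ : State F} {B B' : ℕ} {Q Q' : State F → Prop}

theorem Runs.mono (h : Runs p σ B Q) (hB : B ≤ B') (hQ : ∀ τ, Q τ → Q' τ) : Runs p σ B' Q' := by
  obtain ⟨τ, T, h₁, h₂, h₃⟩ := h
  exact ⟨τ, T, h₁, h₂.trans hB, hQ _ h₃⟩

theorem Runs.seq (h : Runs p σ B Q) (h' : ∀ τ, Q τ → Runs q τ B' Q') :
    Runs (.seq p q) σ (B + B') Q' := by
  obtain ⟨τ, T, h₁, h₂, h₃⟩ := h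
  obtain ⟨υ, U, g₁, g₂, g₃⟩ := h' τ h₃
  exact ⟨υ, T + U, .seq h₁ g₁, add_le_add h₂ g₂, g₃⟩

theorem Runs.setNat {arr : ℕ} {idx val : NatExpr}
    (h : Q (σ.setNat arr (idx.eval σ) (val.eval σ))) :
    Runs (.setNat arr idx val) σ (idx.cost + val.cost + 1) Q :=
  ⟨_, _, .setNat arr idx val σ, le_rfl, h⟩

theorem Runs.setFld {arr : ℕ} {idx : NatExpr} {val : FldExpr}
    (h : Q (σ.setFld arr (idx.eval σ) (val.eval σ))) :
    Runs (.setFld arr idx val) σ (idx.cost + val.cost + 1) Q :=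
  ⟨_, _, .setFld arr idx val σ, le_rfl, h⟩

theorem Runs.ite {t : Test} (h : t.Holds σ → Runs p σ B Q) (h' : ¬ t.Holds σ → Runs q σ B Q) :
    Runs (.ite t p q) σ (t.cost + B) Q := by
  by_cases ht : t.Holds σ
  · obtain ⟨τ, T, h₁, h₂, h₃⟩ := h ht
    exact ⟨τ, _, .iteTrue ht h₁, by omega, h₃⟩
  · obtain ⟨τ, T, h₁, h₂, h₃⟩ := h' ht
    exact ⟨τ, _, .iteFalse ht h₁, by omega, h₃⟩

/-- The number of rounds is known beforehand: the invariant is indexed by the rounds done, and the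
test is equivalent to this index being below `N`. Halting, time bound and final state come from one
induction on the rounds left. -/
theorem Runs.while {t : Test} {N : ℕ} (I : ℕ → State F → Prop)
    (ht : ∀ i σ, I i σ → i ≤ N → (t.Holds σ ↔ i < N))
    (hp : ∀ i σ, I i σ → i < N → Runs p σ B (I (i + 1))) (h0 : I 0 σ) :
    Runs (.while t p) σ (N * (t.cost + B) + t.cost) (I N) := by
  have key : ∀ n i σ, i + n = N → I i σ → Runs (.while t p) σ (n * (t.cost + B) + t.cost) (I N) := by
    intro n
    induction n with
    | zero =>
      intro i σ hi hI
      obtain rfl : i = N := by omega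
      exact ⟨σ, _, .whileFalse (fun h => absurd ((ht i σ hI le_rfl).1 h) (lt_irrefl _)), by simp, hI⟩
    | succ n ih =>
      intro i σ hi hI
      obtain ⟨τ, T, h₁, h₂, h₃⟩ := hp i σ hI (by omega)
      obtain ⟨υ, U, g₁, g₂, g₃⟩ := ih (i + 1) τ (by omega) h₃
      refine ⟨υ, _, .whileTrue ((ht i σ hI (by omega)).2 (by omega)) h₁ g₁, ?_, g₃⟩
      rw [Nat.succ_mul]
      omega
  exact key N 0 σ (by omega) h0

end Runs

/-! ### Compilation

The variables of terms are the cells of natural number array `0`. Natural number array `2` and field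
array `3` are stacks for intermediate results, and the field arrays of commands are shifted to avoid
the latter. -/

/-- The field array of a state that holds array `a` of the memory of a command. -/
def fldArr (a : ℕ) : ℕ := if a < 3 then a else a + 1

theorem fldArr_injective : Function.Injective fldArr := by
  intro a b h
  unfold fldArr at h
  split_ifs at h <;> omega

theorem fldArr_ne (a : ℕ) : fldArr a ≠ 3 := by
  unfold fldArr
  split_ifs <;> omega

/-- The memory of commands that is represented by a state. -/
def view {F : Type*} (σ : State F) : Mem F := fun a => σ.fld (fldArr a)

/-- Two states agree, except for the stacks from height `t` on, and possibly for the variables and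
the memory. -/
structure SameStack {F : Type*} (t : ℕ) (σ τ : State F) : Prop where
  nat_one : τ.nat 1 = σ.nat 1
  nat_two : ∀ i < t, τ.nat 2 i = σ.nat 2 i
  fld_three : ∀ i < t, τ.fld 3 i = σ.fld 3 i

/-- Two states agree, except for the stacks from height `t` on. -/
structure Same {F : Type*} (t : ℕ) (σ τ : State F) : Prop extends SameStack t σ τ where
  nat_zero : τ.nat 0 = σ.nat 0
  view_eq : view τ = view σ

section Same

variable {F : Type*} {t t' : ℕ} {σ τ υ : State F}

theorem SameStack.refl : SameStack t σ σ := ⟨rfl, fun _ _ => rfl, fun _ _ => rfl⟩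

theorem SameStack.trans (h : SameStack t σ τ) (h' : SameStack t τ υ) : SameStack t σ υ :=
  ⟨h'.1.trans h.1, fun i hi => (h'.2 i hi).trans (h.2 i hi),
    fun i hi => (h'.3 i hi).trans (h.3 i hi)⟩

theorem SameStack.mono (h : SameStack t σ τ) (ht : t' ≤ t) : SameStack t' σ τ :=
  ⟨h.1, fun i hi => h.2 i (by omega), fun i hi => h.3 i (by omega)⟩

theorem Same.trans (h : Same t σ τ) (h' : Same t τ υ) : Same t σ υ :=
  ⟨h.1.trans h'.1, h'.2.trans h.2, h'.3.trans h.3⟩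

theorem Same.mono (h : Same t σ τ) (ht : t' ≤ t) : Same t' σ τ :=
  ⟨h.1.mono ht, h.2, h.3⟩

theorem Same.setNat {i v : ℕ} (hi : t ≤ i) : Same t σ (σ.setNat 2 i v) := by
  refine ⟨⟨by simp [State.setNat], fun j hj => ?_, fun j hj => rfl⟩, by simp [State.setNat], rfl⟩
  simp [State.setNat, show j ≠ i by omega]

theorem Same.setFld {i : ℕ} {v : F} (hi : t ≤ i) : Same t σ (σ.setFld 3 i v) := by
  refine ⟨⟨rfl, fun j hj => rfl, fun j hj => ?_⟩, rfl, ?_⟩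
  · simp [State.setFld, show j ≠ i by omega]
  · funext a
    simp [view, State.setFld, fldArr_ne]

theorem SameStack.setVar {i v : ℕ} : SameStack t σ (σ.setNat 0 i v) :=
  ⟨by simp [State.setNat], fun j hj => by simp [State.setNat], fun j hj => rfl⟩

theorem SameStack.setMem {a i : ℕ} {x : F} : SameStack t σ (σ.setFld (fldArr a) i x) :=
  ⟨rfl, fun j hj => rfl, fun j hj => by simp [State.setFld, (fldArr_ne a).symm]⟩

theorem view_setFld {a i : ℕ} {x : F} :
    view (σ.setFld (fldArr a) i x) = Mem.set (view σ) a i x := by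
  funext b
  by_cases h : b = a
  · subst h
    simp [view, State.setFld, Mem.set]
  · simp [view, State.setFld, Mem.set, h, fldArr_injective.ne h]

@[simp] theorem setNat_nat_zero_same {i v : ℕ} :
    (σ.setNat 0 i v).nat 0 = Function.update (σ.nat 0) i v := by simp [State.setNat]

@[simp] theorem setNat_nat_two_same {i v : ℕ} : (σ.setNat 2 i v).nat 2 i = v := by
  simp [State.setNat]

theorem setNat_nat_two_ne {i j v : ℕ} (h : j ≠ i) : (σ.setNat 2 i v).nat 2 j = σ.nat 2 j := by
  simp [State.setNat, h]

@[simp] theorem setNat_zero_nat_two {i v : ℕ} : (σ.setNat 0 i v).nat 2 = σ.nat 2 := by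
  simp [State.setNat]

@[simp] theorem setFld_nat {a i : ℕ} {v : F} : (σ.setFld a i v).nat = σ.nat := rfl

@[simp] theorem setFld_three_same {i : ℕ} {v : F} : (σ.setFld 3 i v).fld 3 i = v := by
  simp [State.setFld]

@[simp] theorem view_setNat {a i v : ℕ} : view (σ.setNat a i v) = view σ := rfl

end Same

/-- As `X ≥ 2`, constant factors can be absorbed into the exponent. All time bounds thus keep the
pure form `X ^ e`, which is stable under composition. -/
theorem le_pow_add_of_le_mul {X T A c e : ℕ} (hX : 2 ≤ X) (hA : A ≤ 2 ^ e) (h : T ≤ A * X ^ c) :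
    T ≤ X ^ (c + e) := by
  calc T ≤ A * X ^ c := h
    _ ≤ X ^ e * X ^ c := Nat.mul_le_mul_right _ (hA.trans (Nat.pow_le_pow_left hX e))
    _ = X ^ (c + e) := by rw [pow_add, mul_comm]

/-- Some program evaluates the term in polynomial time. -/
def NTm.Good (e : NTm) : Prop :=
  ∀ t : ℕ, ∃ (p : Prog) (c : ℕ), ∀ (F : Type u) [Field F] (σ : State F) (X : ℕ), 2 ≤ X →
    (∀ v, σ.nat 0 v ≤ X) → e.eval (σ.nat 0) (view σ) ≤ X ^ c ∧
      Runs p σ (X ^ c) fun τ => Same t σ τ ∧ τ.nat 2 t = e.eval (σ.nat 0) (view σ)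

/-- Some program evaluates the term in polynomial time. -/
def FTm.Good (e : FTm) : Prop :=
  ∀ t : ℕ, ∃ (p : Prog) (c : ℕ), ∀ (F : Type u) [Field F] (σ : State F) (X : ℕ), 2 ≤ X →
    (∀ v, σ.nat 0 v ≤ X) →
      Runs p σ (X ^ c) fun τ => Same t σ τ ∧ τ.fld 3 t = e.eval (σ.nat 0) (view σ)

/-- Cell `t` of the natural number stack. -/
def natCell (t : ℕ) : NatExpr := .load 2 (.const t)

/-- Cell `t` of the field stack. -/
def fldCell (t : ℕ) : FldExpr := .load 3 (.const t)

/-- Write cell `t` of the natural number stack. -/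
def setNatCell (t : ℕ) (e : NatExpr) : Prog := .setNat 2 (.const t) e

/-- Write cell `t` of the field stack. -/
def setFldCell (t : ℕ) (e : FldExpr) : Prog := .setFld 3 (.const t) e

@[simp] theorem natCell_eval {F : Type*} (σ : State F) (t : ℕ) :
    (natCell t).eval σ = σ.nat 2 t := rfl

@[simp] theorem fldCell_eval {F : Type*} [Field F] (σ : State F) (t : ℕ) :
    (fldCell t).eval σ = σ.fld 3 t := rfl

@[simp] theorem natCell_cost (t : ℕ) : (natCell t).cost = 2 := rfl

@[simp] theorem fldCell_cost (t : ℕ) : (fldCell t).cost = 2 := rfl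

theorem Runs.setNatCell {F : Type*} [Field F] {σ : State F} {t : ℕ} {e : NatExpr}
    {Q : State F → Prop} (h : Q (σ.setNat 2 t (e.eval σ))) :
    Runs (setNatCell t e) σ (e.cost + 2) Q :=
  (Runs.setNat (idx := .const t) h).mono (by simp [NatExpr.cost]; omega) fun _ => id

theorem Runs.setFldCell {F : Type*} [Field F] {σ : State F} {t : ℕ} {e : FldExpr}
    {Q : State F → Prop} (h : Q (σ.setFld 3 t (e.eval σ))) :
    Runs (setFldCell t e) σ (e.cost + 2) Q :=
  (Runs.setFld (idx := .const t) h).mono (by simp [NatExpr.cost]; omega) fun _ => id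

theorem NTm.Good.const (n : ℕ) : NTm.Good.{u} (NTm.const n) := by
  intro t
  refine ⟨setNatCell t (.const n), n + 3, fun F _ σ X hX _ => ⟨?_, ?_⟩⟩
  · rw [NTm.eval_const]
    calc n ≤ 2 ^ n := Nat.lt_two_pow_self.le
      _ ≤ X ^ n := Nat.pow_le_pow_left hX n
      _ ≤ _ := Nat.pow_le_pow_right (by omega) (by omega)
  · refine Runs.mono (B := 3) (Runs.setNatCell (e := .const n) ?_) ?_ fun _ => id
    · exact ⟨.setNat le_rfl, by simp [NatExpr.eval]⟩
    · calc 3 ≤ 2 ^ (n + 3) := by have := Nat.one_le_two_pow (n := n); rw [pow_add]; omega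
        _ ≤ _ := Nat.pow_le_pow_left hX _

theorem NTm.Good.var (v : ℕ) : NTm.Good.{u} (NTm.var v) := by
  intro t
  refine ⟨setNatCell t (.load 0 (.const v)), 3, fun F _ σ X hX hv => ⟨?_, ?_⟩⟩
  · rw [NTm.eval_var]
    exact (hv v).trans (Nat.le_self_pow (by norm_num) X)
  · refine Runs.mono (Runs.setNatCell (e := .load 0 (.const v)) ?_) ?_ fun _ => id
    · exact ⟨.setNat le_rfl, by simp [NatExpr.eval]⟩
    · exact le_trans (by simp [NatExpr.cost]) (Nat.pow_le_pow_left hX 3)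

/-- Evaluation of a term that is a binary operation on natural numbers. -/
theorem NTm.Good.bin {e a b : NTm} (ha : NTm.Good.{u} a) (hb : NTm.Good.{u} b) (op : ℕ → ℕ → ℕ)
    (he : ∀ (F : Type u) [Field F] (ρ : ℕ → ℕ) (μ : Mem F),
      e.eval ρ μ = op (a.eval ρ μ) (b.eval ρ μ))
    (q : ℕ → Prog) (c : ℕ)
    (hq : ∀ (t : ℕ) (F : Type u) [Field F] (σ : State F) (X : ℕ), 2 ≤ X → σ.nat 2 t ≤ X →
      σ.nat 2 (t + 1) ≤ X → op (σ.nat 2 t) (σ.nat 2 (t + 1)) ≤ X ^ c ∧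
        Runs (q t) σ (X ^ c) fun τ =>
          Same t σ τ ∧ τ.nat 2 t = op (σ.nat 2 t) (σ.nat 2 (t + 1))) : NTm.Good.{u} e := by
  intro t
  obtain ⟨p₁, c₁, h₁⟩ := ha t
  obtain ⟨p₂, c₂, h₂⟩ := hb (t + 1)
  -- Both operands are at most `X ^ m`, so the program of the operation is run with `X ^ m` in the
  -- role of `X`. The summand `1` ensures that `X ^ m ≥ 2`.
  set m := c₁ + c₂ + 1 with hm
  refine ⟨.seq p₁ (.seq p₂ (q t)), m + m * c + 2, fun F _ σ X hX hv => ?_⟩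
  obtain ⟨v₁, r₁⟩ := h₁ F σ X hX hv
  obtain ⟨v₂, -⟩ := h₂ F σ X hX hv
  have hX1 : 1 ≤ X := by omega
  have hXm : 2 ≤ X ^ m := hX.trans (Nat.le_self_pow (by omega) X)
  have e₁ : X ^ c₁ ≤ X ^ m := Nat.pow_le_pow_right hX1 (by omega)
  have e₂ : X ^ c₂ ≤ X ^ m := Nat.pow_le_pow_right hX1 (by omega)
  have hop : ∀ (τ : State F), τ.nat 2 t = a.eval (σ.nat 0) (view σ) →
      τ.nat 2 (t + 1) = b.eval (σ.nat 0) (view σ) →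
      op (τ.nat 2 t) (τ.nat 2 (t + 1)) ≤ (X ^ m) ^ c ∧
        Runs (q t) τ ((X ^ m) ^ c) fun υ =>
          Same t τ υ ∧ υ.nat 2 t = op (τ.nat 2 t) (τ.nat 2 (t + 1)) := by
    intro τ g₁ g₂
    exact hq t F τ (X ^ m) hXm (g₁ ▸ v₁.trans e₁) (g₂ ▸ v₂.trans e₂)
  have run : Runs (.seq p₁ (.seq p₂ (q t))) σ (X ^ c₁ + (X ^ c₂ + (X ^ m) ^ c)) fun τ =>
      (Same t σ τ ∧ τ.nat 2 t = e.eval (σ.nat 0) (view σ)) ∧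
        e.eval (σ.nat 0) (view σ) ≤ (X ^ m) ^ c := by
    refine r₁.seq fun τ ⟨s₁, g₁⟩ => ?_
    have := (h₂ F τ X hX (by rw [s₁.nat_zero]; exact hv)).2
    rw [s₁.nat_zero, s₁.view_eq] at this
    refine this.seq fun υ ⟨s₂, g₂⟩ => ?_
    have g₁' : υ.nat 2 t = a.eval (σ.nat 0) (view σ) := by rw [s₂.nat_two t (by omega), g₁]
    obtain ⟨b₁, r₃⟩ := hop υ g₁' g₂
    refine r₃.mono le_rfl fun ω ⟨s₃, g₃⟩ => ?_
    rw [g₁', g₂, ← he] at g₃ b₁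
    exact ⟨⟨s₁.trans ((s₂.mono (by omega)).trans s₃), g₃⟩, b₁⟩
  have e₃ : X ^ m ≤ X ^ (m + m * c) := Nat.pow_le_pow_right hX1 (by omega)
  have e₄ : (X ^ m) ^ c ≤ X ^ (m + m * c) := by
    rw [← pow_mul]; exact Nat.pow_le_pow_right hX1 (by omega)
  refine ⟨?_, run.mono ?_ fun _ h => h.1⟩
  · obtain ⟨_, _, -, -, -, h⟩ := run
    exact h.trans (e₄.trans (Nat.pow_le_pow_right hX1 (by omega)))
  · exact le_pow_add_of_le_mul (A := 3) hX (by norm_num) (by omega)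

/-- For operations that the machine has as expressions and that do not exceed the sum of the
operands. -/
theorem NTm.Good.bin_expr {e a b : NTm} (ha : NTm.Good.{u} a) (hb : NTm.Good.{u} b) (op : ℕ → ℕ → ℕ)
    (he : ∀ (F : Type u) [Field F] (ρ : ℕ → ℕ) (μ : Mem F),
      e.eval ρ μ = op (a.eval ρ μ) (b.eval ρ μ))
    (hop : ∀ x y, op x y ≤ x + y) (E : ℕ → NatExpr) (hc : ∀ t, (E t).cost ≤ 5)
    (hE : ∀ (t : ℕ) (F : Type u) [Field F] (σ : State F),
      (E t).eval σ = op (σ.nat 2 t) (σ.nat 2 (t + 1))) : NTm.Good.{u} e := by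
  refine NTm.Good.bin ha hb op he (fun t => setNatCell t (E t)) 3 fun t F _ σ X hX h₁ h₂ => ⟨?_, ?_⟩
  · calc op _ _ ≤ X + X := (hop _ _).trans (add_le_add h₁ h₂)
      _ ≤ X ^ 3 := by nlinarith [Nat.pow_le_pow_left hX 2]
  · refine Runs.mono (Runs.setNatCell (Q := fun τ => Same t σ τ ∧ _) ⟨.setNat le_rfl, ?_⟩) ?_
      fun _ => id
    · simp [hE]
    · have := hc t
      have := Nat.pow_le_pow_left hX 3
      omega

theorem NTm.Good.add {a b : NTm} (ha : NTm.Good.{u} a) (hb : NTm.Good.{u} b) : NTm.Good.{u} (NTm.add a b) :=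
  .bin_expr ha hb (· + ·) (fun _ _ _ _ => by simp) (fun _ _ => le_rfl)
    (fun t => .add (natCell t) (natCell (t + 1))) (fun _ => le_rfl) fun _ _ _ _ => rfl

theorem NTm.Good.sub {a b : NTm} (ha : NTm.Good.{u} a) (hb : NTm.Good.{u} b) : NTm.Good.{u} (NTm.sub a b) :=
  .bin_expr ha hb (· - ·) (fun _ _ _ _ => by simp) (fun _ _ => by omega)
    (fun t => .sub (natCell t) (natCell (t + 1))) (fun _ => le_rfl) fun _ _ _ _ => rfl

/-- The machine cannot multiply natural numbers. Repeated addition is affordable because the number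
of rounds is the value of `b`, which is polynomially bounded. -/
theorem NTm.Good.mul {a b : NTm} (ha : NTm.Good.{u} a) (hb : NTm.Good.{u} b) : NTm.Good.{u} (NTm.mul a b) := by
  refine .bin ha hb (· * ·) (fun _ _ _ _ => by simp)
    (fun t => .seq (setNatCell (t + 2) (.const 0)) (.seq
      (.while (.natLt (.const 0) (natCell (t + 1))) (.seq
        (setNatCell (t + 2) (.add (natCell (t + 2)) (natCell t)))
        (setNatCell (t + 1) (.sub (natCell (t + 1)) (.const 1)))))
      (setNatCell t (natCell (t + 2))))) 6 fun t F _ σ X hX h₁ h₂ => ⟨?_, ?_⟩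
  · calc _ ≤ X * X := Nat.mul_le_mul h₁ h₂
      _ = X ^ 2 := (sq X).symm
      _ ≤ _ := Nat.pow_le_pow_right (by omega) (by omega)
  · let I : ℕ → State F → Prop := fun i τ => Same t σ τ ∧ τ.nat 2 t = σ.nat 2 t ∧
      τ.nat 2 (t + 1) = σ.nat 2 (t + 1) - i ∧ τ.nat 2 (t + 2) = σ.nat 2 t * i
    have key := Runs.seq (F := F) (σ := σ) (Q := I 0) (B := 3)
      (Runs.setNatCell (t := t + 2) (e := .const 0) ⟨.setNat (by omega),
        setNat_nat_two_ne (by omega), setNat_nat_two_ne (by omega), by simp [NatExpr.eval]⟩)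
      fun τ hτ => Runs.seq (Runs.while (N := σ.nat 2 (t + 1)) (B := 7 + 6)
        (t := .natLt (.const 0) (natCell (t + 1)))
        (p := (.seq
        (setNatCell (t + 2) (.add (natCell (t + 2)) (natCell t)))
        (setNatCell (t + 1) (.sub (natCell (t + 1)) (.const 1))))) I ?_ ?_ hτ)
        fun υ hυ => Runs.setNatCell (t := t) (e := natCell (t + 2))
          (Q := fun ω => Same t σ ω ∧ ω.nat 2 t = σ.nat 2 t * σ.nat 2 (t + 1))
          ⟨hυ.1.trans (.setNat le_rfl), by
            rw [setNat_nat_two_same, natCell_eval]; exact hυ.2.2.2⟩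
    · refine key.mono ?_ fun _ => id
      simp only [Test.cost, NatExpr.cost, natCell_cost]
      calc _ ≤ X * 17 + 11 := by omega
        _ ≤ X ^ 6 := by nlinarith [Nat.pow_le_pow_left hX 5, pow_succ X 5]
    · rintro i τ ⟨-, -, h, -⟩ hi
      simp only [Test.Holds, NatExpr.eval, natCell_eval, h]
      omega
    · rintro i τ ⟨hs, g₁, g₂, g₃⟩ hi
      refine Runs.seq (Q := fun υ => Same t σ υ ∧ υ.nat 2 t = σ.nat 2 t ∧
        υ.nat 2 (t + 1) = σ.nat 2 (t + 1) - i ∧ υ.nat 2 (t + 2) = σ.nat 2 t * (i + 1))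
        (Runs.setNatCell ⟨hs.trans (.setNat (by omega)), ?_, ?_, ?_⟩) ?_
      · rw [setNat_nat_two_ne (by omega), g₁]
      · rw [setNat_nat_two_ne (by omega), g₂]
      · simp [NatExpr.eval, g₁, g₃, mul_add]
      · rintro υ ⟨hs, g₁, g₂, g₃⟩
        refine Runs.setNatCell (Q := I (i + 1)) ⟨hs.trans (.setNat (by omega)), ?_, ?_, ?_⟩
        · rw [setNat_nat_two_ne (by omega), g₁]
        · simp [NatExpr.eval, g₂, Nat.sub_sub]
        · rw [setNat_nat_two_ne (by omega), g₃]

/-- Division with remainder by repeated subtraction. -/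
def divModProg (t : ℕ) : Prog :=
  .seq (setNatCell (t + 2) (.const 0)) (.ite (.natLt (.const 0) (natCell (t + 1)))
    (.while (.not (.natLt (natCell t) (natCell (t + 1)))) (.seq
      (setNatCell t (.sub (natCell t) (natCell (t + 1))))
      (setNatCell (t + 2) (.add (natCell (t + 2)) (.const 1))))) .skip)

/-- The number of rounds is the quotient, hence at most the dividend. For divisor zero the loop is
skipped, which leaves quotient `0` and the dividend as remainder, in accordance with the conventions
for `/` and `%`. -/
theorem runs_divModProg (t : ℕ) {F : Type*} [Field F] (σ : State F) :
    Runs (divModProg t) σ (19 * (σ.nat 2 t + 1)) fun τ => Same t σ τ ∧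
      τ.nat 2 t = σ.nat 2 t % σ.nat 2 (t + 1) ∧ τ.nat 2 (t + 2) = σ.nat 2 t / σ.nat 2 (t + 1) := by
  let I : ℕ → State F → Prop := fun i τ => Same t σ τ ∧
    τ.nat 2 t = σ.nat 2 t - i * σ.nat 2 (t + 1) ∧
      τ.nat 2 (t + 1) = σ.nat 2 (t + 1) ∧ τ.nat 2 (t + 2) = i
  refine Runs.mono (Runs.seq (Q := I 0) (B := 3) (B' := 4 + (σ.nat 2 t * (6 + 13) + 6))
    (Runs.setNatCell (t := t + 2) (e := .const 0) ⟨.setNat (by omega), ?_, ?_, ?_⟩)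
    fun τ hτ => Runs.ite (t := .natLt (.const 0) (natCell (t + 1))) ?_ ?_) (by omega) fun _ => id
  · rw [setNat_nat_two_ne (by omega)]; simp
  · rw [setNat_nat_two_ne (by omega)]
  · simp [NatExpr.eval]
  · intro hpos
    simp only [Test.Holds, NatExpr.eval, natCell_eval, hτ.2.2.1] at hpos
    have hdm := Nat.div_add_mod (σ.nat 2 t) (σ.nat 2 (t + 1))
    have hml := Nat.mod_lt (σ.nat 2 t) hpos
    refine (Runs.while (N := σ.nat 2 t / σ.nat 2 (t + 1)) (B := 13) I ?_ ?_ hτ).mono ?_ ?_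
    · rintro i τ ⟨-, h₁, h₂, -⟩ hi
      simp only [Test.Holds, natCell_eval, h₁, h₂, not_lt]
      have hle : i * σ.nat 2 (t + 1) ≤ σ.nat 2 t := (Nat.le_div_iff_mul_le hpos).1 hi
      rw [Nat.le_sub_iff_add_le hle, ← Nat.succ_le_iff, Nat.le_div_iff_mul_le hpos, Nat.succ_mul,
        add_comm]
    · rintro i τ ⟨hs, g₁, g₂, g₃⟩ hi
      refine Runs.mono (Runs.seq (B := 7) (B' := 6) (Q := fun υ => Same t σ υ ∧
        υ.nat 2 t = σ.nat 2 t - (i + 1) * σ.nat 2 (t + 1) ∧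
        υ.nat 2 (t + 1) = σ.nat 2 (t + 1) ∧ υ.nat 2 (t + 2) = i)
        (Runs.setNatCell ⟨hs.trans (.setNat (by omega)), ?_, ?_, ?_⟩) ?_) (by omega) fun _ => id
      · simp [NatExpr.eval, g₁, g₂, Nat.sub_sub, Nat.succ_mul]
      · rw [setNat_nat_two_ne (by omega), g₂]
      · rw [setNat_nat_two_ne (by omega), g₃]
      · rintro υ ⟨hs, g₁, g₂, g₃⟩
        refine Runs.setNatCell (Q := I (i + 1)) ⟨hs.trans (.setNat (by omega)), ?_, ?_, ?_⟩
        · rw [setNat_nat_two_ne (by omega), g₁]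
        · rw [setNat_nat_two_ne (by omega), g₂]
        · simp [NatExpr.eval, g₃]
    · simp only [Test.cost, natCell_cost]
      have := Nat.div_le_self (σ.nat 2 t) (σ.nat 2 (t + 1))
      omega
    · rintro υ ⟨hs, g₁, g₂, g₃⟩
      refine ⟨hs, ?_, g₃⟩
      rw [g₁, mul_comm]
      omega
  · intro hpos
    simp only [Test.Holds, NatExpr.eval, natCell_eval, hτ.2.2.1] at hpos
    refine ⟨τ, 1, .skip τ, by omega, hτ.1, ?_, ?_⟩
    · rw [hτ.2.1, show σ.nat 2 (t + 1) = 0 by omega]; simp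
    · rw [hτ.2.2.2, show σ.nat 2 (t + 1) = 0 by omega]; simp

theorem NTm.Good.mod {a b : NTm} (ha : NTm.Good.{u} a) (hb : NTm.Good.{u} b) : NTm.Good.{u} (NTm.mod a b) := by
  refine .bin ha hb (· % ·) (fun _ _ _ _ => by simp) divModProg 6
    fun t F _ σ X hX h₁ h₂ => ⟨?_, ?_⟩
  · exact (Nat.mod_le _ _).trans (h₁.trans (Nat.le_self_pow (by norm_num) X))
  · refine (runs_divModProg t σ).mono ?_ fun τ h => ⟨h.1, h.2.1⟩
    calc _ ≤ 19 * (X + 1) := by omega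
      _ ≤ X ^ 6 := by nlinarith [Nat.pow_le_pow_left hX 5, pow_succ X 5]

theorem NTm.Good.div {a b : NTm} (ha : NTm.Good.{u} a) (hb : NTm.Good.{u} b) : NTm.Good.{u} (NTm.div a b) := by
  refine .bin ha hb (· / ·) (fun _ _ _ _ => by simp)
    (fun t => .seq (divModProg t) (setNatCell t (natCell (t + 2)))) 7
    fun t F _ σ X hX h₁ h₂ => ⟨?_, ?_⟩
  · exact (Nat.div_le_self _ _).trans (h₁.trans (Nat.le_self_pow (by norm_num) X))
  · refine ((runs_divModProg t σ).seq (B' := 4) (Q' := fun τ => Same t σ τ ∧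
      τ.nat 2 t = σ.nat 2 t / σ.nat 2 (t + 1)) fun τ h =>
      Runs.setNatCell ⟨h.1.trans (.setNat le_rfl), by
        rw [setNat_nat_two_same, natCell_eval]; exact h.2.2⟩).mono ?_ fun _ => id
    calc _ ≤ 19 * (X + 1) + 4 := by omega
      _ ≤ X ^ 7 := by nlinarith [Nat.pow_le_pow_left hX 6, pow_succ X 6]

theorem NTm.Good.lt {a b : NTm} (ha : NTm.Good.{u} a) (hb : NTm.Good.{u} b) : NTm.Good.{u} (NTm.lt a b) := by
  refine .bin ha hb (fun x y => if x < y then 1 else 0) (fun _ _ _ _ => by simp)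
    (fun t => .ite (.natLt (natCell t) (natCell (t + 1))) (setNatCell t (.const 1))
      (setNatCell t (.const 0))) 4 fun t F _ σ X hX h₁ h₂ => ⟨?_, ?_⟩
  · have := Nat.one_le_pow 4 X (by omega)
    split_ifs <;> omega
  · refine Runs.mono (B := 5 + 3) (Runs.ite ?_ ?_) ?_ fun _ => id
    · intro h
      refine Runs.setNatCell (e := .const 1) ⟨.setNat le_rfl, ?_⟩
      simpa [Test.Holds, NatExpr.eval] using h
    · intro h
      refine Runs.setNatCell (e := .const 0) ⟨.setNat le_rfl, ?_⟩
      simpa [Test.Holds, NatExpr.eval] using h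
    · exact le_trans (by norm_num) (Nat.pow_le_pow_left hX 4)

/-! ### Compilation of conditionals, sums and field operations -/

theorem NTm.Good.ite {c a b : NTm} (hc : NTm.Good.{u} c) (ha : NTm.Good.{u} a)
    (hb : NTm.Good.{u} b) : NTm.Good.{u} (NTm.ite c a b) := by
  intro t
  obtain ⟨p₀, c₀, h₀⟩ := hc t
  obtain ⟨p₁, c₁, h₁⟩ := ha t
  obtain ⟨p₂, c₂, h₂⟩ := hb t
  refine ⟨.seq p₀ (.ite (.natLt (.const 0) (natCell t)) p₁ p₂), c₀ + c₁ + c₂ + 3,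
    fun F _ σ X hX hv => ?_⟩
  obtain ⟨-, r₀⟩ := h₀ F σ X hX hv
  have e₀ : X ^ c₀ ≤ X ^ (c₀ + c₁ + c₂) := Nat.pow_le_pow_right (by omega) (by omega)
  have e₁ : X ^ c₁ ≤ X ^ (c₀ + c₁ + c₂) := Nat.pow_le_pow_right (by omega) (by omega)
  have e₂ : X ^ c₂ ≤ X ^ (c₀ + c₁ + c₂) := Nat.pow_le_pow_right (by omega) (by omega)
  have e₃ : X ^ (c₀ + c₁ + c₂) ≤ X ^ (c₀ + c₁ + c₂ + 3) :=
    Nat.pow_le_pow_right (by omega) (by omega)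
  have e₄ : 1 ≤ X ^ (c₀ + c₁ + c₂) := Nat.one_le_pow _ _ (by omega)
  refine ⟨?_, (r₀.seq (B' := 4 + X ^ (c₀ + c₁ + c₂)) fun τ ⟨s₁, g₁⟩ =>
    Runs.ite (t := .natLt (.const 0) (natCell t)) ?_ ?_).mono
    (le_pow_add_of_le_mul (A := 6) hX (by norm_num) (by omega)) fun _ => id⟩
  · have := (h₁ F σ X hX hv).1
    have := (h₂ F σ X hX hv).1
    rw [NTm.eval_ite]
    split_ifs <;> omega
  · intro h
    simp only [Test.Holds, NatExpr.eval, natCell_eval, g₁] at h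
    have := (h₁ F τ X hX (by rw [s₁.nat_zero]; exact hv)).2
    rw [s₁.nat_zero, s₁.view_eq] at this
    refine this.mono e₁ fun υ ⟨s₂, g₂⟩ => ⟨s₁.trans s₂, ?_⟩
    rw [NTm.eval_ite, if_neg (by omega), g₂]
  · intro h
    simp only [Test.Holds, NatExpr.eval, natCell_eval, g₁] at h
    have := (h₂ F τ X hX (by rw [s₁.nat_zero]; exact hv)).2
    rw [s₁.nat_zero, s₁.view_eq] at this
    refine this.mono e₂ fun υ ⟨s₂, g₂⟩ => ⟨s₁.trans s₂, ?_⟩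
    rw [NTm.eval_ite, if_pos (by omega), g₂]

theorem FTm.Good.ite {c : NTm} {a b : FTm} (hc : NTm.Good.{u} c) (ha : FTm.Good.{u} a)
    (hb : FTm.Good.{u} b) : FTm.Good.{u} (FTm.ite c a b) := by
  intro t
  obtain ⟨p₀, c₀, h₀⟩ := hc t
  obtain ⟨p₁, c₁, h₁⟩ := ha t
  obtain ⟨p₂, c₂, h₂⟩ := hb t
  refine ⟨.seq p₀ (.ite (.natLt (.const 0) (natCell t)) p₁ p₂), c₀ + c₁ + c₂ + 3,
    fun F _ σ X hX hv => ?_⟩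
  obtain ⟨-, r₀⟩ := h₀ F σ X hX hv
  have e₀ : X ^ c₀ ≤ X ^ (c₀ + c₁ + c₂) := Nat.pow_le_pow_right (by omega) (by omega)
  have e₁ : X ^ c₁ ≤ X ^ (c₀ + c₁ + c₂) := Nat.pow_le_pow_right (by omega) (by omega)
  have e₂ : X ^ c₂ ≤ X ^ (c₀ + c₁ + c₂) := Nat.pow_le_pow_right (by omega) (by omega)
  have e₄ : 1 ≤ X ^ (c₀ + c₁ + c₂) := Nat.one_le_pow _ _ (by omega)
  refine (r₀.seq (B' := 4 + X ^ (c₀ + c₁ + c₂)) fun τ ⟨s₁, g₁⟩ =>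
    Runs.ite (t := .natLt (.const 0) (natCell t)) ?_ ?_).mono
    (le_pow_add_of_le_mul (A := 6) hX (by norm_num) (by omega)) fun _ => id
  · intro h
    simp only [Test.Holds, NatExpr.eval, natCell_eval, g₁] at h
    have := h₁ F τ X hX (by rw [s₁.nat_zero]; exact hv)
    rw [s₁.nat_zero, s₁.view_eq] at this
    refine this.mono e₁ fun υ ⟨s₂, g₂⟩ => ⟨s₁.trans s₂, ?_⟩
    rw [FTm.eval_ite, if_neg (by omega), g₂]
  · intro h
    simp only [Test.Holds, NatExpr.eval, natCell_eval, g₁] at h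
    have := h₂ F τ X hX (by rw [s₁.nat_zero]; exact hv)
    rw [s₁.nat_zero, s₁.view_eq] at this
    refine this.mono e₂ fun υ ⟨s₂, g₂⟩ => ⟨s₁.trans s₂, ?_⟩
    rw [FTm.eval_ite, if_pos (by omega), g₂]

/-- Run `p` for all values of the variable `v` below the number in cell `t + 1` of the stack, keeping
the saved value of `v` and the counter in cells `t + 2` and `t + 3`. -/
def forProg (t v : ℕ) (p : Prog) : Prog :=
  .seq (setNatCell (t + 2) (.load 0 (.const v))) (.seq (setNatCell (t + 3) (.const 0)) (.seq
    (.while (.natLt (natCell (t + 3)) (natCell (t + 1))) (.seq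
      (.setNat 0 (.const v) (natCell (t + 3))) (.seq p
        (setNatCell (t + 3) (.add (natCell (t + 3)) (.const 1))))))
    (.setNat 0 (.const v) (natCell (t + 2)))))

/-- Loop rule: `I i` holds after `i` rounds, apart from the bookkeeping. -/
theorem runs_forProg {F : Type*} [Field F] {t v N B : ℕ} {p : Prog} {σ : State F}
    (I : ℕ → State F → Prop) (hN : σ.nat 2 (t + 1) = N)
    (hI : ∀ i τ j w, t < j → I i τ → I i (τ.setNat 2 j w))
    (hI' : ∀ i τ w, I i τ → I i (τ.setNat 0 v w)) (h0 : I 0 σ)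
    (hp : ∀ i τ, i < N → SameStack t σ τ → τ.nat 0 = Function.update (σ.nat 0) v i → I i τ →
      Runs p τ B fun υ => SameStack t τ υ ∧ υ.nat 0 = τ.nat 0 ∧
        (∀ j, t < j → j < t + 4 → υ.nat 2 j = τ.nat 2 j) ∧ I (i + 1) υ) :
    Runs (forProg t v p) σ ((N + 1) * (B + 16)) fun τ =>
      SameStack t σ τ ∧ τ.nat 0 = σ.nat 0 ∧ I N τ := by
  -- Cell `t` is left to an accumulator of the body; the bookkeeping occupies the three cells above
  -- it, so the body has to work from `t + 4` on.
  let J : ℕ → State F → Prop := fun i τ => SameStack t σ τ ∧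
    (∃ w, τ.nat 0 = Function.update (σ.nat 0) v w) ∧ τ.nat 2 (t + 1) = N ∧
      τ.nat 2 (t + 2) = σ.nat 0 v ∧ τ.nat 2 (t + 3) = i ∧ I i τ
  refine Runs.mono (B := 4 + (3 + ((N * (5 + (4 + (B + 6))) + 5) + 4)))
    (Runs.seq (Q := fun τ => Same t σ τ ∧ τ.nat 2 (t + 1) = N ∧ τ.nat 2 (t + 2) = σ.nat 0 v ∧ I 0 τ)
      (Runs.setNatCell ⟨.setNat (by omega), ?_, ?_, ?_⟩) ?_) ?_ fun _ => id
  · rw [setNat_nat_two_ne (by omega), hN]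
  · simp [NatExpr.eval]
  · exact hI _ _ _ _ (by omega) h0
  · rintro τ ⟨s, g₁, g₂, g₃⟩
    refine Runs.seq (Q := J 0) (Runs.setNatCell (e := .const 0)
      ⟨(s.trans (.setNat (by omega))).1, ⟨σ.nat 0 v, ?_⟩, ?_, ?_, ?_, ?_⟩) ?_
    · rw [Function.update_eq_self]
      exact (s.trans (.setNat (show t ≤ t + 3 by omega))).nat_zero
    · rw [setNat_nat_two_ne (by omega), g₁]
    · rw [setNat_nat_two_ne (by omega), g₂]
    · simp [NatExpr.eval]
    · exact hI _ _ _ _ (by omega) g₃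
    · intro τ hτ
      refine Runs.seq (Runs.while (B := 4 + (B + 6)) (N := N) J ?_ ?_ hτ) ?_
      · rintro i τ ⟨-, -, h₁, -, h₂, -⟩ hi
        simp only [Test.Holds, natCell_eval, h₁, h₂]
      · rintro i τ ⟨s, ⟨w, g₀⟩, g₁, g₂, g₃, g₄⟩ hi
        refine Runs.seq (Q := fun υ => SameStack t σ υ ∧ υ.nat 0 = Function.update (σ.nat 0) v i ∧
          υ.nat 2 = τ.nat 2 ∧ I i υ)
          (Runs.setNat ⟨s.trans .setVar, ?_, ?_, hI' _ _ _ g₄⟩) ?_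
        · simp [NatExpr.eval, g₀, g₃]
        · simp
        · rintro υ ⟨s', k₀, k₁, k₄⟩
          refine (hp i υ hi s' k₀ k₄).seq ?_
          rintro ω ⟨s'', l₀, l₁, l₄⟩
          refine Runs.setNatCell (e := .add (natCell (t + 3)) (.const 1)) (Q := J (i + 1))
            ⟨s'.trans (s''.trans (Same.setNat (by omega)).1), ⟨i, ?_⟩, ?_, ?_, ?_,
              hI _ _ _ _ (by omega) l₄⟩
          · rw [← k₀, ← l₀]
            exact (Same.setNat (show t ≤ t + 3 by omega)).nat_zero
          · rw [setNat_nat_two_ne (by omega), l₁ _ (by omega) (by omega), k₁, g₁]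
          · rw [setNat_nat_two_ne (by omega), l₁ _ (by omega) (by omega), k₁, g₂]
          · simp [NatExpr.eval, l₁ (t + 3) (by omega) (by omega), k₁, g₃]
      · rintro υ ⟨s, ⟨w, g₀⟩, g₁, g₂, g₃, g₄⟩
        refine Runs.setNat ⟨s.trans .setVar, ?_, hI' _ _ _ g₄⟩
        simp [NatExpr.eval, g₀, g₂]
  · nlinarith

/-- A sum has polynomially many summands, each evaluated with a polynomially bounded value of `v`,
so nesting of sums merely enlarges the exponent. -/
theorem NTm.Good.sum {v : ℕ} {N a : NTm} (hN : NTm.Good.{u} N) (ha : NTm.Good.{u} a) :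
    NTm.Good.{u} (NTm.sum v N a) := by
  intro t
  obtain ⟨p₁, c₁, h₁⟩ := hN (t + 1)
  obtain ⟨p₂, c₂, h₂⟩ := ha (t + 4)
  -- `X ^ m` bounds both the summation variable, which stays below `X ^ c₁`, and the other
  -- variables, which are at most `X`.
  set m := c₁ + 1
  refine ⟨.seq (setNatCell t (.const 0)) (.seq p₁ (forProg t v (.seq p₂
    (setNatCell t (.add (natCell t) (natCell (t + 4))))))), (m + m * c₂) + 6,
    fun F _ σ X hX hv => ?_⟩
  have hX1 : 1 ≤ X := by omega
  have hXm : X ≤ X ^ m := Nat.le_self_pow (by omega) X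
  obtain ⟨b₁, -⟩ := h₁ F σ X hX hv
  set n := N.eval (σ.nat 0) (view σ) with hn
  have hnm : n ≤ X ^ m := b₁.trans (Nat.pow_le_pow_right hX1 (by omega))
  have hupd : ∀ i < n, ∀ w, Function.update (σ.nat 0) v i w ≤ X ^ m := by
    intro i hi w
    rw [Function.update_apply]
    split_ifs
    · omega
    · exact (hv w).trans hXm
  set g : ℕ → ℕ := fun i => a.eval (Function.update (σ.nat 0) v i) (view σ) with hg
  have hval : ∀ i < n, ∀ τ : State F, τ.nat 0 = Function.update (σ.nat 0) v i →
      view τ = view σ → g i ≤ (X ^ m) ^ c₂ ∧ Runs p₂ τ ((X ^ m) ^ c₂) fun υ =>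
        Same (t + 4) τ υ ∧ υ.nat 2 (t + 4) = g i := by
    intro i hi τ e₁ e₂
    have := h₂ F τ (X ^ m) (hX.trans hXm) (by rw [e₁]; exact hupd i hi)
    rwa [e₁, e₂] at this
  have hE : (X ^ m) * (X ^ m) ^ c₂ = X ^ (m + m * c₂) := by rw [← pow_mul, ← pow_add]
  have hpos : 1 ≤ (X ^ m) ^ c₂ := Nat.one_le_pow _ _ (Nat.one_le_pow _ _ hX1)
  constructor
  · rw [NTm.eval_sum]
    calc ∑ i ∈ Finset.range n, g i ≤ n * (X ^ m) ^ c₂ := by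
          refine (Finset.sum_le_card_nsmul _ _ ((X ^ m) ^ c₂) fun i hi => ?_).trans_eq (by simp)
          exact (hval i (Finset.mem_range.1 hi) (σ.setNat 0 v i) (by simp) rfl).1
      _ ≤ X ^ (m + m * c₂) := by rw [← hE]; exact Nat.mul_le_mul_right _ hnm
      _ ≤ _ := Nat.pow_le_pow_right hX1 (by omega)
  · refine Runs.mono (B := 3 + (X ^ c₁ + (n + 1) * (((X ^ m) ^ c₂ + 7) + 16))) (Runs.seq
      (Q := fun τ => Same t σ τ ∧ τ.nat 2 t = 0) (Runs.setNatCell ⟨.setNat le_rfl, ?_⟩)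
      fun τ ⟨s₀, g₀⟩ => Runs.seq (Q := fun υ => Same t σ υ ∧ υ.nat 2 t = 0 ∧ υ.nat 2 (t + 1) = n)
        ?_ fun τ ⟨s₁, g₁, g₂⟩ => (runs_forProg (σ := τ)
        (fun i τ => view τ = view σ ∧ τ.nat 2 t = ∑ j ∈ Finset.range i, g j) g₂
        ?_ ?_ ⟨s₁.view_eq, by simp [g₁]⟩ ?_).mono le_rfl ?_) ?_ fun _ => id
    · simp [NatExpr.eval]
    · have := (h₁ F τ X hX (by rw [s₀.nat_zero]; exact hv)).2
      rw [s₀.nat_zero, s₀.view_eq] at this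
      refine this.mono le_rfl fun υ ⟨s, e⟩ =>
        ⟨s₀.trans (s.mono (by omega)), by rw [s.nat_two t (by omega), g₀], e⟩
    · rintro i τ j w hj ⟨e₁, e₂⟩
      exact ⟨e₁, by rw [setNat_nat_two_ne (by omega), e₂]⟩
    · rintro i τ w ⟨e₁, e₂⟩
      exact ⟨e₁, by simpa using e₂⟩
    · rintro i υ hi s₂ e₀ ⟨e₁, e₂⟩
      rw [s₁.nat_zero] at e₀
      refine ((hval i hi υ e₀ e₁).2.seq (B' := 7) fun ω ⟨s₃, e₃⟩ => Runs.setNatCell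
        ⟨((s₃.mono (by omega)).trans (.setNat le_rfl)).1, ?_, ?_, ?_, ?_⟩)
      · exact ((s₃.mono (show t ≤ t + 4 by omega)).trans (.setNat le_rfl)).nat_zero
      · intro j hj hj'
        rw [setNat_nat_two_ne (by omega), s₃.nat_two j hj']
      · rw [view_setNat, s₃.view_eq, e₁]
      · simp [NatExpr.eval, e₃, s₃.nat_two t, e₂, Finset.sum_range_succ]
    · rintro υ ⟨s, e₀, e₁, e₂⟩
      refine ⟨⟨s₁.1.trans s, by rw [e₀, s₁.nat_zero], e₁⟩, ?_⟩
      rw [e₂, NTm.eval_sum]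
    · have l₁ : X ^ c₁ ≤ X ^ m := Nat.pow_le_pow_right hX1 (by omega)
      -- The summand `6` in the exponent pays for the factor `60 ≤ 2 ^ 6`.
      refine le_pow_add_of_le_mul (A := 60) hX (by norm_num) ?_
      rw [← hE]
      have l₂ : 1 ≤ X ^ m := Nat.one_le_pow _ _ hX1
      generalize X ^ m = y at *
      generalize y ^ c₂ = z at *
      nlinarith [Nat.mul_le_mul hnm (le_refl z), Nat.mul_le_mul l₂ hpos,
        Nat.mul_le_mul (le_refl y) hpos, Nat.mul_le_mul l₂ (le_refl z)]

theorem FTm.Good.sum {v : ℕ} {N : NTm} {a : FTm} (hN : NTm.Good.{u} N) (ha : FTm.Good.{u} a) :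
    FTm.Good.{u} (FTm.sum v N a) := by
  intro t
  obtain ⟨p₁, c₁, h₁⟩ := hN (t + 1)
  obtain ⟨p₂, c₂, h₂⟩ := ha (t + 4)
  set m := c₁ + 1
  refine ⟨.seq (setFldCell t .zero) (.seq p₁ (forProg t v (.seq p₂
    (setFldCell t (.add (fldCell t) (fldCell (t + 4))))))), (m + m * c₂) + 6,
    fun F _ σ X hX hv => ?_⟩
  have hX1 : 1 ≤ X := by omega
  have hXm : X ≤ X ^ m := Nat.le_self_pow (by omega) X
  obtain ⟨b₁, -⟩ := h₁ F σ X hX hv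
  set n := N.eval (σ.nat 0) (view σ) with hn
  have hnm : n ≤ X ^ m := b₁.trans (Nat.pow_le_pow_right hX1 (by omega))
  have hupd : ∀ i < n, ∀ w, Function.update (σ.nat 0) v i w ≤ X ^ m := by
    intro i hi w
    rw [Function.update_apply]
    split_ifs
    · omega
    · exact (hv w).trans hXm
  set g : ℕ → F := fun i => a.eval (Function.update (σ.nat 0) v i) (view σ) with hg
  have hval : ∀ i < n, ∀ τ : State F, τ.nat 0 = Function.update (σ.nat 0) v i →
      view τ = view σ → Runs p₂ τ ((X ^ m) ^ c₂) fun υ =>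
        Same (t + 4) τ υ ∧ υ.fld 3 (t + 4) = g i := by
    intro i hi τ e₁ e₂
    have := h₂ F τ (X ^ m) (hX.trans hXm) (by rw [e₁]; exact hupd i hi)
    rwa [e₁, e₂] at this
  have hE : (X ^ m) * (X ^ m) ^ c₂ = X ^ (m + m * c₂) := by rw [← pow_mul, ← pow_add]
  have hpos : 1 ≤ (X ^ m) ^ c₂ := Nat.one_le_pow _ _ (Nat.one_le_pow _ _ hX1)
  refine Runs.mono (B := 3 + (X ^ c₁ + (n + 1) * (((X ^ m) ^ c₂ + 7) + 16))) (Runs.seq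
    (Q := fun τ => Same t σ τ ∧ τ.fld 3 t = 0) (Runs.setFldCell ⟨.setFld le_rfl, ?_⟩)
    fun τ ⟨s₀, g₀⟩ => Runs.seq (Q := fun υ => Same t σ υ ∧ υ.fld 3 t = 0 ∧ υ.nat 2 (t + 1) = n)
      ?_ fun τ ⟨s₁, g₁, g₂⟩ => (runs_forProg (σ := τ)
      (fun i τ => view τ = view σ ∧ τ.fld 3 t = ∑ j ∈ Finset.range i, g j) g₂
      ?_ ?_ ⟨s₁.view_eq, by simp [g₁]⟩ ?_).mono le_rfl ?_) ?_ fun _ => id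
  · simp [FldExpr.eval]
  · have := (h₁ F τ X hX (by rw [s₀.nat_zero]; exact hv)).2
    rw [s₀.nat_zero, s₀.view_eq] at this
    refine this.mono le_rfl fun υ ⟨s, e⟩ =>
      ⟨s₀.trans (s.mono (by omega)), by rw [s.fld_three t (by omega), g₀], e⟩
  · rintro i τ j w hj ⟨e₁, e₂⟩
    exact ⟨e₁, e₂⟩
  · rintro i τ w ⟨e₁, e₂⟩
    exact ⟨e₁, e₂⟩
  · rintro i υ hi s₂ e₀ ⟨e₁, e₂⟩
    rw [s₁.nat_zero] at e₀
    refine ((hval i hi υ e₀ e₁).seq (B' := 7) fun ω ⟨s₃, e₃⟩ => Runs.setFldCell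
      ⟨((s₃.mono (by omega)).trans (.setFld le_rfl)).1, ?_, ?_, ?_, ?_⟩)
    · exact s₃.nat_zero
    · intro j hj hj'
      exact s₃.nat_two j hj'
    · rw [(Same.setFld le_rfl).view_eq, s₃.view_eq, e₁]
    · simp [FldExpr.eval, e₃, s₃.fld_three t, e₂, Finset.sum_range_succ]
  · rintro υ ⟨s, e₀, e₁, e₂⟩
    refine ⟨⟨s₁.1.trans s, by rw [e₀, s₁.nat_zero], e₁⟩, ?_⟩
    rw [e₂, FTm.eval_sum]
  · have l₁ : X ^ c₁ ≤ X ^ m := Nat.pow_le_pow_right hX1 (by omega)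
    refine le_pow_add_of_le_mul (A := 60) hX (by norm_num) ?_
    rw [← hE]
    have l₂ : 1 ≤ X ^ m := Nat.one_le_pow _ _ hX1
    generalize X ^ m = y at *
    generalize y ^ c₂ = z at *
    nlinarith [Nat.mul_le_mul hnm (le_refl z), Nat.mul_le_mul l₂ hpos,
      Nat.mul_le_mul (le_refl y) hpos, Nat.mul_le_mul l₂ (le_refl z)]

/-- Evaluation of two field terms in adjacent cells. -/
theorem FTm.Good.pair {x y : FTm} (hx : FTm.Good.{u} x) (hy : FTm.Good.{u} y) (t : ℕ) :
    ∃ (p : Prog) (c : ℕ), ∀ (F : Type u) [Field F] (σ : State F) (X : ℕ), 2 ≤ X →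
      (∀ v, σ.nat 0 v ≤ X) → Runs p σ (X ^ c) fun τ => Same t σ τ ∧
        τ.fld 3 t = x.eval (σ.nat 0) (view σ) ∧ τ.fld 3 (t + 1) = y.eval (σ.nat 0) (view σ) := by
  obtain ⟨p₁, c₁, h₁⟩ := hx t
  obtain ⟨p₂, c₂, h₂⟩ := hy (t + 1)
  refine ⟨.seq p₁ p₂, (c₁ + c₂) + 1, fun F _ σ X hX hv => ?_⟩
  have e₁ : X ^ c₁ ≤ X ^ (c₁ + c₂) := Nat.pow_le_pow_right (by omega) (by omega)
  have e₂ : X ^ c₂ ≤ X ^ (c₁ + c₂) := Nat.pow_le_pow_right (by omega) (by omega)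
  refine ((h₁ F σ X hX hv).seq (B' := X ^ c₂) fun τ ⟨s₁, g₁⟩ => ?_).mono
    (le_pow_add_of_le_mul (A := 2) hX (by norm_num) (by omega)) fun _ => id
  have := h₂ F τ X hX (by rw [s₁.nat_zero]; exact hv)
  rw [s₁.nat_zero, s₁.view_eq] at this
  exact this.mono le_rfl fun υ ⟨s₂, g₂⟩ =>
    ⟨s₁.trans (s₂.mono (by omega)), by rw [s₂.fld_three t (by omega), g₁], g₂⟩

theorem NTm.Good.ne {x y : FTm} (hx : FTm.Good.{u} x) (hy : FTm.Good.{u} y) :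
    NTm.Good.{u} (NTm.ne x y) := by
  intro t
  obtain ⟨p, c, h⟩ := FTm.Good.pair hx hy t
  refine ⟨.seq p (.ite (.fldEq (fldCell t) (fldCell (t + 1))) (setNatCell t (.const 0))
    (setNatCell t (.const 1))), c + 4, fun F _ σ X hX hv => ⟨?_, ?_⟩⟩
  · have := Nat.one_le_pow (c + 4) X (by omega)
    rw [NTm.eval_ne]
    split_ifs <;> omega
  · have := Nat.one_le_pow c X (by omega)
    refine ((h F σ X hX hv).seq (B' := 5 + 3) fun τ ⟨s, g₁, g₂⟩ => Runs.ite ?_ ?_).mono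
      (le_pow_add_of_le_mul (A := 9) hX (by norm_num) (by omega)) fun _ => id
    · intro h
      simp only [Test.Holds, fldCell_eval, g₁, g₂] at h
      exact Runs.setNatCell (e := .const 0)
        ⟨s.trans (.setNat le_rfl), by simp [NatExpr.eval, h]⟩
    · intro h
      simp only [Test.Holds, fldCell_eval, g₁, g₂] at h
      exact Runs.setNatCell (e := .const 1)
        ⟨s.trans (.setNat le_rfl), by simp [NatExpr.eval, h]⟩

theorem FTm.Good.bin {e x y : FTm} (hx : FTm.Good.{u} x) (hy : FTm.Good.{u} y)
    (E : ℕ → FldExpr) (hc : ∀ t, (E t).cost ≤ 5)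
    (hE : ∀ (t : ℕ) (F : Type u) [Field F] (ρ : ℕ → ℕ) (μ : Mem F) (σ : State F),
      σ.fld 3 t = x.eval ρ μ → σ.fld 3 (t + 1) = y.eval ρ μ → (E t).eval σ = e.eval ρ μ) :
    FTm.Good.{u} e := by
  intro t
  obtain ⟨p, c, h⟩ := FTm.Good.pair hx hy t
  refine ⟨.seq p (setFldCell t (E t)), c + 3, fun F _ σ X hX hv => ?_⟩
  have := Nat.one_le_pow c X (by omega)
  have := hc t
  refine ((h F σ X hX hv).seq (B' := (E t).cost + 2) fun τ ⟨s, g₁, g₂⟩ => Runs.setFldCell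
    ⟨s.trans (.setFld le_rfl), ?_⟩).mono
      (le_pow_add_of_le_mul (A := 8) hX (by norm_num) (by omega)) fun _ => id
  rw [setFld_three_same, hE t F _ _ τ g₁ g₂]

theorem FTm.Good.add {x y : FTm} (hx : FTm.Good.{u} x) (hy : FTm.Good.{u} y) :
    FTm.Good.{u} (FTm.add x y) :=
  .bin hx hy (fun t => .add (fldCell t) (fldCell (t + 1))) (fun _ => le_rfl)
    fun t F _ ρ μ σ h₁ h₂ => by simp [FldExpr.eval, h₁, h₂]

theorem FTm.Good.sub {x y : FTm} (hx : FTm.Good.{u} x) (hy : FTm.Good.{u} y) :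
    FTm.Good.{u} (FTm.sub x y) :=
  .bin hx hy (fun t => .sub (fldCell t) (fldCell (t + 1))) (fun _ => le_rfl)
    fun t F _ ρ μ σ h₁ h₂ => by simp [FldExpr.eval, h₁, h₂]

theorem FTm.Good.mul {x y : FTm} (hx : FTm.Good.{u} x) (hy : FTm.Good.{u} y) :
    FTm.Good.{u} (FTm.mul x y) :=
  .bin hx hy (fun t => .mul (fldCell t) (fldCell (t + 1))) (fun _ => le_rfl)
    fun t F _ ρ μ σ h₁ h₂ => by simp [FldExpr.eval, h₁, h₂]

/-- Evaluating `x` twice lets the scheme for two operands serve; the second value is ignored. -/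
theorem FTm.Good.inv {x : FTm} (hx : FTm.Good.{u} x) : FTm.Good.{u} (FTm.inv x) :=
  .bin hx hx (fun t => .inv (fldCell t)) (fun t => by simp [FldExpr.cost])
    fun t F _ ρ μ σ h₁ h₂ => by simp [FldExpr.eval, h₁]

theorem FTm.Good.of_expr {e : FTm} (E : FldExpr) (hc : E.cost ≤ 5)
    (hE : ∀ (F : Type u) [Field F] (ρ : ℕ → ℕ) (μ : Mem F) (σ : State F),
      E.eval σ = e.eval ρ μ) : FTm.Good.{u} e := by
  refine fun t => ⟨setFldCell t E, 3, fun F _ σ X hX hv => ?_⟩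
  have := Nat.pow_le_pow_left hX 3
  exact (Runs.setFldCell ⟨.setFld le_rfl, by rw [setFld_three_same, hE F _ _ σ]⟩).mono
    (by omega) fun _ => id

theorem FTm.Good.load {a : ℕ} {i : NTm} (hi : NTm.Good.{u} i) : FTm.Good.{u} (FTm.load a i) := by
  intro t
  obtain ⟨p, c, h⟩ := hi t
  refine ⟨.seq p (setFldCell t (.load (fldArr a) (natCell t))), c + 3, fun F _ σ X hX hv => ?_⟩
  have := Nat.one_le_pow c X (by omega)
  refine ((h F σ X hX hv).2.seq (B' := 5) fun τ ⟨s, g⟩ => Runs.setFldCell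
    ⟨s.trans (.setFld le_rfl), ?_⟩).mono
      (le_pow_add_of_le_mul (A := 8) hX (by norm_num) (by omega)) fun _ => id
  rw [setFld_three_same, FTm.eval_load, ← congrFun (congrFun s.view_eq a) _]
  simp [FldExpr.eval, view, g]

mutual
theorem NTm.good : ∀ e : NTm, NTm.Good.{u} e
  | .const n => .const n
  | .var v => .var v
  | .add a b => .add a.good b.good
  | .sub a b => .sub a.good b.good
  | .mul a b => .mul a.good b.good
  | .div a b => .div a.good b.good
  | .mod a b => .mod a.good b.good
  | .lt a b => .lt a.good b.good
  | .ite c a b => .ite c.good a.good b.good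
  | .sum _ N a => .sum N.good a.good
  | .ne x y => .ne x.good y.good
theorem FTm.good : ∀ e : FTm, FTm.Good.{u} e
  | .zero => .of_expr .zero (by simp [FldExpr.cost]) fun _ _ _ _ _ => by simp [FldExpr.eval]
  | .one => .of_expr .one (by simp [FldExpr.cost]) fun _ _ _ _ _ => by simp [FldExpr.eval]
  | .load _ i => .load i.good
  | .add x y => .add x.good y.good
  | .sub x y => .sub x.good y.good
  | .mul x y => .mul x.good y.good
  | .inv x => .inv x.good
  | .ite c x y => .ite c.good x.good y.good
  | .sum _ N x => .sum N.good x.good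
end

/-- Every command is executed by some program in polynomial time. -/
theorem Cmd.good (c : Cmd) : ∀ t : ℕ, ∃ (p : Prog) (e : ℕ), ∀ (F : Type u) [Field F] (σ : State F)
    (X : ℕ), 2 ≤ X → (∀ v, σ.nat 0 v ≤ X) → Runs p σ (X ^ e) fun τ => SameStack t σ τ ∧
      τ.nat 0 = σ.nat 0 ∧ view τ = c.run (σ.nat 0) (view σ) := by
  induction c with
  | skip =>
    refine fun t => ⟨.skip, 0, fun F _ σ X hX hv => ⟨σ, 1, .skip σ, ?_, .refl, rfl, rfl⟩⟩
    simp
  | set a i x =>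
    intro t
    obtain ⟨p₁, c₁, h₁⟩ := NTm.good.{u} i t
    obtain ⟨p₂, c₂, h₂⟩ := FTm.good.{u} x (t + 1)
    refine ⟨.seq p₁ (.seq p₂ (.setFld (fldArr a) (natCell t) (fldCell (t + 1)))), (c₁ + c₂) + 3,
      fun F _ σ X hX hv => ?_⟩
    have e₁ : X ^ c₁ ≤ X ^ (c₁ + c₂) := Nat.pow_le_pow_right (by omega) (by omega)
    have e₂ : X ^ c₂ ≤ X ^ (c₁ + c₂) := Nat.pow_le_pow_right (by omega) (by omega)
    have e₃ : 1 ≤ X ^ (c₁ + c₂) := Nat.one_le_pow _ _ (by omega)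
    refine Runs.mono (B := X ^ c₁ + (X ^ c₂ + 5)) ((h₁ F σ X hX hv).2.seq fun τ ⟨s₁, g₁⟩ =>
      (h₂ F τ X hX (by rw [s₁.nat_zero]; exact hv)).seq fun υ ⟨s₂, g₂⟩ =>
        Runs.setFld ⟨s₁.1.trans ((s₂.1.mono (by omega)).trans .setMem), ?_, ?_⟩)
        (le_pow_add_of_le_mul (A := 8) hX (by norm_num) (by omega)) fun _ => id
    · rw [setFld_nat, s₂.nat_zero, s₁.nat_zero]
    · rw [view_setFld, s₂.view_eq, s₁.view_eq, Cmd.run, natCell_eval, fldCell_eval,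
        s₂.nat_two t (by omega), g₁, g₂, s₁.nat_zero, s₁.view_eq]
  | seq c d ihc ihd =>
    intro t
    obtain ⟨p₁, c₁, h₁⟩ := ihc t
    obtain ⟨p₂, c₂, h₂⟩ := ihd t
    refine ⟨.seq p₁ p₂, (c₁ + c₂) + 1, fun F _ σ X hX hv => ?_⟩
    have e₁ : X ^ c₁ ≤ X ^ (c₁ + c₂) := Nat.pow_le_pow_right (by omega) (by omega)
    have e₂ : X ^ c₂ ≤ X ^ (c₁ + c₂) := Nat.pow_le_pow_right (by omega) (by omega)
    -- The first command restores the variables, so the same `X` bounds them for the second. This is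
    -- why numbers cannot grow in the course of a computation.
    refine ((h₁ F σ X hX hv).seq fun τ ⟨s₁, g₁, g₂⟩ =>
      (h₂ F τ X hX (by rw [g₁]; exact hv)).mono le_rfl fun υ ⟨s₂, g₃, g₄⟩ =>
        ⟨s₁.trans s₂, by rw [g₃, g₁], ?_⟩).mono
        (le_pow_add_of_le_mul (A := 2) hX (by norm_num) (by omega)) fun _ => id
    rw [g₄, g₁, g₂, Cmd.run]
  | loop v N c ih =>
    intro t
    obtain ⟨p₁, c₁, h₁⟩ := NTm.good.{u} N (t + 1)
    obtain ⟨p₂, c₂, h₂⟩ := ih (t + 4)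
    set m := c₁ + 1
    refine ⟨.seq p₁ (forProg t v p₂), (m + m * c₂) + 6, fun F _ σ X hX hv => ?_⟩
    have hX1 : 1 ≤ X := by omega
    have hXm : X ≤ X ^ m := Nat.le_self_pow (by omega) X
    obtain ⟨b₁, r₁⟩ := h₁ F σ X hX hv
    set n := N.eval (σ.nat 0) (view σ) with hn
    have hnm : n ≤ X ^ m := b₁.trans (Nat.pow_le_pow_right hX1 (by omega))
    have hupd : ∀ i < n, ∀ w, Function.update (σ.nat 0) v i w ≤ X ^ m := by
      intro i hi w
      rw [Function.update_apply]
      split_ifs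
      · omega
      · exact (hv w).trans hXm
    refine Runs.mono (B := X ^ c₁ + (n + 1) * ((X ^ m) ^ c₂ + 16)) (r₁.seq fun τ ⟨s₁, g₁⟩ =>
      (runs_forProg (σ := τ) (fun i τ => view τ =
        iter (fun i μ' => c.run (Function.update (σ.nat 0) v i) μ') i (view σ)) g₁
        (fun i τ j w _ h => h) (fun i τ w h => h) s₁.view_eq ?_).mono le_rfl ?_) ?_ fun _ => id
    · intro i υ hi s₂ e₀ e₁
      rw [s₁.nat_zero] at e₀
      have := h₂ F υ (X ^ m) (hX.trans hXm) (by rw [e₀]; exact hupd i hi)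
      refine this.mono le_rfl fun ω ⟨s₃, e₂, e₃⟩ => ⟨s₃.mono (by omega), e₂,
        fun j _ hj => s₃.nat_two j hj, ?_⟩
      rw [e₃, e₀, e₁, iter]
    · rintro υ ⟨s₂, e₀, e₁⟩
      refine ⟨(s₁.1.mono (by omega)).trans s₂, by rw [e₀, s₁.nat_zero], ?_⟩
      rw [e₁, Cmd.run]
    · have l₁ : X ^ c₁ ≤ X ^ m := Nat.pow_le_pow_right hX1 (by omega)
      have hE : (X ^ m) * (X ^ m) ^ c₂ = X ^ (m + m * c₂) := by rw [← pow_mul, ← pow_add]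
      have hpos : 1 ≤ (X ^ m) ^ c₂ := Nat.one_le_pow _ _ (Nat.one_le_pow _ _ hX1)
      refine le_pow_add_of_le_mul (A := 60) hX (by norm_num) ?_
      rw [← hE]
      have l₂ : 1 ≤ X ^ m := Nat.one_le_pow _ _ hX1
      generalize X ^ m = y at *
      generalize y ^ c₂ = z at *
      nlinarith [Nat.mul_le_mul hnm (le_refl z), Nat.mul_le_mul l₂ hpos,
        Nat.mul_le_mul (le_refl y) hpos, Nat.mul_le_mul l₂ (le_refl z)]

/-- A command followed by the computation of the number of outputs is a program that runs in
polynomial time. -/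
theorem exists_prog (c : Cmd) (N : NTm) : ∃ (p : Prog) (e : ℕ), ∀ (F : Type u) [Field F]
    (σ : State F) (X : ℕ), 2 ≤ X → (∀ v, σ.nat 0 v ≤ X) → Runs p σ (X ^ e) fun τ =>
      view τ = c.run (σ.nat 0) (view σ) ∧ τ.nat 1 0 = N.eval (σ.nat 0) (view τ) ∧
        τ.nat 1 0 ≤ X ^ e := by
  obtain ⟨p₁, c₁, h₁⟩ := Cmd.good.{u} c 0
  obtain ⟨p₂, c₂, h₂⟩ := NTm.good.{u} N 0
  refine ⟨.seq p₁ (.seq p₂ (.setNat 1 (.const 0) (natCell 0))), (c₁ + c₂) + 3,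
    fun F _ σ X hX hv => ?_⟩
  have e₁ : X ^ c₁ ≤ X ^ (c₁ + c₂) := Nat.pow_le_pow_right (by omega) (by omega)
  have e₂ : X ^ c₂ ≤ X ^ (c₁ + c₂) := Nat.pow_le_pow_right (by omega) (by omega)
  have e₃ : X ^ (c₁ + c₂) ≤ X ^ (c₁ + c₂ + 3) := Nat.pow_le_pow_right (by omega) (by omega)
  have e₄ : 1 ≤ X ^ (c₁ + c₂) := Nat.one_le_pow _ _ (by omega)
  refine Runs.mono (B := X ^ c₁ + (X ^ c₂ + 4)) ((h₁ F σ X hX hv).seq fun τ ⟨s₁, g₁, g₂⟩ => ?_)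
    (le_pow_add_of_le_mul (A := 8) hX (by norm_num) (by omega)) fun _ => id
  obtain ⟨b, r⟩ := h₂ F τ X hX (by rw [g₁]; exact hv)
  refine r.seq fun υ ⟨s₂, g₃⟩ => Runs.setNat ⟨?_, ?_, ?_⟩
  · rw [view_setNat, s₂.view_eq, g₂]
  · rw [view_setNat, s₂.view_eq, ← g₁]
    simpa [State.setNat, NatExpr.eval] using g₃
  · have : ((υ.setNat 1 0 ((natCell 0).eval υ)).nat 1 0) = υ.nat 2 0 := by simp [State.setNat]
    exact this.trans_le (by omega)

/-! ### Effects of loops -/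

theorem iter_induction {α : Type*} {f : ℕ → α → α} {x : α} (P : ℕ → α → Prop) (n : ℕ) (h0 : P 0 x)
    (h : ∀ i < n, ∀ y, P i y → P (i + 1) (f i y)) : P n (iter f n x) := by
  induction n with
  | zero => exact h0
  | succ n ih => exact h n (Nat.lt_succ_self n) _ (ih fun i hi => h i (by omega))

/-- The arrays that a command may change. -/
def Cmd.writes : Cmd → Set ℕ
  | .skip => ∅
  | .set a _ _ => {a}
  | .seq c d => c.writes ∪ d.writes
  | .loop _ _ c => c.writes

section run

variable {F : Type u} [Field F] {ρ : ℕ → ℕ} {μ : Mem F}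

/-- Frame rule, by which arrays filled at earlier stages are known to be intact later. -/
theorem Cmd.run_of_notMem_writes (c : Cmd) {b : ℕ} (hb : b ∉ c.writes) :
    c.run ρ μ b = μ b := by
  induction c generalizing ρ μ with
  | skip => rfl
  | set a i x =>
    have : b ≠ a := hb
    simp [Cmd.run, Mem.set, this]
  | seq c d ihc ihd =>
    have := not_or.1 hb
    rw [Cmd.run, ihd this.2, ihc this.1]
  | loop v N c ih =>
    rw [Cmd.run]
    exact iter_induction (fun _ (μ' : Mem F) => μ' b = μ b) _ rfl fun i _ μ' h => (ih hb).trans h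

theorem run_loop (v : ℕ) (N : NTm) (c : Cmd) {n : ℕ} (hN : N.eval ρ μ = n)
    (P : ℕ → Mem F → Prop) (h0 : P 0 μ)
    (h : ∀ i < n, ∀ μ', P i μ' → P (i + 1) (c.run (Function.update ρ v i) μ')) :
    P n ((Cmd.loop v N c).run ρ μ) := by
  rw [Cmd.run, hN]
  exact iter_induction P n h0 h

/-- The effect of a loop that writes cells of one array. -/
theorem run_fill {v : ℕ} {N : NTm} {a : ℕ} {idx : NTm} {val : FTm} {n : ℕ}
    (hN : N.eval ρ μ = n) (I : ℕ → ℕ) (G : ℕ → F)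
    (hidx : ∀ i < n, ∀ μ' : Mem F, (∀ b ≠ a, μ' b = μ b) →
      idx.eval (Function.update ρ v i) μ' = I i)
    (hinj : ∀ i < n, ∀ j < i, I j ≠ I i)
    (hval : ∀ i < n, ∀ μ' : Mem F, (∀ b ≠ a, μ' b = μ b) → (∀ j < i, μ' a (I j) = G j) →
      (∀ c, (∀ j < i, I j ≠ c) → μ' a c = μ a c) → val.eval (Function.update ρ v i) μ' = G i) :
    let μ' := (Cmd.loop v N (.set a idx val)).run ρ μ
    (∀ b ≠ a, μ' b = μ b) ∧ (∀ j < n, μ' a (I j) = G j) ∧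
      ∀ c, (∀ j < n, I j ≠ c) → μ' a c = μ a c := by
  refine run_loop v N _ hN (fun i (μ' : Mem F) => (∀ b ≠ a, μ' b = μ b) ∧ (∀ j < i, μ' a (I j) = G j) ∧
      ∀ c, (∀ j < i, I j ≠ c) → μ' a c = μ a c) ⟨fun _ _ => rfl, fun _ h => by omega,
        fun _ _ => rfl⟩ ?_
  rintro i hi μ' ⟨h1, h2, h3⟩
  rw [Cmd.run, hidx i hi μ' h1, hval i hi μ' h1 h2 h3]
  refine ⟨fun b hb => by simp [Mem.set, hb, h1 b hb], fun j hj => ?_, fun c hc => ?_⟩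
  · rcases Nat.lt_succ_iff_lt_or_eq.1 hj with h | rfl
    · simp [Mem.set, hinj i hi j h, h2 j h]
    · simp [Mem.set]
  · have := hc i (Nat.lt_succ_self i)
    simp [Mem.set, this.symm, h3 c fun j hj => hc j (by omega)]

/-- The effect of a loop that writes the first cells of one array, with values that do not depend
on cells written before. -/
theorem run_fill_id {v : ℕ} {N : NTm} {a : ℕ} {val : FTm} {n : ℕ}
    (hN : N.eval ρ μ = n) (G : ℕ → F)
    (hval : ∀ i < n, ∀ μ' : Mem F, (∀ b ≠ a, μ' b = μ b) → (∀ c, i ≤ c → μ' a c = μ a c) →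
      val.eval (Function.update ρ v i) μ' = G i) :
    let μ' := (Cmd.loop v N (.set a (.var v) val)).run ρ μ
    (∀ b ≠ a, μ' b = μ b) ∧ (∀ j < n, μ' a j = G j) := by
  have := run_fill (ρ := ρ) (μ := μ) (a := a) (idx := .var v) (val := val) hN id G
    (fun i _ μ' _ => by simp) (fun i _ j hj => hj.ne)
    (fun i hi μ' h1 _ h3 => hval i hi μ' h1 fun c hc => h3 c fun j hj => by
      simp only [id]; omega)
  exact ⟨this.1, this.2.1⟩

end run

/-! ### Searching -/

/-- The least value of the variable `v` below `N` for which `t` holds, or `N` if there is none; the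
condition `t` is expressed in terms of the variable `w`. -/
def NTm.first (v w : ℕ) (N t : NTm) : NTm :=
  .sum v N (.ite (.sum w (.add (.var v) (.const 1)) t) (.const 0) (.const 1))

/-- The summand at `i` is `1` exactly if `t` vanishes on `0, …, i`. The sum is therefore the length
of the initial segment of zeros, that is, the position of the first nonzero value. -/
theorem sum_ite_find {n : ℕ} (t : ℕ → ℕ) :
    let p := ∑ i ∈ Finset.range n, if ∑ j ∈ Finset.range (i + 1), t j = 0 then 1 else 0
    (p < n ∧ t p ≠ 0) ∨ (p = n ∧ ∀ i < n, t i = 0) := by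
  induction n with
  | zero => simp
  | succ n ih =>
    simp only at ih ⊢
    rw [Finset.sum_range_succ]
    rcases ih with ⟨h1, h2⟩ | ⟨h1, h2⟩
    · left
      rw [if_neg]
      · exact ⟨by omega, by simpa using h2⟩
      · intro h
        exact h2 (Finset.sum_eq_zero_iff.1 h _ (Finset.mem_range.2 (by omega)))
    · have h3 : ∑ j ∈ Finset.range (n + 1), t j = t n := by
        rw [Finset.sum_range_succ, Finset.sum_eq_zero fun i hi => h2 i (Finset.mem_range.1 hi),
          zero_add]
      rw [h1, h3]
      by_cases h : t n = 0
      · right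
        rw [if_pos h]
        refine ⟨rfl, fun i hi => ?_⟩
        rcases Nat.lt_succ_iff_lt_or_eq.1 hi with h' | rfl
        · exact h2 i h'
        · exact h
      · left
        rw [if_neg h]
        exact ⟨by omega, h⟩

theorem NTm.eval_first {F : Type u} [Field F] {ρ : ℕ → ℕ} {μ : Mem F} {v w : ℕ} {N t : NTm} {n : ℕ}
    (hN : N.eval ρ μ = n) (T : ℕ → ℕ)
    (ht : ∀ i j, t.eval (Function.update (Function.update ρ v i) w j) μ = T j) :
    ((NTm.first v w N t).eval ρ μ < n ∧ T ((NTm.first v w N t).eval ρ μ) ≠ 0) ∨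
      ((NTm.first v w N t).eval ρ μ = n ∧ ∀ i < n, T i = 0) := by
  have := sum_ite_find (n := n) T
  simpa [NTm.first, hN, ht] using this

/-! ### Kernels of matrices -/

section kernel

/-- Fill array `4` with the `N` standard basis vectors of length `N`. -/
def kerInit (N : NTm) : Cmd :=
  .loop 4 (.mul N N) (.set 4 (.var 4) (.ite
    (.add (.lt (.div (.var 4) N) (.mod (.var 4) N)) (.lt (.mod (.var 4) N) (.div (.var 4) N)))
    .zero .one))

/-- The index of the first basis vector that is not orthogonal to the current row. -/
def kerPivot (N : NTm) : NTm := .first 4 5 N (.ne (.load 5 (.var 5)) .zero)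

/-- Array `4` holds `N` vectors of length `N`. They are replaced by vectors that span the subspace
of vectors in their span that are orthogonal to a row. Entry number `x` of the row is `ent`, with
`x` the value of variable `7`. -/
def kerRow (N : NTm) (ent : FTm) : Cmd :=
  .seq (.loop 4 N (.set 5 (.var 4)
    (.sum 7 N (.mul ent (.load 4 (.add (.mul (.var 4) N) (.var 7)))))))
  (.seq (.loop 7 N (.set 6 (.var 7)
    (.mul (.inv (.load 5 (kerPivot N))) (.load 4 (.add (.mul (kerPivot N) N) (.var 7))))))
  (.loop 4 (.mul N N) (.set 4 (.var 4) (.sub (.load 4 (.var 4))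
    (.mul (.load 5 (.div (.var 4) N)) (.load 6 (.mod (.var 4) N)))))))

/-- Process all rows of a matrix; the index of the row is in variable `6`. -/
def kerRows (R N : NTm) (ent : FTm) : Cmd := .loop 6 R (kerRow N ent)

/-- The index of the first nonzero basis vector. -/
def kerPickIndex (N : NTm) : NTm :=
  .first 4 5 N (.sum 8 N (.ne (.load 4 (.add (.mul (.var 5) N) (.var 8))) .zero))

/-- Copy the first nonzero basis vector into array `a`. -/
def kerPick (N : NTm) (a : ℕ) : Cmd :=
  .loop 7 N (.set a (.var 7) (.ite (.lt (kerPickIndex N) N)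
    (.load 4 (.add (.mul (kerPickIndex N) N) (.var 7))) .zero))

theorem kerInit_writes (N : NTm) : (kerInit N).writes = {4} := rfl

theorem kerRow_writes (N : NTm) (ent : FTm) : (kerRow N ent).writes = {5} ∪ ({6} ∪ {4}) := rfl

theorem kerRows_writes (R N : NTm) (ent : FTm) :
    (kerRows R N ent).writes = {5} ∪ ({6} ∪ {4}) := rfl

variable {F : Type u} [Field F]

/-- The value of the term is a number that depends only on the first four variables. -/
def NTm.IsParam (F : Type u) [Field F] (N : NTm) (ρ : ℕ → ℕ) (n : ℕ) : Prop :=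
  ∀ (ρ' : ℕ → ℕ) (μ' : Mem F), (∀ v < 4, ρ' v = ρ v) → N.eval ρ' μ' = n

theorem NTm.IsParam.of_eq {N : NTm} {ρ ρ' : ℕ → ℕ} {n : ℕ} (h : N.IsParam F ρ n)
    (hρ : ∀ v < 4, ρ' v = ρ v) : N.IsParam F ρ' n :=
  fun ρ'' μ' h' => h ρ'' μ' fun v hv => (h' v hv).trans (hρ v hv)

theorem NTm.IsParam.update {N : NTm} {ρ : ℕ → ℕ} {n : ℕ} (h : N.IsParam F ρ n) {v i : ℕ}
    (hv : 4 ≤ v) : N.IsParam F (Function.update ρ v i) n :=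
  h.of_eq fun w hw => by simp [show w ≠ v by omega]

theorem NTm.IsParam.eval {N : NTm} {ρ : ℕ → ℕ} {n : ℕ} (h : N.IsParam F ρ n) (μ : Mem F) :
    N.eval ρ μ = n := h ρ μ fun _ _ => rfl

/-- Vector number `j` in array `4`. -/
def basisVec (μ : Mem F) (n : ℕ) (j : ℕ) : Fin n → F := fun x => μ 4 (j * n + x)

/-- The span of the vectors in array `4`. -/
def basisSpan (μ : Mem F) (n : ℕ) : Submodule F (Fin n → F) :=
  Submodule.span F (Set.range fun j : Fin n => basisVec μ n j)

theorem mul_add_lt_mul_self {n j x : ℕ} (hj : j < n) (hx : x < n) : j * n + x < n * n :=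
  calc j * n + x < j * n + n := by omega
    _ = (j + 1) * n := by ring
    _ ≤ n * n := Nat.mul_le_mul_right _ hj

theorem mul_add_div_eq {n j x : ℕ} (hx : x < n) : (j * n + x) / n = j := by
  rw [add_comm, Nat.add_mul_div_right _ _ (by omega), Nat.div_eq_of_lt hx, zero_add]

theorem mul_add_mod_eq {n j x : ℕ} (hx : x < n) : (j * n + x) % n = x := by
  rw [add_comm, Nat.add_mul_mod_self_right, Nat.mod_eq_of_lt hx]

theorem basisSpan_kerInit {N : NTm} {ρ : ℕ → ℕ} {n : ℕ} (hN : N.IsParam F ρ n) (μ : Mem F) :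
    basisSpan ((kerInit N).run ρ μ) n = ⊤ := by
  obtain ⟨-, h⟩ := run_fill_id (ρ := ρ) (μ := μ) (v := 4) (N := .mul N N) (a := 4)
    (val := .ite (.add (.lt (.div (.var 4) N) (.mod (.var 4) N))
      (.lt (.mod (.var 4) N) (.div (.var 4) N))) .zero .one) (n := n * n)
    (by simp [hN.eval]) (fun i => if i / n = i % n then 1 else 0) fun i hi μ' _ _ => by
      simp only [FTm.eval_ite, NTm.eval_add, NTm.eval_lt, NTm.eval_div, NTm.eval_var,
        NTm.eval_mod, Function.update_self, (hN.update (v := 4) (i := i) le_rfl).eval,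
        FTm.eval_one, FTm.eval_zero]
      rcases lt_trichotomy (i / n) (i % n) with h | h | h
      · simp [h, h.ne]
      · simp [h]
      · simp [h, h.ne', not_lt.2 h.le]
  rw [eq_top_iff, ← (Pi.basisFun F (Fin n)).span_eq, basisSpan]
  apply Submodule.span_mono
  rintro _ ⟨j, rfl⟩
  refine ⟨j, ?_⟩
  ext x
  simp only [basisVec, kerInit]
  rw [h _ (mul_add_lt_mul_self j.2 x.2), mul_add_div_eq x.2, mul_add_mod_eq x.2]
  simp [Pi.single_apply, Fin.ext_iff, eq_comm]

/-- One step of the elimination. -/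
theorem span_elim {ι V : Type*} [Finite ι] [AddCommGroup V] [Module F V] (b b' : ι → V)
    (φ : V →ₗ[F] F) (q : V) (hb' : ∀ j, b' j = b j - φ (b j) • q)
    (hq : (∃ j, φ (b j) ≠ 0) → ∃ p, φ (b p) ≠ 0 ∧ q = (φ (b p))⁻¹ • b p) :
    Submodule.span F (Set.range b') = Submodule.span F (Set.range b) ⊓ LinearMap.ker φ := by
  have := Fintype.ofFinite ι
  by_cases h : ∃ j, φ (b j) ≠ 0
  -- Since `φ q = 1`, the map `v ↦ v - φ v • q` projects the span onto its intersection with the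
  -- kernel. The pivot becomes zero but is kept, so the number of stored vectors never changes.
  · obtain ⟨p, hp, hqp⟩ := hq h
    have hφq : φ q = 1 := by rw [hqp, map_smul, smul_eq_mul, inv_mul_cancel₀ hp]
    have hqm : q ∈ Submodule.span F (Set.range b) := by
      rw [hqp]
      exact Submodule.smul_mem _ _ (Submodule.subset_span ⟨p, rfl⟩)
    apply le_antisymm
    · rw [Submodule.span_le]
      rintro _ ⟨j, rfl⟩
      refine ⟨?_, ?_⟩
      · rw [hb']
        exact Submodule.sub_mem _ (Submodule.subset_span ⟨j, rfl⟩) (Submodule.smul_mem _ _ hqm)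
      · simp [hb', hφq]
    · rintro v ⟨hv, hv'⟩
      obtain ⟨c, rfl⟩ := (Submodule.mem_span_range_iff_exists_fun F).1 hv
      have h0 : ∑ j, c j * φ (b j) = 0 := by simpa using hv'
      -- The same coefficients work, because the corrections add up to a multiple of `q` by `φ v =
      -- 0`.
      refine (Submodule.mem_span_range_iff_exists_fun F).2 ⟨c, ?_⟩
      simp only [hb', smul_sub, Finset.sum_sub_distrib, smul_smul, ← Finset.sum_smul, h0, zero_smul,
        sub_zero]
  -- Without a pivot all `φ (b j)` are zero, and nothing is changed whatever `q` may be.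
  · push Not at h
    have hbb : b' = b := funext fun j => by rw [hb', h j, zero_smul, sub_zero]
    rw [hbb, eq_comm, inf_eq_left, Submodule.span_le]
    rintro _ ⟨j, rfl⟩
    exact h j

/-- The linear form with the given coefficients. -/
def rowForm (n : ℕ) (M : ℕ → F) : (Fin n → F) →ₗ[F] F := ∑ x : Fin n, M x • LinearMap.proj x

theorem rowForm_apply (n : ℕ) (M : ℕ → F) (v : Fin n → F) :
    rowForm n M v = ∑ x : Fin n, M x * v x := by
  simp [rowForm]

/-- The three loops compute the values of the linear form on the stored vectors, the pivot divided
by its value, and the corrected vectors, as required by `span_elim`. -/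
theorem basisSpan_kerRow {N : NTm} {ent : FTm} {ρ : ℕ → ℕ} {n : ℕ} (hN : N.IsParam F ρ n)
    (μ : Mem F) (M : ℕ → F) (hent : ∀ μ' : Mem F, (∀ b, b ≠ 4 → b ≠ 5 → b ≠ 6 → μ' b = μ b) →
      ∀ j x, x < n → ent.eval (Function.update (Function.update ρ 4 j) 7 x) μ' = M x) :
    basisSpan ((kerRow N ent).run ρ μ) n = basisSpan μ n ⊓ LinearMap.ker (rowForm n M) := by
  set μ₁ := (Cmd.loop 4 N (.set 5 (.var 4)
    (.sum 7 N (.mul ent (.load 4 (.add (.mul (.var 4) N) (.var 7))))))).run ρ μ with hμ₁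
  obtain ⟨f₁, g₁⟩ := run_fill_id (ρ := ρ) (μ := μ) (v := 4) (N := N) (a := 5) (n := n)
    (val := .sum 7 N (.mul ent (.load 4 (.add (.mul (.var 4) N) (.var 7))))) (hN.eval μ)
    (fun j => rowForm n M (basisVec μ n j)) fun j hj μ' h' _ => by
      rw [FTm.eval_sum, (hN.update le_rfl).eval, Finset.sum_range, rowForm_apply]
      refine Finset.sum_congr rfl fun x _ => ?_
      rw [FTm.eval_mul, hent μ' (fun b _ h5 _ => h' b h5) j x x.2]
      simp [((hN.update (v := 4) (i := j) le_rfl).update (v := 7) (i := x) (by norm_num)).eval,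
        h' 4 (by norm_num), basisVec]
  rw [← hμ₁] at f₁ g₁
  set p := (kerPivot N).eval ρ μ₁ with hp
  have hpiv : ∀ (x : ℕ) (μ' : Mem F), (∀ b ≠ 6, μ' b = μ₁ b) →
      (kerPivot N).eval (Function.update ρ 7 x) μ' = p := by
    intro x μ' h'
    classical
    simp [hp, kerPivot, NTm.first, (hN.update (v := 7) (i := x) (by norm_num)).eval, hN.eval,
      h' 5 (by norm_num)]
  classical
  have hp' := NTm.eval_first (ρ := ρ) (μ := μ₁) (v := 4) (w := 5) (hN.eval μ₁)
    (t := .ne (.load 5 (.var 5)) .zero)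
    (fun j => if μ₁ 5 j = 0 then 0 else 1) fun i j => by simp
  change (p < n ∧ _) ∨ (p = n ∧ _) at hp'
  set μ₂ := (Cmd.loop 7 N (.set 6 (.var 7) (.mul (.inv (.load 5 (kerPivot N)))
    (.load 4 (.add (.mul (kerPivot N) N) (.var 7)))))).run ρ μ₁ with hμ₂
  obtain ⟨f₂, g₂⟩ := run_fill_id (ρ := ρ) (μ := μ₁) (v := 7) (N := N) (a := 6) (n := n)
    (val := .mul (.inv (.load 5 (kerPivot N))) (.load 4 (.add (.mul (kerPivot N) N) (.var 7))))
    (hN.eval μ₁) (fun x => (μ₁ 5 p)⁻¹ * μ₁ 4 (p * n + x)) fun x hx μ' h' _ => by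
      simp [hpiv x μ' h', (hN.update (v := 7) (i := x) (by norm_num)).eval, h' 5 (by norm_num),
        h' 4 (by norm_num)]
  rw [← hμ₂] at f₂ g₂
  -- Array `4` is updated in place. This is harmless, because the value written to a cell uses no
  -- other cell of this array.
  obtain ⟨-, g₃⟩ := run_fill_id (ρ := ρ) (μ := μ₂) (v := 4) (N := .mul N N) (a := 4) (n := n * n)
    (val := .sub (.load 4 (.var 4))
      (.mul (.load 5 (.div (.var 4) N)) (.load 6 (.mod (.var 4) N)))) (by simp [hN.eval])
    (fun i => μ₂ 4 i - μ₂ 5 (i / n) * μ₂ 6 (i % n)) fun i hi μ' h' h'' => by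
      simp [(hN.update (v := 4) (i := i) le_rfl).eval, h' 5 (by norm_num),
        h' 6 (by norm_num), h'' i le_rfl]
  refine span_elim (fun j : Fin n => basisVec μ n j) _ (rowForm n M) (fun x => μ₂ 6 x) ?_ ?_
  · intro j
    ext x
    have := g₃ _ (mul_add_lt_mul_self j.2 x.2)
    simp only [basisVec, Pi.sub_apply, Pi.smul_apply, smul_eq_mul]
    change (Cmd.run _ ρ μ₂) 4 _ = _
    rw [this, mul_add_div_eq x.2, mul_add_mod_eq x.2, f₂ 4 (by norm_num), f₂ 5 (by norm_num),
      f₁ 4 (by norm_num), g₁ j j.2]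
  · rintro ⟨j, hj⟩
    rcases hp' with ⟨h1, h2⟩ | ⟨h1, h2⟩
    · have h3 : μ₁ 5 p ≠ 0 := by
        intro h
        exact h2 (if_pos h)
      rw [g₁ p h1] at h3
      refine ⟨⟨p, h1⟩, h3, ?_⟩
      ext x
      rw [g₂ x x.2, g₁ p h1, f₁ 4 (by norm_num)]
      rfl
    · exfalso
      have := h2 j j.2
      rw [g₁ j j.2] at this
      simp [hj] at this

/-- The vectors orthogonal to the first `R` rows of a matrix. -/
def matKer (n R : ℕ) (M : ℕ → ℕ → F) : Submodule F (Fin n → F) :=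
  ⨅ i : Fin R, LinearMap.ker (rowForm n (M i))

theorem mem_matKer {n R : ℕ} {M : ℕ → ℕ → F} {v : Fin n → F} :
    v ∈ matKer n R M ↔ ∀ i < R, ∑ x : Fin n, M i x * v x = 0 := by
  simp [matKer, Submodule.mem_iInf, rowForm_apply, Fin.forall_iff]

/-- Elimination meets the span with the kernel of one row after another. Entries are read while
arrays `4` to `6` hold intermediate results, so `hent` has to hold whatever these contain. -/
theorem basisSpan_kerRows {R N : NTm} {ent : FTm} {ρ : ℕ → ℕ} {n r : ℕ} (hN : N.IsParam F ρ n)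
    (hR : R.IsParam F ρ r) (μ : Mem F) (M : ℕ → ℕ → F)
    (hent : ∀ μ' : Mem F, (∀ b, b ≠ 4 → b ≠ 5 → b ≠ 6 → μ' b = μ b) → ∀ i < r, ∀ j x, x < n →
      ent.eval (Function.update (Function.update (Function.update ρ 6 i) 4 j) 7 x) μ' = M i x) :
    basisSpan ((kerRows R N ent).run ρ μ) n = basisSpan μ n ⊓ matKer n r M := by
  refine (run_loop (ρ := ρ) (μ := μ) 6 R (kerRow N ent) (hR.eval μ) (fun i μ' =>
    (∀ b, b ≠ 4 → b ≠ 5 → b ≠ 6 → μ' b = μ b) ∧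
      basisSpan μ' n = basisSpan μ n ⊓ matKer n i M) ⟨fun _ _ _ _ => rfl, ?_⟩ ?_).2
  · simp [matKer]
  · rintro i hi μ' ⟨h1, h2⟩
    refine ⟨fun b h4 h5 h6 => ?_, ?_⟩
    · rw [Cmd.run_of_notMem_writes _ (by rw [kerRow_writes]; simp [h4, h5, h6]), h1 b h4 h5 h6]
    · rw [basisSpan_kerRow (hN.update (by norm_num)) μ' (M i) (fun μ'' h j x hx =>
        hent μ'' (fun b h4 h5 h6 => (h b h4 h5 h6).trans (h1 b h4 h5 h6)) i hi j x hx), h2,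
        inf_assoc]
      congr 1
      ext v
      simp only [Submodule.mem_inf, mem_matKer, LinearMap.mem_ker, rowForm_apply]
      constructor
      · rintro ⟨h3, h4⟩ l hl
        rcases Nat.lt_succ_iff_lt_or_eq.1 hl with h | rfl
        · exact h3 l h
        · exact h4
      · exact fun h => ⟨fun l hl => h l (by omega), h i (by omega)⟩

/-- A span is nonzero exactly if one of the spanning vectors is, so the first nonzero stored vector
serves as a witness. If there is none, the zero vector is written. -/
theorem kerPick_spec {N : NTm} {a : ℕ} (ha : a ≠ 4) {ρ : ℕ → ℕ} {n : ℕ} (hN : N.IsParam F ρ n)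
    (μ : Mem F) : let v : Fin n → F := fun x => (kerPick N a).run ρ μ a x
    v ∈ basisSpan μ n ∧ (basisSpan μ n ≠ ⊥ → v ≠ 0) := by
  intro v
  set p := (kerPickIndex N).eval ρ μ with hp
  have hpick : ∀ (x : ℕ) (μ' : Mem F), (∀ b ≠ a, μ' b = μ b) →
      (kerPickIndex N).eval (Function.update ρ 7 x) μ' = p := by
    intro x μ' h'
    have e : ∀ x i j l : ℕ, ∀ μ' : Mem F, N.eval (Function.update (Function.update
        (Function.update (Function.update ρ 7 x) 4 i) 5 j) 8 l) μ' = n := fun x i j l μ' =>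
      ((((hN.update (by norm_num)).update (by norm_num)).update (by norm_num)).update
        (by norm_num)).eval μ'
    have e' : ∀ i j l : ℕ, ∀ μ' : Mem F, N.eval (Function.update (Function.update
        (Function.update ρ 4 i) 5 j) 8 l) μ' = n := fun i j l μ' =>
      (((hN.update (by norm_num)).update (by norm_num)).update
        (by norm_num)).eval μ'
    have e2 : ∀ x i j : ℕ, ∀ μ' : Mem F, N.eval (Function.update (Function.update
        (Function.update ρ 7 x) 4 i) 5 j) μ' = n := fun x i j μ' =>
      (((hN.update (by norm_num)).update (by norm_num)).update
        (by norm_num)).eval μ'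
    have e3 : ∀ i j : ℕ, ∀ μ' : Mem F, N.eval (Function.update
        (Function.update ρ 4 i) 5 j) μ' = n := fun i j μ' =>
      ((hN.update (by norm_num)).update (by norm_num)).eval μ'
    classical
    simp [hp, kerPickIndex, NTm.first, (hN.update (v := 7) (i := x) (by norm_num)).eval, hN.eval,
      h' 4 ha.symm, e, e', e2, e3]
  have hv : ∀ x : Fin n, v x = if p < n then μ 4 (p * n + x) else 0 := by
    intro x
    refine (run_fill_id (ρ := ρ) (μ := μ) (v := 7) (N := N) (a := a) (n := n)
      (val := .ite (.lt (kerPickIndex N) N)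
        (.load 4 (.add (.mul (kerPickIndex N) N) (.var 7))) .zero) (hN.eval μ)
      (fun x => if p < n then μ 4 (p * n + x) else 0) fun x hx μ' h' _ => ?_).2 x x.2
    by_cases h : p < n <;>
      simp [hpick x μ' h', (hN.update (v := 7) (i := x) (by norm_num)).eval, h' 4 ha.symm, h]
  classical
  have hp' := NTm.eval_first (ρ := ρ) (μ := μ) (v := 4) (w := 5) (hN.eval μ)
    (t := .sum 8 N (.ne (.load 4 (.add (.mul (.var 5) N) (.var 8))) .zero))
    (fun j => ∑ x ∈ Finset.range n, if μ 4 (j * n + x) = 0 then 0 else 1) fun i j => by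
      have e3 : ∀ i j : ℕ, ∀ μ' : Mem F, N.eval (Function.update
          (Function.update ρ 4 i) 5 j) μ' = n := fun i j μ' =>
        ((hN.update (by norm_num)).update (by norm_num)).eval μ'
      have e' : ∀ i j l : ℕ, ∀ μ' : Mem F, N.eval (Function.update (Function.update
          (Function.update ρ 4 i) 5 j) 8 l) μ' = n := fun i j l μ' =>
        (((hN.update (by norm_num)).update (by norm_num)).update
          (by norm_num)).eval μ'
      simp [e3, e']
  change (p < n ∧ _) ∨ (p = n ∧ _) at hp'
  rcases hp' with ⟨h1, h2⟩ | ⟨h1, h2⟩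
  · have hvp : v = basisVec μ n p := by
      ext x
      rw [hv, if_pos h1]
      rfl
    refine ⟨hvp ▸ Submodule.subset_span ⟨⟨p, h1⟩, rfl⟩, fun _ h0 => h2 ?_⟩
    refine Finset.sum_eq_zero fun x hx => if_pos ?_
    have := congrFun (hvp.symm.trans h0) ⟨x, Finset.mem_range.1 hx⟩
    exact this
  · have hv0 : v = 0 := by
      ext x
      rw [hv, if_neg (by omega)]
      rfl
    refine ⟨hv0 ▸ Submodule.zero_mem _, fun hne => absurd ?_ hne⟩
    rw [basisSpan, Submodule.span_eq_bot]
    rintro _ ⟨j, rfl⟩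
    ext x
    have := Finset.sum_eq_zero_iff.1 (h2 j j.2) x (Finset.mem_range.2 x.2)
    by_contra h
    rw [if_neg (show ¬ μ 4 (j * n + x) = 0 from h)] at this
    exact one_ne_zero this

end kernel

/-! ### Translation of polynomials -/

open MvPolynomial in
/-- The polynomial `f (a + y)` in `y`. -/
noncomputable def shift {k : ℕ} {F : Type*} [Field F] (a : Fin k → F) :
    MvPolynomial (Fin k) F →ₐ[F] MvPolynomial (Fin k) F :=
  aeval fun i => C (a i) + X i

section shift

variable {k : ℕ} {F : Type*} [Field F]

@[simp] theorem shift_X (a : Fin k → F) (i : Fin k) :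
    shift a (MvPolynomial.X i) = MvPolynomial.C (a i) + MvPolynomial.X i := by
  simp [shift]

theorem shift_injective (a : Fin k → F) : Function.Injective (shift a) := by
  have h : (shift (-a)).comp (shift a) = AlgHom.id F _ := by
    refine MvPolynomial.algHom_ext fun i => ?_
    have hC : ∀ c : F, shift (-a) (MvPolynomial.C c) = MvPolynomial.C c := fun c => by
      simp [shift, MvPolynomial.algebraMap_eq]
    simp [hC]
  intro f g hfg
  have := congrArg (shift (-a)) hfg
  simpa [← AlgHom.comp_apply, h] using this

theorem coeff_zero_shift (a : Fin k → F) (f : MvPolynomial (Fin k) F) :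
    MvPolynomial.coeff 0 (shift a f) = MvPolynomial.eval a f := by
  have h : (MvPolynomial.constantCoeff.comp (shift a).toRingHom) =
      MvPolynomial.eval a := by
    refine MvPolynomial.ringHom_ext (fun c => ?_) fun i => ?_
    · have := (shift a).commutes c
      simp only [MvPolynomial.algebraMap_eq] at this
      simp [this]
    · simp
  exact congrArg (fun φ => φ f) h

/-- Substituting `x = a` in `f (x + z)` commutes with taking the coefficient of `z ^ e`. From here
on Hasse derivatives at a point are treated as coefficients of a translate. -/
theorem eval_hasseDeriv (a : Fin k → F) (e : Fin k →₀ ℕ) (f : MvPolynomial (Fin k) F) :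
    MvPolynomial.eval a (hasseDeriv e f) = MvPolynomial.coeff e (shift a f) := by
  rw [hasseDeriv, ← MvPolynomial.coeff_map]
  congr 1
  have h : (MvPolynomial.map (MvPolynomial.eval a)).comp (MvPolynomial.aeval (R := F) (fun i =>
      (MvPolynomial.C (MvPolynomial.X i) + MvPolynomial.X i :
        MvPolynomial (Fin k) (MvPolynomial (Fin k) F))) :
          MvPolynomial (Fin k) F →ₐ[F] _).toRingHom = (shift a).toRingHom := by
    refine MvPolynomial.ringHom_ext (fun c => ?_) fun i => ?_
    · simp [MvPolynomial.algebraMap_eq, shift, MvPolynomial.algebraMap_apply]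
    · simp
  exact congrArg (fun φ => φ f) h

theorem enc_apply {s : ℕ} {S : Finset F} (f : MvPolynomial (Fin k) F) (a : Fin k → S)
    (e : Exps k s) :
    enc s S f a e = MvPolynomial.coeff e.1 (shift (fun i => (a i : F)) f) :=
  eval_hasseDeriv _ _ _

/-- The coefficient of `y ^ e` in `(a + y) ^ u`. -/
def powCoeff (a : F) (u e : ℕ) : F := (u.choose e : F) * a ^ (u - e)

theorem powCoeff_eq (a : F) (u e : ℕ) :
    powCoeff a u e = ((Polynomial.X + Polynomial.C a) ^ u).coeff e := by
  rw [Polynomial.coeff_X_add_C_pow, powCoeff, mul_comm]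

/-- The translate of a monomial is a product of powers of univariate binomials, one for each
variable, and each exponent vector arises from at most one choice of terms. -/
theorem coeff_shift_monomial (a : Fin k → F) (e u : Fin k →₀ ℕ) (c : F) :
    MvPolynomial.coeff e (shift a (MvPolynomial.monomial u c)) =
      c * ∏ i, powCoeff (a i) (u i) (e i) := by
  have h1 : shift a (MvPolynomial.monomial u c) =
      MvPolynomial.C c * ∏ i, (MvPolynomial.C (a i) + MvPolynomial.X i) ^ u i := by
    rw [shift, MvPolynomial.aeval_monomial, MvPolynomial.algebraMap_eq, Finsupp.prod_fintype]
    simp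
  have h2 : ∀ i, (MvPolynomial.C (a i) + MvPolynomial.X i : MvPolynomial (Fin k) F) ^ u i =
      ∑ j ∈ Finset.range (u i + 1), MvPolynomial.monomial (Finsupp.single i j)
        (powCoeff (a i) (u i) j) := by
    intro i
    rw [add_comm, add_pow]
    refine Finset.sum_congr rfl fun j _ => ?_
    rw [MvPolynomial.monomial_eq, Finsupp.prod_single_index (by simp), powCoeff]
    simp
    ring
  rw [h1, MvPolynomial.coeff_C_mul]
  congr 1
  rw [Finset.prod_congr rfl fun i _ => h2 i, Finset.prod_univ_sum, MvPolynomial.coeff_sum]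
  have h3 : ∀ v : Fin k → ℕ, ∏ i, MvPolynomial.monomial (Finsupp.single i (v i))
      (powCoeff (a i) (u i) (v i)) = MvPolynomial.monomial (Finsupp.equivFunOnFinite.symm v)
        (∏ i, powCoeff (a i) (u i) (v i)) := by
    intro v
    have : Finsupp.equivFunOnFinite.symm v = ∑ i, Finsupp.single i (v i) := by
      ext j
      simp [Finsupp.finsetSum_apply, Finsupp.single_apply]
    rw [this, MvPolynomial.monomial_sum_prod]
  simp only [h3, MvPolynomial.coeff_monomial]
  by_cases he : ∀ i, e i ≤ u i
  · rw [Finset.sum_eq_single (fun i => e i)]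
    · rw [if_pos]
      ext; simp
    · intro v _ hv
      rw [if_neg]
      rintro rfl
      exact hv (by ext; simp)
    · intro h
      exact absurd (Fintype.mem_piFinset.2 fun i => Finset.mem_range.2
        (Nat.lt_succ_of_le (he i))) h
  -- If `e i` exceeds `u i` for some `i`, the expansion has no term with exponent `e`, and a
  -- binomial coefficient on the right is zero.
  · push Not at he
    obtain ⟨i, hi⟩ := he
    rw [Finset.prod_eq_zero (Finset.mem_univ i), Finset.sum_eq_zero]
    · intro v hv
      rw [if_neg]
      rintro rfl
      have := Finset.mem_range.1 (Fintype.mem_piFinset.1 hv i)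
      simp at hi
      omega
    · simp [powCoeff, Nat.choose_eq_zero_of_lt hi]

theorem coeff_shift (a : Fin k → F) (e : Fin k →₀ ℕ) (f : MvPolynomial (Fin k) F) :
    MvPolynomial.coeff e (shift a f) =
      ∑ u ∈ f.support, f.coeff u * ∏ i, powCoeff (a i) (u i) (e i) := by
  conv_lhs => rw [f.as_sum, map_sum, MvPolynomial.coeff_sum]
  exact Finset.sum_congr rfl fun u _ => coeff_shift_monomial _ _ _ _

/-! ### Counting zeros with multiplicities -/

/-- When variable `0` is split off, translation acts on the coefficients by the other coordinates
and then as a univariate Taylor expansion. This prepares the induction on the number of variables.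
-/
theorem finSuccEquiv_shift (a : Fin (k + 1) → F) (f : MvPolynomial (Fin (k + 1)) F) :
    MvPolynomial.finSuccEquiv F k (shift a f) =
      Polynomial.taylor (MvPolynomial.C (a 0))
        ((MvPolynomial.finSuccEquiv F k f).map (shift (Fin.tail a)).toRingHom) := by
  have h : (MvPolynomial.finSuccEquiv F k).toRingEquiv.toRingHom.comp (shift a).toRingHom =
      ((Polynomial.taylorAlgHom (MvPolynomial.C (a 0) : MvPolynomial (Fin k) F)).toRingHom.comp
        (Polynomial.mapRingHom (shift (Fin.tail a)).toRingHom)).comp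
          (MvPolynomial.finSuccEquiv F k).toRingEquiv.toRingHom := by
    refine MvPolynomial.ringHom_ext (fun c => ?_) fun i => ?_
    · have h0 : ∀ {n : ℕ} (b : Fin n → F), shift b (MvPolynomial.C c) = MvPolynomial.C c :=
        fun b => by simp [shift, MvPolynomial.algebraMap_eq]
      simp [h0, MvPolynomial.finSuccEquiv_apply]
    · refine Fin.cases ?_ (fun j => ?_) i
      · simp [MvPolynomial.finSuccEquiv_apply, add_comm]
      · simp [MvPolynomial.finSuccEquiv_apply, Fin.tail]
  exact congrArg (fun φ => φ f) h

/-- The multiplicity Schwartz–Zippel lemma: if the translates of a nonzero polynomial to the points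
`a` of a grid have no coefficients of order less than `μ a`, then the sum of all `μ a` is at most
`deg f * |S| ^ (k - 1)`. -/
theorem sum_multiplicity_le (S : Finset F) : ∀ {k : ℕ} {f : MvPolynomial (Fin k) F} (_ : f ≠ 0)
    (μ : (Fin k → S) → ℕ)
    (_ : ∀ a, ∀ e : Fin k →₀ ℕ, ∑ i, e i < μ a →
      MvPolynomial.coeff e (shift (fun i => (a i : F)) f) = 0),
    (∑ a, μ a) * S.card ≤ f.totalDegree * S.card ^ k := by
  intro k
  induction k with
  | zero =>
    intro f hf μ hμ
    -- In no variables a nonzero polynomial is a nonzero constant, so no multiplicity is positive.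
    suffices h : ∀ a, μ a = 0 by simp [h]
    intro a
    by_contra h
    apply hf
    have : shift (fun i => (a i : F)) f = 0 := by
      ext e
      rw [hμ a e (by simpa using Nat.pos_of_ne_zero h)]
      simp
    exact shift_injective _ (this.trans (map_zero _).symm)
  | succ k ih =>
    intro f hf μ hμ
    -- The induction hypothesis is applied to the leading coefficient of `f` in variable `0`, whose
    -- degree is at most `deg f - t`.
    set G := MvPolynomial.finSuccEquiv F k f with hG
    have hG0 : G ≠ 0 := by simpa [hG] using hf
    set t := G.natDegree with ht
    have hlead : G.coeff t ≠ 0 := by simpa [ht] using hG0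
    have hdeg : (G.coeff t).totalDegree + t ≤ f.totalDegree :=
      MvPolynomial.totalDegree_coeff_finSuccEquiv_add_le f t hlead
    have hex : ∀ b : Fin k → S, ∃ m, ∃ e : Fin k →₀ ℕ, ∑ i, e i = m ∧
        MvPolynomial.coeff e (shift (fun i => (b i : F)) (G.coeff t)) ≠ 0 := by
      intro b
      have : shift (fun i => (b i : F)) (G.coeff t) ≠ 0 := by
        rw [Ne, ← map_zero (shift fun i => (b i : F)), (shift_injective _).eq_iff]
        exact hlead
      obtain ⟨e, he⟩ := MvPolynomial.ne_zero_iff.1 this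
      exact ⟨_, e, rfl, he⟩
    classical
    -- The exact order of vanishing of the leading coefficient at `b`.
    set m : (Fin k → S) → ℕ := fun b => Nat.find (hex b) with hm
    have hIH := ih hlead m fun b e he => by
      by_contra h
      exact Nat.find_min (hex b) he ⟨e, rfl, h⟩
    -- On the line over `b`, choose a nonzero Taylor coefficient at `b` of the leading coefficient,
    -- with exponent `e'` of order `m b`. Extracting this Taylor coefficient from all coefficients
    -- of `G` gives a univariate `g` of degree `t`. Vanishing of `f` to order `μ` at the point over
    -- `c` makes `g` vanish at `c` to order at least `μ - m b`, and `g` has at most `t` roots with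
    -- multiplicity.
    have hline : ∀ b : Fin k → S, ∑ c : S, μ (Fin.cons c b) ≤ S.card * m b + t := by
      intro b
      obtain ⟨e', he'm, he'⟩ := Nat.find_spec (hex b)
      set φ : MvPolynomial (Fin k) F →+ F :=
        (MvPolynomial.coeffAddMonoidHom e').comp (shift fun i => (b i : F)).toRingHom.toAddMonoidHom
        with hφ
      set g : Polynomial F := ∑ j ∈ Finset.range (t + 1), Polynomial.monomial j (φ (G.coeff j))
        with hg
      have hgt : g.coeff t ≠ 0 := by
        rw [hg, Polynomial.finsetSum_coeff, Finset.sum_eq_single t]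
        · simpa [hφ] using he'
        · intro j _ hj
          rw [Polynomial.coeff_monomial, if_neg hj]
        · simp
      have hg0 : g ≠ 0 := fun h => hgt (by simp [h])
      have hgdeg : g.natDegree ≤ t := by
        refine Polynomial.natDegree_sum_le_of_forall_le _ _ fun j hj => ?_
        exact (Polynomial.natDegree_monomial_le _).trans (by simpa [Nat.lt_succ_iff] using hj)
      have htaylor : ∀ (c : S) (n : ℕ), (Polynomial.taylor (c : F) g).coeff n =
          MvPolynomial.coeff (e'.cons n) (shift (fun i => ((Fin.cons c b : Fin (k + 1) → S) i : F)) f) := by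
        intro c n
        rw [← MvPolynomial.finSuccEquiv_coeff_coeff, finSuccEquiv_shift]
        have hGs : G = ∑ j ∈ Finset.range (t + 1), Polynomial.monomial j (G.coeff j) :=
          G.as_sum_range
        rw [← hG]
        conv_rhs => rw [hGs]
        simp only [hg, Polynomial.map_sum, map_sum, Polynomial.finsetSum_coeff,
          Polynomial.map_monomial, Polynomial.taylor_monomial, Polynomial.coeff_C_mul,
          Polynomial.coeff_X_add_C_pow, MvPolynomial.coeff_sum]
        refine Finset.sum_congr rfl fun j _ => ?_
        have : ((MvPolynomial.C ((Fin.cons c b : Fin (k + 1) → S) 0 : F)) ^ (j - n) *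
            ((j.choose n : ℕ) : MvPolynomial (Fin k) F)) =
              MvPolynomial.C ((c : F) ^ (j - n) * ((j.choose n : ℕ) : F)) := by simp
        rw [this, mul_comm _ (MvPolynomial.C _), MvPolynomial.coeff_C_mul, mul_comm]
        rfl
      have hroot : ∀ c : S, μ (Fin.cons c b) ≤ m b + g.roots.count (c : F) := by
        intro c
        rw [Polynomial.count_roots, ← tsub_le_iff_left, Polynomial.le_rootMultiplicity_iff hg0,
          Polynomial.X_sub_C_pow_dvd_iff, Polynomial.X_pow_dvd_iff]
        intro n hn
        rw [← Polynomial.taylor_apply, htaylor]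
        apply hμ
        rw [Fin.sum_univ_succ]
        simp only [Finsupp.cons_zero, Finsupp.cons_succ, he'm]
        change n + m b < _
        omega
      calc ∑ c : S, μ (Fin.cons c b) ≤ ∑ c : S, (m b + g.roots.count (c : F)) :=
            Finset.sum_le_sum fun c _ => hroot c
        _ = S.card * m b + ∑ c ∈ S, g.roots.count c := by
            rw [Finset.sum_add_distrib, Finset.sum_coe_sort S (fun c => g.roots.count c)]
            simp
        _ ≤ S.card * m b + t := by
            gcongr
            calc ∑ c ∈ S, g.roots.count c ≤ ∑ c ∈ S ∪ g.roots.toFinset, g.roots.count c :=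
                  Finset.sum_le_sum_of_subset Finset.subset_union_left
              _ = g.roots.card := Multiset.sum_count_eq_card fun a ha => by simp [ha]
              _ ≤ t := (Polynomial.card_roots' g).trans hgdeg
    have hsum : ∑ a, μ a = ∑ b : Fin k → S, ∑ c : S, μ (Fin.cons c b) := by
      rw [← Fintype.sum_equiv (Fin.consEquiv fun _ => (S : Type _)) (fun x => μ (Fin.cons x.1 x.2))
        μ (fun x => rfl), Fintype.sum_prod_type_right]
    calc (∑ a, μ a) * S.card ≤ (∑ b : Fin k → S, (S.card * m b + t)) * S.card := by
          rw [hsum]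
          exact Nat.mul_le_mul_right _ (Finset.sum_le_sum fun b _ => hline b)
      _ = S.card * ((∑ b, m b) * S.card) + t * S.card ^ (k + 1) := by
          rw [Finset.sum_add_distrib, ← Finset.mul_sum]
          simp
          ring
      _ ≤ S.card * ((G.coeff t).totalDegree * S.card ^ k) + t * S.card ^ (k + 1) := by
          gcongr
      _ = ((G.coeff t).totalDegree + t) * S.card ^ (k + 1) := by ring
      _ ≤ _ := Nat.mul_le_mul_right _ hdeg

end shift

/-! ### Linear differential operators in coordinate directions -/

section dirDeriv

variable {k : ℕ} {F : Type*} [Field F]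

theorem totalDegree_le_iff {f : MvPolynomial (Fin k) F} {d : ℕ} :
    f.totalDegree ≤ d ↔ ∀ e : Fin k →₀ ℕ, d < ∑ i, e i → f.coeff e = 0 := by
  rw [MvPolynomial.totalDegree, Finset.sup_le_iff]
  refine forall_congr' fun e => ?_
  rw [MvPolynomial.mem_support_iff, Finsupp.sum_fintype _ _ (fun _ => rfl), ← not_lt]
  tauto

theorem totalDegree_shift_le (a : Fin k → F) (f : MvPolynomial (Fin k) F) :
    (shift a f).totalDegree ≤ f.totalDegree := by
  rw [totalDegree_le_iff]
  intro e he
  rw [coeff_shift]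
  refine Finset.sum_eq_zero fun u hu => ?_
  have hu' : ∑ i, u i ≤ f.totalDegree := by
    by_contra h
    exact MvPolynomial.mem_support_iff.1 hu (totalDegree_le_iff.1 le_rfl u (not_le.1 h))
  -- An exponent of smaller sum is exceeded by `e` in some coordinate, where the binomial
  -- coefficient vanishes.
  obtain ⟨i, -, hi⟩ := Finset.exists_lt_of_sum_lt (hu'.trans_lt he)
  rw [Finset.prod_eq_zero (Finset.mem_univ i), mul_zero]
  simp [powCoeff, Nat.choose_eq_zero_of_lt hi]

/-- The Hasse derivative of order `j` in the variable `i`. -/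
noncomputable def dirDeriv (i : Fin k) (j : ℕ) :
    MvPolynomial (Fin k) F →ₗ[F] MvPolynomial (Fin k) F :=
  (MvPolynomial.basisMonomials (Fin k) F).constr F fun u =>
    MvPolynomial.monomial (u - Finsupp.single i j) ((u i).choose j : F)

theorem dirDeriv_monomial (i : Fin k) (j : ℕ) (u : Fin k →₀ ℕ) (c : F) :
    dirDeriv i j (MvPolynomial.monomial u c) =
      MvPolynomial.monomial (u - Finsupp.single i j) (c * (u i).choose j) := by
  have h : MvPolynomial.monomial u c = c • MvPolynomial.basisMonomials (Fin k) F u := by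
    simp [MvPolynomial.smul_monomial]
  rw [h, map_smul, dirDeriv, Module.Basis.constr_basis, MvPolynomial.smul_monomial, smul_eq_mul]

theorem coeff_dirDeriv (i : Fin k) (j : ℕ) (f : MvPolynomial (Fin k) F) (e : Fin k →₀ ℕ) :
    (dirDeriv i j f).coeff e = (e i + j).choose j * f.coeff (e + Finsupp.single i j) := by
  induction f using MvPolynomial.induction_on' with
  | monomial u c =>
    rw [dirDeriv_monomial, MvPolynomial.coeff_monomial, MvPolynomial.coeff_monomial]
    by_cases h : u = e + Finsupp.single i j
    · subst h
      simp [mul_comm]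
    · rw [if_neg h, mul_zero]
      split_ifs with h'
      -- Truncated subtraction can lead to `e` from an exponent `u` other than the expected one, but
      -- only for `u i < j`, where the binomial coefficient is zero.
      · have hlt : u i < j := by
          by_contra hle
          apply h
          rw [← h', tsub_add_cancel_of_le]
          intro l
          by_cases hl : l = i
          · subst hl; simpa using hle
          · simp [Ne.symm hl]
        simp [Nat.choose_eq_zero_of_lt hlt]
      · rfl
  | add p q hp hq => rw [map_add, MvPolynomial.coeff_add, MvPolynomial.coeff_add, hp, hq, mul_add]

/-- Choosing `j` and then `e` further ones among `u` objects is the same as choosing `e + j` of them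
and then `j` among these. -/
theorem powCoeff_choose (a : F) (u e j : ℕ) :
    (u.choose j : F) * powCoeff a (u - j) e = (e + j).choose j * powCoeff a u (e + j) := by
  have h : u.choose j * (u - j).choose e = (e + j).choose j * u.choose (e + j) := by
    rw [mul_comm ((e + j).choose j), Nat.choose_mul, Nat.add_sub_cancel]
    omega
  rw [powCoeff, powCoeff, ← mul_assoc, ← mul_assoc, ← Nat.cast_mul, ← Nat.cast_mul, h,
    Nat.sub_sub, add_comm j e]

/-- Allows the value of a differential operator near a point to be computed from the Taylor
coefficients of `f` at that point alone. -/
theorem shift_dirDeriv (a : Fin k → F) (i : Fin k) (j : ℕ) (f : MvPolynomial (Fin k) F) :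
    shift a (dirDeriv i j f) = dirDeriv i j (shift a f) := by
  induction f using MvPolynomial.induction_on' with
  | monomial u c =>
    ext e
    rw [coeff_dirDeriv, dirDeriv_monomial, coeff_shift_monomial, coeff_shift_monomial,
      ← Finset.mul_prod_erase _ _ (Finset.mem_univ i), ← Finset.mul_prod_erase _ _
        (Finset.mem_univ i)]
    have h : ∏ l ∈ Finset.univ.erase i, powCoeff (a l) ((u - Finsupp.single i j) l) (e l) =
        ∏ l ∈ Finset.univ.erase i, powCoeff (a l) (u l) ((e + Finsupp.single i j) l) := by
      refine Finset.prod_congr rfl fun l hl => ?_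
      have : i ≠ l := (Finset.ne_of_mem_erase hl).symm
      simp [this]
    rw [h]
    generalize ∏ l ∈ Finset.univ.erase i,
      powCoeff (a l) (u l) ((e + Finsupp.single i j) l) = P
    have := powCoeff_choose (a i) (u i) (e i) j
    simp only [Finsupp.coe_tsub, Pi.sub_apply, Finsupp.single_eq_same, Finsupp.coe_add,
      Pi.add_apply]
    linear_combination (c * P) * this
  | add p q hp hq => simp only [map_add, hp, hq]

theorem totalDegree_dirDeriv_le (i : Fin k) (j : ℕ) (f : MvPolynomial (Fin k) F) :
    (dirDeriv i j f).totalDegree ≤ f.totalDegree := by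
  rw [totalDegree_le_iff]
  intro e he
  rw [coeff_dirDeriv, totalDegree_le_iff.1 le_rfl, mul_zero]
  exact he.trans_le (Finset.sum_le_sum fun l _ => by simp)

theorem map_dirDeriv {L : Type*} [Field L] (φ : F →+* L) (i : Fin k) (j : ℕ)
    (f : MvPolynomial (Fin k) F) :
    MvPolynomial.map φ (dirDeriv i j f) = dirDeriv i j (MvPolynomial.map φ f) := by
  ext e
  simp [coeff_dirDeriv, MvPolynomial.coeff_map]

/-- The differential operator `∑ j ≤ m, Q j * ∂ⱼ`, where `∂ⱼ` is the Hasse derivative of order `j`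
in the variable `i`. -/
noncomputable def diffOp (m : ℕ) (i : Fin k) (Q : ℕ → MvPolynomial (Fin k) F) :
    MvPolynomial (Fin k) F →ₗ[F] MvPolynomial (Fin k) F :=
  ∑ j ∈ Finset.range (m + 1), LinearMap.mulLeft F (Q j) ∘ₗ dirDeriv i j

theorem diffOp_apply (m : ℕ) (i : Fin k) (Q : ℕ → MvPolynomial (Fin k) F)
    (f : MvPolynomial (Fin k) F) :
    diffOp m i Q f = ∑ j ∈ Finset.range (m + 1), Q j * dirDeriv i j f := by
  simp [diffOp]

/-- Only Taylor coefficients of `f` of order at most `|e| + m` occur on the right. As long as this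
is less than `s`, they can be replaced by the symbols of a received word. -/
theorem coeff_shift_diffOp (m : ℕ) (i : Fin k) (Q : ℕ → MvPolynomial (Fin k) F)
    (f : MvPolynomial (Fin k) F) (a : Fin k → F) (e : Fin k →₀ ℕ) :
    (shift a (diffOp m i Q f)).coeff e = ∑ j ∈ Finset.range (m + 1),
      ∑ p ∈ Finset.HasAntidiagonal.antidiagonal e, (shift a (Q j)).coeff p.1 *
        ((p.2 i + j).choose j * (shift a f).coeff (p.2 + Finsupp.single i j)) := by
  simp only [diffOp_apply, map_sum, map_mul, shift_dirDeriv, MvPolynomial.coeff_sum,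
    MvPolynomial.coeff_mul, coeff_dirDeriv]

theorem totalDegree_diffOp_le {m : ℕ} {i : Fin k} {Q : ℕ → MvPolynomial (Fin k) F}
    {f : MvPolynomial (Fin k) F} {B d : ℕ} (hQ : ∀ j ≤ m, (Q j).totalDegree ≤ B)
    (hf : f.totalDegree ≤ d) : (diffOp m i Q f).totalDegree ≤ B + d := by
  rw [diffOp_apply]
  refine MvPolynomial.totalDegree_finsetSum_le fun j hj => ?_
  refine (MvPolynomial.totalDegree_mul _ _).trans (add_le_add (hQ j ?_)
    ((totalDegree_dirDeriv_le _ _ _).trans hf))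
  have := Finset.mem_range.1 hj
  omega

theorem map_diffOp {L : Type*} [Field L] (φ : F →+* L) (m : ℕ) (i : Fin k)
    (Q : ℕ → MvPolynomial (Fin k) F) (f : MvPolynomial (Fin k) F) :
    MvPolynomial.map φ (diffOp m i Q f) =
      diffOp m i (fun j => MvPolynomial.map φ (Q j)) (MvPolynomial.map φ f) := by
  simp only [diffOp_apply, map_sum, map_mul, map_dirDeriv]

/-- A polynomial that vanishes with high multiplicity at many points of a grid is zero. -/
theorem eq_zero_of_vanish {S : Finset F} {f : MvPolynomial (Fin k) F} {D l : ℕ}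
    (hf : f.totalDegree ≤ D) (A : Finset (Fin k → S))
    (hA : ∀ a ∈ A, ∀ e : Fin k →₀ ℕ, ∑ i, e i < l →
      (shift (fun i => (a i : F)) f).coeff e = 0)
    (h : D * S.card ^ k < l * A.card * S.card) : f = 0 := by
  classical
  by_contra hf0
  have := sum_multiplicity_le S hf0 (fun a => if a ∈ A then l else 0) fun a e he => by
    split_ifs at he with ha
    · exact hA a ha e he
    · omega
  simp only [Finset.sum_ite_mem, Finset.univ_inter, Finset.sum_const, smul_eq_mul] at this
  have h2 : f.totalDegree * S.card ^ k ≤ D * S.card ^ k := Nat.mul_le_mul_right _ hf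
  rw [mul_comm A.card l] at this
  omega

/-- A polynomial solution of differential equations, one in each coordinate direction, is
determined by its low-order Taylor coefficients at a point where the leading coefficients do not
vanish. -/
theorem eq_zero_of_diffOp {m d : ℕ} {Q : Fin k → ℕ → MvPolynomial (Fin k) F} {μ : Fin k → ℕ}
    (hμ : ∀ i, μ i ≤ m) (hQ : ∀ i j, μ i < j → j ≤ m → Q i j = 0) {a : Fin k → F}
    (ha : ∀ i, MvPolynomial.eval a (Q i (μ i)) ≠ 0)
    (hd : ∀ i u, μ i ≤ u → u ≤ d → (u.choose (μ i) : F) ≠ 0) {f : MvPolynomial (Fin k) F}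
    (hf : f.totalDegree ≤ d) (hfQ : ∀ i, diffOp m i (Q i) f = 0)
    (h0 : ∀ e : Fin k →₀ ℕ, (∀ i, e i < μ i) → (shift a f).coeff e = 0) : f = 0 := by
  have hdeg : ∀ e : Fin k →₀ ℕ, d < ∑ i, e i → (shift a f).coeff e = 0 :=
    totalDegree_le_iff.1 ((totalDegree_shift_le a f).trans hf)
  -- Taylor coefficients are shown to vanish by strong induction on their order.
  suffices key : ∀ n, ∀ e : Fin k →₀ ℕ, ∑ i, e i = n → (shift a f).coeff e = 0 by
    apply shift_injective a
    rw [map_zero]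
    ext e
    rw [key _ e rfl, MvPolynomial.coeff_zero]
  intro n
  induction n using Nat.strong_induction_on with
  | _ n ih =>
    intro e he
    by_cases hlow : ∀ i, e i < μ i
    · exact h0 e hlow
    push Not at hlow
    obtain ⟨i, hi⟩ := hlow
    rcases lt_or_ge d n with hdn | hdn
    · exact hdeg e (he ▸ hdn)
    have hei : e i ≤ d := by
      have := Finset.single_le_sum (f := fun l => e l) (fun _ _ => Nat.zero_le _)
        (Finset.mem_univ i)
      omega
    -- Compare coefficients of exponent `e₀` in equation `i`. The term with `j = μ i` and the
    -- constant coefficient of `Q i (μ i)` contributes the coefficient of `f` at `e`, times a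
    -- nonzero value and a nonzero binomial coefficient. All other terms with `j ≤ μ i` involve
    -- coefficients of order less than `n`, and for `j > μ i` the polynomial `Q i j` is zero.
    set e₀ := e - Finsupp.single i (μ i) with he₀
    have hadd : e₀ + Finsupp.single i (μ i) = e := by
      rw [he₀, tsub_add_cancel_of_le]
      simpa using hi
    have hsingle : ∀ j : ℕ, ∑ l, (Finsupp.single i j) l = j := fun j => by
      simp [Finsupp.single_apply]
    have hsum : ∑ l, e₀ l + μ i = n := by
      rw [← he, ← hadd]
      simp only [Finsupp.add_apply, Finset.sum_add_distrib, hsingle]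
    have hz := coeff_shift_diffOp m i (Q i) f a e₀
    rw [hfQ i, map_zero, MvPolynomial.coeff_zero, Finset.sum_eq_single (μ i)] at hz
    · rw [Finset.sum_eq_single (0, e₀)] at hz
      · rw [coeff_zero_shift, hadd] at hz
        have h1 : e₀ i + μ i = e i := by
          rw [← hadd]; simp
        rw [h1] at hz
        have := mul_eq_zero.1 hz.symm
        rcases this with h | h
        · exact absurd h (ha i)
        · exact (mul_eq_zero.1 h).resolve_left (hd i _ hi hei)
      · rintro ⟨p, q⟩ hpq hne
        have hpq' : p + q = e₀ := Finset.HasAntidiagonal.mem_antidiagonal.1 hpq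
        have hp : 0 < ∑ l, p l := by
          rw [Nat.pos_iff_ne_zero]
          intro h
          have hp0 : p = 0 := by
            ext l
            simpa using (Finset.sum_eq_zero_iff.1 h) l (Finset.mem_univ l)
          subst hp0
          exact hne (by rw [← hpq', zero_add])
        rw [ih (∑ l, (q + Finsupp.single i (μ i)) l) ?_ _ rfl, mul_zero, mul_zero]
        simp only [Finsupp.add_apply, Finset.sum_add_distrib, hsingle]
        rw [← hpq'] at hsum
        simp only [Finsupp.add_apply, Finset.sum_add_distrib] at hsum
        omega
      · intro h
        exact absurd (by simp) h
    · intro j hj hne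
      have hjm : j ≤ m := by
        have := Finset.mem_range.1 hj
        omega
      rcases lt_or_gt_of_ne hne with hlt | hgt
      · refine Finset.sum_eq_zero fun p hp => ?_
        have hpq' : p.1 + p.2 = e₀ := Finset.HasAntidiagonal.mem_antidiagonal.1 hp
        rw [ih (∑ l, (p.2 + Finsupp.single i j) l) ?_ _ rfl, mul_zero, mul_zero]
        simp only [Finsupp.add_apply, Finset.sum_add_distrib, hsingle]
        rw [← hpq'] at hsum
        simp only [Finsupp.add_apply, Finset.sum_add_distrib] at hsum
        omega
      · simp [hQ i j hgt hjm]
    · intro h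
      exact absurd (Finset.mem_range.2 (Nat.lt_succ_of_le (hμ i))) h

-- The dimension of the space of solutions, and determining sets of points

/-- The polynomials of degree at most `d` that solve the differential equations given by `Q`. -/
noncomputable def solutions (m d : ℕ) (Q : Fin k → ℕ → MvPolynomial (Fin k) F) :
    Submodule F (MvPolynomial (Fin k) F) :=
  MvPolynomial.restrictTotalDegree (Fin k) F d ⊓ ⨅ i, LinearMap.ker (diffOp m i (Q i))

theorem mem_solutions {m d : ℕ} {Q : Fin k → ℕ → MvPolynomial (Fin k) F}
    {f : MvPolynomial (Fin k) F} :
    f ∈ solutions m d Q ↔ f.totalDegree ≤ d ∧ ∀ i, diffOp m i (Q i) f = 0 := by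
  simp [solutions, MvPolynomial.mem_restrictTotalDegree, Submodule.mem_iInf]

/-- The binomial coefficient divides `u !`, which has no prime factor larger than `d`. -/
theorem cast_choose_ne_zero {d : ℕ} (hF : ringChar F = 0 ∨ d < ringChar F) {u j : ℕ} (hj : j ≤ u)
    (hu : u ≤ d) : (u.choose j : F) ≠ 0 := by
  intro h
  have hdvd := (ringChar.spec F _).1 h
  rcases hF with h0 | hlt
  · rw [h0, zero_dvd_iff] at hdvd
    exact absurd hdvd (Nat.choose_pos hj).ne'
  · have hp : (ringChar F).Prime :=
      (CharP.char_is_prime_or_zero F (ringChar F)).resolve_right (by omega)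
    have h2 : ringChar F ∣ u.factorial := by
      rw [← Nat.choose_mul_factorial_mul_factorial hj, mul_assoc]
      exact hdvd.mul_right _
    have := (hp.dvd_factorial).1 h2
    omega

/-- An `F`-linear functional on `L`, applied to the coefficients of a relation over `L`, turns it
into a relation over `F`; functionals separate the elements of `L`. -/
theorem linearIndependent_map {L ι : Type*} [Field L] [Algebra F L]
    {g : ι → MvPolynomial (Fin k) F} (hg : LinearIndependent F g) :
    LinearIndependent L fun i => MvPolynomial.map (algebraMap F L) (g i) := by
  rw [linearIndependent_iff'] at hg ⊢
  intro t c hc i hi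
  rw [← Module.forall_dual_apply_eq_zero_iff F]
  intro φ
  refine hg t (fun i => φ (c i)) ?_ i hi
  ext e
  have := congrArg (fun p => φ (MvPolynomial.coeff e p)) hc
  simp only [MvPolynomial.coeff_sum, MvPolynomial.coeff_smul, MvPolynomial.coeff_map, smul_eq_mul,
    MvPolynomial.coeff_zero, map_zero, map_sum] at this ⊢
  rw [← this]
  refine Finset.sum_congr rfl fun l _ => ?_
  rw [mul_comm (c l), ← Algebra.smul_def, map_smul, smul_eq_mul, mul_comm]

/-- The space of solutions of nontrivial differential equations in all coordinate directions has
bounded dimension. -/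
theorem card_le_of_linearIndependent_solutions {m d : ℕ} (hF : ringChar F = 0 ∨ d < ringChar F)
    {Q : Fin k → ℕ → MvPolynomial (Fin k) F} (hQ : ∀ i, ∃ j ≤ m, Q i j ≠ 0) {ι : Type*} [Fintype ι]
    {g : ι → MvPolynomial (Fin k) F} (hg : LinearIndependent F g)
    (hmem : ∀ i, g i ∈ solutions m d Q) : Fintype.card ι ≤ (m + 1) ^ k := by
  classical
  -- `F` may be finite, and then a nonzero polynomial can vanish at all of its points; over the
  -- infinite field `L` the product of the leading coefficients has a nonzero value.
  let L := AlgebraicClosure F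
  let φ := algebraMap F L
  have hφ : Function.Injective (MvPolynomial.map φ : MvPolynomial (Fin k) F → _) :=
    MvPolynomial.map_injective φ φ.injective
  let μ : Fin k → ℕ := fun i => Nat.findGreatest (fun j => Q i j ≠ 0) m
  have hμ : ∀ i, Q i (μ i) ≠ 0 := fun i => by
    obtain ⟨j, hj, hj'⟩ := hQ i
    exact Nat.findGreatest_spec (P := fun j => Q i j ≠ 0) hj hj'
  have hprod : ∏ i, MvPolynomial.map φ (Q i (μ i)) ≠ 0 :=
    Finset.prod_ne_zero_iff.2 fun i _ => by
      rw [Ne, ← map_zero (MvPolynomial.map φ), hφ.eq_iff]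
      exact hμ i
  obtain ⟨a, ha⟩ : ∃ a : Fin k → L, MvPolynomial.eval a (∏ i, MvPolynomial.map φ (Q i (μ i))) ≠ 0 := by
    by_contra! h
    exact hprod (MvPolynomial.funext fun a => by rw [h a, map_zero])
  rw [map_prod, Finset.prod_ne_zero_iff] at ha
  let W := solutions m d fun i j => MvPolynomial.map φ (Q i j)
  -- As `μ i ≤ m`, the `(m + 1) ^ k` Taylor coefficients recorded here include those that determine
  -- a solution, so `T` is injective.
  let T : W →ₗ[L] ((Fin k → Fin (m + 1)) → L) := LinearMap.pi fun e =>
    (MvPolynomial.lcoeff L (Finsupp.equivFunOnFinite.symm fun i => (e i : ℕ))) ∘ₗ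
      (shift a).toLinearMap ∘ₗ W.subtype
  have hT : LinearMap.ker T = ⊥ := by
    rw [LinearMap.ker_eq_bot']
    rintro ⟨f, hf⟩ hTf
    have hf' := mem_solutions.1 hf
    refine Subtype.ext (eq_zero_of_diffOp (m := m) (d := d) (μ := μ)
      (fun i => Nat.findGreatest_le m) (fun i j hj hjm => ?_) (fun i => ha i (Finset.mem_univ i))
      (fun i u hu hud => ?_) hf'.1 hf'.2 fun e he => ?_)
    · have := Nat.findGreatest_is_greatest hj hjm
      simp only [not_not] at this
      rw [this, map_zero]
    · have := cast_choose_ne_zero hF hu hud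
      rw [← map_natCast φ]
      exact (map_ne_zero φ).2 this
    · have := congrFun hTf fun i => ⟨e i, (he i).trans_le
        ((Nat.findGreatest_le m).trans (Nat.le_succ m))⟩
      simpa [T] using this
  have hgL := linearIndependent_map (L := L) hg
  have hmemL : ∀ i, MvPolynomial.map φ (g i) ∈ W := fun i => by
    obtain ⟨h1, h2⟩ := mem_solutions.1 (hmem i)
    refine mem_solutions.2 ⟨totalDegree_le_iff.2 fun e he => ?_, fun l => ?_⟩
    · rw [MvPolynomial.coeff_map, totalDegree_le_iff.1 h1 e he, map_zero]
    · rw [← map_diffOp, h2 l, map_zero]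
  have hgW : LinearIndependent L fun i => (⟨_, hmemL i⟩ : W) :=
    LinearIndependent.of_comp W.subtype hgL
  have := (hgW.map' T hT).fintype_card_le_finrank
  simpa using this

/-- A bound for the cardinal rank, so that it includes the finiteness of the dimension. -/
theorem finrank_solutions_le {m d : ℕ} (hF : ringChar F = 0 ∨ d < ringChar F)
    {Q : Fin k → ℕ → MvPolynomial (Fin k) F} (hQ : ∀ i, ∃ j ≤ m, Q i j ≠ 0) :
    Module.rank F (solutions m d Q) ≤ ((m + 1) ^ k : ℕ) := by
  refine rank_le fun t ht => ?_
  have := card_le_of_linearIndependent_solutions hF hQ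
    (g := fun i : t => ((i : solutions m d Q) : MvPolynomial (Fin k) F))
    (ht.map' (Submodule.subtype _) (Submodule.ker_subtype _)) fun i => (i : solutions m d Q).2
  simpa using this

/-- If the elements of a space of dimension at most `r` are determined by some linear functions,
then they are determined by `r` of these functions. -/
theorem exists_determining {V W ι : Type*} [AddCommGroup V] [Module F V] [AddCommGroup W]
    [Module F W] (φ : ι → V →ₗ[F] W) (A : Set ι) (hA : A.Nonempty) :
    ∀ (r : ℕ) (U : Submodule F V), Module.rank F U ≤ r →
      (∀ f ∈ U, (∀ a ∈ A, φ a f = 0) → f = 0) →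
      ∃ p : Fin r → ι, (∀ l, p l ∈ A) ∧ ∀ f ∈ U, (∀ l, φ (p l) f = 0) → f = 0 := by
  intro r
  induction r with
  | zero =>
    intro U hU h
    have : U = ⊥ := by
      rw [← Submodule.rank_eq_zero (R := F)]
      simpa using hU
    subst this
    exact ⟨Fin.elim0, fun l => l.elim0, fun f hf _ => by simpa using hf⟩
  | succ r ih =>
    intro U hU h
    -- The zero space needs no function at all, and any element of `A` fills up the list.
    by_cases hbot : U = ⊥
    · subst hbot
      exact ⟨fun _ => hA.some, fun _ => hA.some_mem, fun f hf _ => by simpa using hf⟩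
    -- A function that does not vanish on `U` has a kernel that meets `U` in a smaller dimension, to
    -- which the induction hypothesis applies.
    obtain ⟨f, hf, hf0⟩ := (Submodule.ne_bot_iff U).1 hbot
    obtain ⟨a, ha, haf⟩ : ∃ a ∈ A, φ a f ≠ 0 := by
      by_contra! hc
      exact hf0 (h f hf hc)
    have hfin : FiniteDimensional F U :=
      Module.rank_lt_aleph0_iff.1 (hU.trans_lt Cardinal.natCast_lt_aleph0)
    have hlt : U ⊓ LinearMap.ker (φ a) < U := by
      refine lt_of_le_of_ne inf_le_left fun heq => haf ?_
      rw [← heq] at hf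
      exact hf.2
    have hrank : Module.rank F ↥(U ⊓ LinearMap.ker (φ a)) ≤ r := by
      have : FiniteDimensional F ↥(U ⊓ LinearMap.ker (φ a)) :=
        Submodule.finiteDimensional_of_le hlt.le
      have h1 := Submodule.finrank_lt_finrank_of_lt hlt
      have h2 : Module.finrank F U ≤ r + 1 := by
        rw [← Module.finrank_eq_rank] at hU
        exact_mod_cast hU
      rw [← Module.finrank_eq_rank]
      exact_mod_cast (by omega : Module.finrank F ↥(U ⊓ LinearMap.ker (φ a)) ≤ r)
    obtain ⟨p, hp, hp'⟩ := ih (U ⊓ LinearMap.ker (φ a)) hrank fun f hf => h f hf.1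
    refine ⟨Fin.cons a p, fun l => Fin.cases ha hp l, fun f hf hl => hp' f ⟨hf, ?_⟩ fun l => ?_⟩
    · exact hl 0
    · exact hl l.succ

end dirDeriv

/-! ### Digits -/

/-- The digit number `i` of `x` in base `b`. -/
def dig (x b i : ℕ) : ℕ := x / b ^ i % b

section digits

variable {k : ℕ}

theorem dig_lt {x b : ℕ} (i : ℕ) (hb : 0 < b) : dig x b i < b := Nat.mod_lt _ hb

theorem dig_radix {b : ℕ} {v : Fin k → ℕ} (hv : ∀ i, v i < b) (i : Fin k) :
    dig (radix b v) b i = v i := by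
  have h := congrArg Fin.val (congrFun ((finFunctionFinEquiv (m := b) (n := k)).symm_apply_apply
    (fun i => ⟨v i, hv i⟩)) i)
  simp only [finFunctionFinEquiv_symm_apply_val, finFunctionFinEquiv_apply] at h
  exact h

theorem radix_dig {b x : ℕ} (hx : x < b ^ k) : radix b (fun i : Fin k => dig x b i) = x := by
  have h := congrArg Fin.val ((finFunctionFinEquiv (m := b) (n := k)).apply_symm_apply ⟨x, hx⟩)
  simp only [finFunctionFinEquiv_symm_apply_val, finFunctionFinEquiv_apply] at h
  exact h

theorem radix_add {b : ℕ} (v w : Fin k → ℕ) : radix b (v + w) = radix b v + radix b w := by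
  simp [radix, add_mul, Finset.sum_add_distrib]

theorem radix_single {b : ℕ} (i : Fin k) (j : ℕ) :
    radix b (Finsupp.single i j : Fin k →₀ ℕ) = j * b ^ (i : ℕ) := by
  rw [radix, Finset.sum_eq_single i]
  · simp
  · intro l _ hl
    simp [hl.symm]
  · simp

theorem sum_range_pow {M : Type*} [AddCommMonoid M] {b : ℕ} (g : ℕ → M) :
    ∑ x ∈ Finset.range (b ^ k), g x = ∑ u : Fin k → Fin b, g (radix b fun i => (u i : ℕ)) := by
  rw [Finset.sum_range]
  exact (Fintype.sum_equiv finFunctionFinEquiv _ _ fun u => rfl).symm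

theorem sum_range_mul {M : Type*} [AddCommMonoid M] (A B : ℕ) (g : ℕ → M) :
    ∑ x ∈ Finset.range (A * B), g x =
      ∑ j ∈ Finset.range A, ∑ u ∈ Finset.range B, g (j * B + u) := by
  induction A with
  | zero => simp
  | succ A ih => rw [Nat.succ_mul, Finset.sum_range_add, ih, Finset.sum_range_succ]

/-- The exponent vector with the digits of `x`. -/
noncomputable def digExp (k x b : ℕ) : Fin k →₀ ℕ :=
  Finsupp.equivFunOnFinite.symm fun i => dig x b i

@[simp] theorem digExp_apply (x b : ℕ) (i : Fin k) : digExp k x b i = dig x b i := rfl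

theorem digExp_radix {b : ℕ} {e : Fin k →₀ ℕ} (he : ∀ i, e i < b) :
    digExp k (radix b e) b = e := by
  ext i
  rw [digExp_apply, dig_radix he]

theorem lt_of_sum_lt {e : Fin k →₀ ℕ} {s : ℕ} (he : ∑ i, e i < s) (i : Fin k) : e i < s :=
  (Finset.single_le_sum (f := fun i => e i) (fun _ _ => Nat.zero_le _)
    (Finset.mem_univ i)).trans_lt he

theorem sum_indicator_eq_zero {p : Fin k → Prop} [DecidablePred p] :
    (∑ l, if p l then 1 else 0) = 0 ↔ ∀ l, ¬ p l := by
  simp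

/-- The form in which a program sums over decompositions of `e`: the second part is coded by its
digits, and the condition that it is at most `e` in each coordinate becomes the vanishing of a sum
of indicators, since terms have no conjunction. -/
theorem sum_antidiagonal_eq {M : Type*} [AddCommMonoid M] {s : ℕ} {e : Fin k →₀ ℕ}
    (he : ∀ i, e i < s) (g : (Fin k →₀ ℕ) → (Fin k →₀ ℕ) → M) :
    ∑ p ∈ Finset.HasAntidiagonal.antidiagonal e, g p.1 p.2 = ∑ y ∈ Finset.range (s ^ k),
      if (∑ l : Fin k, if e l < dig y s l then 1 else 0) = 0 then
        g (e - digExp k y s) (digExp k y s) else 0 := by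
  rw [← Finset.sum_filter]
  refine (Finset.sum_nbij' (fun y => (e - digExp k y s, digExp k y s))
    (fun p => radix s p.2) ?_ ?_ ?_ ?_ ?_).symm
  · intro y hy
    rw [Finset.mem_filter, sum_indicator_eq_zero] at hy
    rw [Finset.HasAntidiagonal.mem_antidiagonal]
    refine tsub_add_cancel_of_le fun l => ?_
    simpa using hy.2 l
  · intro p hp
    rw [Finset.HasAntidiagonal.mem_antidiagonal] at hp
    have hl : ∀ l, p.2 l ≤ e l := fun l => by rw [← hp]; simp
    rw [Finset.mem_filter, sum_indicator_eq_zero]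
    refine ⟨Finset.mem_range.2 (radix_lt fun l => (hl l).trans_lt (he l)), fun l => ?_⟩
    rw [dig_radix fun l => (hl l).trans_lt (he l)]
    exact not_lt.2 (hl l)
  · intro y hy
    exact radix_dig (Finset.mem_range.1 (Finset.mem_filter.1 hy).1)
  · intro p hp
    rw [Finset.HasAntidiagonal.mem_antidiagonal] at hp
    have hl : ∀ l, p.2 l ≤ e l := fun l => by rw [← hp]; simp
    rw [digExp_radix fun l => (hl l).trans_lt (he l)]
    ext1
    · rw [← hp]; simp
    · rfl
  · intro y _
    rfl

end digits

/-! ### Polynomials with coefficients in a list -/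

section polyOf

variable {k : ℕ} {F : Type u} [Field F]

/-- The polynomial of degree less than `b` in each variable with coefficients `c`. -/
noncomputable def polyOf (k b : ℕ) (c : ℕ → F) : MvPolynomial (Fin k) F :=
  ∑ u : Fin k → Fin b, MvPolynomial.monomial (Finsupp.equivFunOnFinite.symm fun i => (u i : ℕ))
    (c (radix b fun i => (u i : ℕ)))

theorem polyOf_eq_sum (b : ℕ) (c : ℕ → F) :
    polyOf k b c = ∑ x ∈ Finset.range (b ^ k), MvPolynomial.monomial (digExp k x b) (c x) := by
  rw [sum_range_pow, polyOf]
  refine Finset.sum_congr rfl fun u _ => ?_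
  have h : digExp k (radix b fun i => (u i : ℕ)) b = Finsupp.equivFunOnFinite.symm fun i => (u i : ℕ) :=
    Finsupp.ext fun i => dig_radix (fun i => (u i).2) i
  rw [h]

theorem polyOf_congr {b : ℕ} {c c' : ℕ → F} (h : ∀ x < b ^ k, c x = c' x) :
    polyOf k b c = polyOf k b c' := by
  rw [polyOf_eq_sum, polyOf_eq_sum]
  exact Finset.sum_congr rfl fun x hx => by rw [h x (Finset.mem_range.1 hx)]

theorem coeff_polyOf (b : ℕ) (c : ℕ → F) (e : Fin k →₀ ℕ) :
    (polyOf k b c).coeff e = if ∀ i, e i < b then c (radix b e) else 0 := by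
  rw [polyOf_eq_sum, MvPolynomial.coeff_sum]
  split_ifs with h
  · rw [Finset.sum_eq_single (radix b e), digExp_radix h, MvPolynomial.coeff_monomial, if_pos rfl]
    · intro x hx hne
      rw [MvPolynomial.coeff_monomial, if_neg]
      rintro rfl
      exact hne (radix_dig (Finset.mem_range.1 hx)).symm
    · intro hn
      exact absurd (Finset.mem_range.2 (radix_lt h)) hn
  · refine Finset.sum_eq_zero fun x hx => ?_
    rw [MvPolynomial.coeff_monomial, if_neg]
    rintro rfl
    refine h fun i => dig_lt _ ?_
    by_contra hb
    obtain rfl : b = 0 := by omega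
    rw [zero_pow (by have := i.2; omega)] at hx
    simp at hx

theorem coeff_polyOf_digExp {b x : ℕ} (hb : 0 < b) (hx : x < b ^ k) (c : ℕ → F) :
    (polyOf k b c).coeff (digExp k x b) = c x := by
  have h : radix b (digExp k x b) = x := radix_dig hx
  have h' : ∀ i, digExp k x b i < b := fun i => dig_lt _ hb
  rw [coeff_polyOf, if_pos h', h]

theorem polyOf_coeff {d : ℕ} {f : MvPolynomial (Fin k) F} (hf : f.totalDegree ≤ d) :
    polyOf k (d + 1) (fun x => f.coeff (digExp k x (d + 1))) = f := by
  ext e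
  rw [coeff_polyOf]
  split_ifs with h
  · rw [digExp_radix h]
  · push Not at h
    obtain ⟨i, hi⟩ := h
    refine (totalDegree_le_iff.1 hf e ?_).symm
    exact (Nat.lt_of_succ_le hi).trans_le
      (Finset.single_le_sum (f := fun i => e i) (fun _ _ => Nat.zero_le _) (Finset.mem_univ i))

theorem polyOf_smul (b : ℕ) (a : F) (c : ℕ → F) :
    polyOf k b (fun x => a * c x) = a • polyOf k b c := by
  ext e
  simp [coeff_polyOf]

theorem totalDegree_polyOf_le (b : ℕ) (c : ℕ → F) :
    (polyOf k b c).totalDegree ≤ k * (b - 1) := by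
  rw [totalDegree_le_iff]
  intro e he
  rw [coeff_polyOf, if_neg]
  intro h
  have : ∑ i, e i ≤ ∑ _i : Fin k, (b - 1) :=
    Finset.sum_le_sum fun i _ => Nat.le_sub_one_of_lt (h i)
  simp at this
  omega

theorem coeff_shift_polyOf (b : ℕ) (c : ℕ → F) (a : Fin k → F) (e : Fin k →₀ ℕ) :
    (shift a (polyOf k b c)).coeff e =
      ∑ x ∈ Finset.range (b ^ k), c x * ∏ l : Fin k, powCoeff (a l) (dig x b l) (e l) := by
  rw [polyOf_eq_sum, map_sum, MvPolynomial.coeff_sum]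
  exact Finset.sum_congr rfl fun x _ => by rw [coeff_shift_monomial]; rfl

end polyOf

/-! ### The linear systems of the decoder -/

section systems

variable {k : ℕ} {F : Type u} [Field F]

/-- The matrix of the interpolation step for direction `i`. Its columns correspond to the
coefficients of polynomials `Q 0, …, Q m` of degree less than `b` in each variable, its rows to the
conditions that `∑ j ≤ m, Q j * ∂ⱼ` annihilates the received word to order `s - m` at the points. -/
noncomputable def interpEntry (m s n b : ℕ) (i : Fin k) (pts wd : ℕ → F) (row x : ℕ) : F :=
  if ∑ l : Fin k, dig (row % s ^ k) s l + m < s then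
    ∑ y ∈ Finset.range (s ^ k),
      if (∑ l : Fin k, if dig (row % s ^ k) s l < dig y s l then 1 else 0) = 0 then
        (∏ l : Fin k, powCoeff (pts (dig (row / s ^ k) n l)) (dig (x % b ^ k) b l)
          (dig (row % s ^ k) s l - dig y s l)) *
          (powCoeff 1 (dig y s i + x / b ^ k) (x / b ^ k) *
            wd (row / s ^ k * s ^ k + (y + x / b ^ k * s ^ (i : ℕ))))
      else 0
  else 0

/-- The polynomial `Q j` given by a solution `q` of the interpolation step. -/
noncomputable def interpPoly (k b : ℕ) (q : ℕ → F) (j : ℕ) : MvPolynomial (Fin k) F :=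
  polyOf k b fun x => q (j * b ^ k + x)

/-- The values `wd` at the grid point `p` are those of the encoding of `f`. -/
def AgreesAt (s n : ℕ) (pts wd : ℕ → F) (f : MvPolynomial (Fin k) F) (p : Fin k → Fin n) : Prop :=
  ∀ e : Fin k →₀ ℕ, ∑ i, e i < s → wd (radix n (fun i => (p i : ℕ)) * s ^ k + radix s e) =
    (shift (fun i => pts (p i)) f).coeff e

theorem powCoeff_one (u e : ℕ) : powCoeff (1 : F) u e = u.choose e := by simp [powCoeff]

/-- At a point of agreement the symbols of the word are Taylor coefficients of `f`, so the equation
for this point and the exponent `e` literally says that the coefficient of exponent `e` vanishes. -/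
theorem coeff_shift_diffOp_eq_zero {m s n b : ℕ} {i : Fin k} {pts wd q : ℕ → F}
    (hq : ∀ row < n ^ k * s ^ k, ∑ x ∈ Finset.range ((m + 1) * b ^ k),
      interpEntry m s n b i pts wd row x * q x = 0)
    {p : Fin k → Fin n} {f : MvPolynomial (Fin k) F} (hf : AgreesAt s n pts wd f p)
    {e : Fin k →₀ ℕ} (he : ∑ l, e l + m < s) :
    (shift (fun l => pts (p l)) (diffOp m i (interpPoly k b q) f)).coeff e = 0 := by
  have hes : ∀ l, e l < s := lt_of_sum_lt (by omega)
  have hr := radix_lt hes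
  have hpos : 0 < s ^ k := by omega
  have hp := radix_lt fun l => (p l).2
  set row := radix n (fun l => (p l : ℕ)) * s ^ k + radix s e with hrow
  have hdiv : row / s ^ k = radix n (fun l => (p l : ℕ)) := by
    rw [hrow, add_comm, Nat.add_mul_div_right _ _ hpos, Nat.div_eq_of_lt hr, zero_add]
  have hmod : row % s ^ k = radix s e := by
    rw [hrow, add_comm, Nat.add_mul_mod_self_right, Nat.mod_eq_of_lt hr]
  have hlt : row < n ^ k * s ^ k := by
    calc row < (radix n (fun l => (p l : ℕ)) + 1) * s ^ k := by rw [add_mul]; omega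
      _ ≤ _ := Nat.mul_le_mul_right _ hp
  have h0 := hq row hlt
  rw [← h0, sum_range_mul, coeff_shift_diffOp]
  refine Finset.sum_congr rfl fun j hj => ?_
  have hjm : j ≤ m := Nat.lt_succ_iff.1 (Finset.mem_range.1 hj)
  rw [sum_antidiagonal_eq hes (fun y z => (shift (fun l => pts (p l)) (interpPoly k b q j)).coeff y *
    ((z i + j).choose j * (shift (fun l => pts (p l)) f).coeff (z + Finsupp.single i j)))]
  have hcol : ∀ u ∈ Finset.range (b ^ k), interpEntry m s n b i pts wd row (j * b ^ k + u) *
      q (j * b ^ k + u) = ∑ y ∈ Finset.range (s ^ k),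
        if (∑ l : Fin k, if e l < dig y s l then 1 else 0) = 0 then
          (q (j * b ^ k + u) * ∏ l : Fin k, powCoeff (pts (p l)) (dig u b l)
            (e l - dig y s l)) * ((dig y s i + j).choose j * wd (radix n (fun l => (p l : ℕ)) * s ^ k
              + (y + j * s ^ (i : ℕ)))) else 0 := by
    intro u hu
    have hu' := Finset.mem_range.1 hu
    have hb : 0 < b ^ k := by omega
    have e1 : (j * b ^ k + u) / b ^ k = j := by
      rw [add_comm, Nat.add_mul_div_right _ _ hb, Nat.div_eq_of_lt hu', zero_add]
    have e2 : (j * b ^ k + u) % b ^ k = u := by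
      rw [add_comm, Nat.add_mul_mod_self_right, Nat.mod_eq_of_lt hu']
    have e3 : ∀ l : Fin k, dig (radix s e) s l = e l := dig_radix hes
    have e4 : ∀ l : Fin k, dig (radix n fun l => (p l : ℕ)) n l = p l := dig_radix fun l => (p l).2
    rw [interpEntry]
    simp only [hdiv, hmod, e1, e2, e3, e4, if_pos he, powCoeff_one]
    rw [Finset.sum_mul]
    refine Finset.sum_congr rfl fun y _ => ?_
    split_ifs <;> ring
  rw [Finset.sum_congr rfl hcol, Finset.sum_comm]
  refine Finset.sum_congr rfl fun y hy => ?_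
  split_ifs with hbad
  · rw [interpPoly, coeff_shift_polyOf, Finset.sum_mul]
    refine Finset.sum_congr rfl fun u _ => ?_
    congr 1
    rw [digExp_apply]
    congr 1
    rw [← hf (digExp k y s + Finsupp.single i j)]
    · congr 2
      rw [Finsupp.coe_add, radix_add, radix_single]
      congr 1
      exact radix_dig (Finset.mem_range.1 hy)
    -- The symbol is defined and agrees with `f` here: its order is at most `|e| + j ≤ |e| + m < s`.
    · rw [sum_indicator_eq_zero] at hbad
      have h1 : ∑ l : Fin k, dig y s l ≤ ∑ l, e l :=
        Finset.sum_le_sum fun l _ => not_lt.1 (hbad l)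
      have h2 : ∑ l, (Finsupp.single i j : Fin k →₀ ℕ) l = j := by simp [Finsupp.single_apply]
      simp only [Finsupp.add_apply, Finset.sum_add_distrib, h2, digExp_apply]
      omega
  · exact Finset.sum_const_zero.symm

/-- A homogeneous linear system with more unknowns than equations has a nontrivial solution. -/
theorem matKer_ne_bot {n R : ℕ} (h : R < n) (M : ℕ → ℕ → F) : matKer n R M ≠ ⊥ := by
  have : LinearMap.ker (LinearMap.pi fun i : Fin R => rowForm n (M i)) ≠ ⊥ :=
    LinearMap.ker_ne_bot_of_finrank_lt (by simpa using h)
  rwa [LinearMap.ker_pi] at this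

/-- The equations that say that the polynomial with the given coefficients has degree at most `d`. -/
noncomputable def degreeEntry (k d row x : ℕ) : F :=
  if (if x < row then 1 else 0) + (if row < x then 1 else 0) = 0 then
    if d < ∑ l : Fin k, dig row (d + 1) l then 1 else 0
  else 0

/-- The matrix is diagonal, with `1` at the exponents of order larger than `d`. The number `N` of
unknowns may exceed the number of coefficients, to make room for a further unknown. -/
theorem totalDegree_le_iff_degreeEntry {d N : ℕ} (hN : (d + 1) ^ k ≤ N) {c : ℕ → F} :
    (∀ row < (d + 1) ^ k, ∑ x ∈ Finset.range N, degreeEntry k d row x * c x = 0) ↔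
      (polyOf k (d + 1) c).totalDegree ≤ d := by
  have h1 : ∀ row < (d + 1) ^ k, ∑ x ∈ Finset.range N, degreeEntry k d row x * c x =
      if d < ∑ l : Fin k, dig row (d + 1) l then c row else 0 := by
    intro row hrow
    rw [Finset.sum_eq_single row]
    · simp [degreeEntry]
    · intro x _ hx
      rcases lt_or_gt_of_ne hx with h | h <;> simp [degreeEntry, h]
    · intro h
      exact absurd (Finset.mem_range.2 (hrow.trans_le hN)) h
  rw [totalDegree_le_iff]
  constructor
  · intro h e he
    rw [coeff_polyOf]
    split_ifs with hd
    · have := h (radix (d + 1) e) (radix_lt hd)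
      rw [h1 _ (radix_lt hd), if_pos] at this
      · exact this
      · rwa [Finset.sum_congr rfl fun l _ => dig_radix hd l]
    · rfl
  · intro h row hrow
    rw [h1 row hrow]
    split_ifs with hd
    · have := h (digExp k row (d + 1)) hd
      rwa [coeff_polyOf, if_pos, show radix (d + 1) (digExp k row (d + 1)) = row from
        radix_dig hrow] at this
      exact fun l => dig_lt _ (Nat.succ_pos d)
    · rfl

/-- The equations that say that the polynomial with the given coefficients solves the differential
equation given by `q`. -/
noncomputable def solveEntry (m b d : ℕ) (i : Fin k) (q : ℕ → F) (row x : ℕ) : F :=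
  if x < (d + 1) ^ k then
    ∑ j ∈ Finset.range (m + 1),
      if (∑ l : Fin k, ((if dig row (b + d) l + (if l = i then j else 0) < dig x (d + 1) l
          then 1 else 0) +
        if dig row (b + d) l + (if l = i then j else 0) - dig x (d + 1) l < b then 0 else 1)) = 0
      then q (j * b ^ k + radix b fun l : Fin k =>
          dig row (b + d) l + (if l = i then j else 0) - dig x (d + 1) l) *
        powCoeff 1 (dig x (d + 1) i) j
      else 0
  else 0

/-- The complementary exponent is `y` plus `j` in direction `i` minus `w`; adding before subtracting
avoids nested truncated differences. For `w i < j` both sides are zero by the binomial coefficient.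
-/
theorem coeff_mul_dirDeriv_monomial (b : ℕ) (c : ℕ → F) (i : Fin k) (j : ℕ) (w y : Fin k →₀ ℕ)
    (a : F) : (polyOf k b c * dirDeriv i j (MvPolynomial.monomial w a)).coeff y =
      if ∀ l, w l ≤ y l + (if l = i then j else 0) ∧ y l + (if l = i then j else 0) - w l < b then
        c (radix b fun l => y l + (if l = i then j else 0) - w l) * powCoeff 1 (w i) j * a
      else 0 := by
  rw [dirDeriv_monomial, MvPolynomial.coeff_mul_monomial', powCoeff_one]
  rcases lt_or_ge (w i) j with h | h
  · simp [Nat.choose_eq_zero_of_lt h]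
  have hl : ∀ l, (w - Finsupp.single i j) l = w l - (if l = i then j else 0) := by
    intro l
    by_cases hli : l = i
    · subst hli; simp
    · simp [hli]
  have hle : w - Finsupp.single i j ≤ y ↔ ∀ l, w l ≤ y l + (if l = i then j else 0) := by
    refine forall_congr' fun l => ?_
    rw [hl, tsub_le_iff_right]
  have hsub : ∀ l, (y - (w - Finsupp.single i j)) l = y l + (if l = i then j else 0) - w l := by
    intro l
    rw [Finsupp.tsub_apply, hl]
    by_cases hli : l = i
    · subst hli; simp; omega
    · simp [hli]
  have hfun : ((y - (w - Finsupp.single i j) : Fin k →₀ ℕ) : Fin k → ℕ) =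
      fun l => y l + (if l = i then j else 0) - w l := funext hsub
  rw [coeff_polyOf]
  simp only [hle, hsub, hfun, forall_and]
  split_ifs with h1 h2 h3 h4 h5
  · ring
  · exact absurd ⟨h1, h2⟩ h3
  · exact absurd h4.2 h2
  · simp
  · exact absurd h5.1 h1
  · rfl

theorem coeff_diffOp_interpPoly (m b d : ℕ) (i : Fin k) (q c : ℕ → F) (y : Fin k →₀ ℕ) :
    (diffOp m i (interpPoly k b q) (polyOf k (d + 1) c)).coeff y =
      ∑ x ∈ Finset.range ((d + 1) ^ k), (∑ j ∈ Finset.range (m + 1),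
        if ∀ l : Fin k, dig x (d + 1) l ≤ y l + (if l = i then j else 0) ∧
          y l + (if l = i then j else 0) - dig x (d + 1) l < b
        then q (j * b ^ k + radix b fun l : Fin k =>
          y l + (if l = i then j else 0) - dig x (d + 1) l) * powCoeff 1 (dig x (d + 1) i) j
        else 0) * c x := by
  rw [diffOp_apply, polyOf_eq_sum]
  simp only [map_sum, Finset.mul_sum, MvPolynomial.coeff_sum, interpPoly,
    coeff_mul_dirDeriv_monomial]
  rw [Finset.sum_comm]
  refine Finset.sum_congr rfl fun x _ => ?_
  rw [Finset.sum_mul]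
  refine Finset.sum_congr rfl fun j _ => ?_
  rw [ite_mul, zero_mul]
  exact if_congr Iff.rfl rfl rfl

/-- The degree in each variable of a coefficient polynomial is less than `b`, that of a derivative
at most `d`, so only exponents with entries less than `b + d` have to be compared. Columns of
additional unknowns are zero. -/
theorem diffOp_eq_zero_iff_solveEntry {m b d N : ℕ} (hN : (d + 1) ^ k ≤ N) {i : Fin k}
    {q c : ℕ → F} :
    (∀ row < (b + d) ^ k, ∑ x ∈ Finset.range N, solveEntry m b d i q row x * c x = 0) ↔
      diffOp m i (interpPoly k b q) (polyOf k (d + 1) c) = 0 := by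
  have h1 : ∀ y : Fin k →₀ ℕ, (∀ l, y l < b + d) →
      ∑ x ∈ Finset.range N, solveEntry m b d i q (radix (b + d) y) x * c x =
        (diffOp m i (interpPoly k b q) (polyOf k (d + 1) c)).coeff y := by
    intro y hy
    rw [coeff_diffOp_interpPoly, ← Finset.sum_subset (Finset.range_subset_range.2 hN)]
    · refine Finset.sum_congr rfl fun x hx => ?_
      rw [solveEntry, if_pos (Finset.mem_range.1 hx)]
      simp only [dig_radix hy]
      congr 1
      refine Finset.sum_congr rfl fun j _ => ?_
      refine if_congr ?_ rfl rfl
      rw [Finset.sum_eq_zero_iff]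
      refine ⟨fun h l => ?_, fun h l _ => ?_⟩
      · have h2 := h l (Finset.mem_univ l)
        generalize (y l + if l = i then j else 0) = g at h2 ⊢
        split_ifs at h2 <;> omega
      · obtain ⟨h1, h2⟩ := h l
        generalize (y l + if l = i then j else 0) = g at h1 h2 ⊢
        rw [if_neg (not_lt.2 h1), if_pos h2, add_zero]
    · intro x _ hx
      rw [solveEntry, if_neg (by simpa using hx), zero_mul]
  constructor
  · intro h
    ext y
    rw [MvPolynomial.coeff_zero]
    by_cases hy : ∀ l, y l < b + d
    · rw [← h1 y hy, h _ (radix_lt hy)]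
    · push Not at hy
      obtain ⟨l, hl⟩ := hy
      rw [coeff_diffOp_interpPoly]
      refine Finset.sum_eq_zero fun x _ => ?_
      rw [Finset.sum_eq_zero, zero_mul]
      intro j _
      rw [if_neg]
      intro hc
      have h2 := (hc l).2
      have h3 := dig_lt (x := x) (b := d + 1) l d.succ_pos
      split_ifs at h2 <;> omega
  · intro h row hrow
    have hpos : ∀ l : Fin k, digExp k row (b + d) l < b + d := fun l => by
      refine dig_lt _ ?_
      by_contra hb
      obtain hb : b + d = 0 := by omega
      rw [hb, zero_pow (by have := l.2; omega)] at hrow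
      omega
    have := h1 (digExp k row (b + d)) hpos
    rw [h, MvPolynomial.coeff_zero] at this
    rwa [show radix (b + d) (digExp k row (b + d)) = row from radix_dig hrow] at this

/-- The equations that say that the encoding of the polynomial with the given coefficients agrees
with a multiple of the received word at point number `pt`; the factor is the unknown number
`(d + 1) ^ k`. -/
noncomputable def pointEntry (k s n d : ℕ) (pts wd : ℕ → F) (pt row x : ℕ) : F :=
  if ∑ l : Fin k, dig row s l < s then
    if x < (d + 1) ^ k then
      ∏ l : Fin k, powCoeff (pts (dig pt n l)) (dig x (d + 1) l) (dig row s l)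
    else 0 - wd (pt * s ^ k + row)
  else 0

/-- Rows run over all digit strings in base `s`; those of digit sum at least `s` are zero equations.
-/
theorem pointEntry_iff {s n d : ℕ} {pts wd c : ℕ → F} {p : Fin k → Fin n} :
    (∀ row < s ^ k, ∑ x ∈ Finset.range ((d + 1) ^ k + 1),
      pointEntry k s n d pts wd (radix n fun l => (p l : ℕ)) row x * c x = 0) ↔
    ∀ e : Fin k →₀ ℕ, ∑ l, e l < s →
      (shift (fun l => pts (p l)) (polyOf k (d + 1) c)).coeff e =
        wd (radix n (fun l => (p l : ℕ)) * s ^ k + radix s e) * c ((d + 1) ^ k) := by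
  have h1 : ∀ row < s ^ k, ∑ x ∈ Finset.range ((d + 1) ^ k + 1),
      pointEntry k s n d pts wd (radix n fun l => (p l : ℕ)) row x * c x =
      if ∑ l, digExp k row s l < s then
        (shift (fun l => pts (p l)) (polyOf k (d + 1) c)).coeff (digExp k row s) -
          wd (radix n (fun l => (p l : ℕ)) * s ^ k + row) * c ((d + 1) ^ k) else 0 := by
    intro row _
    have e4 : ∀ l : Fin k, dig (radix n fun l => (p l : ℕ)) n l = p l := dig_radix fun l => (p l).2
    have e6 : ∀ a a' : F, (0 - a) * a' = -(a * a') := fun a a' => by ring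
    have e5 : ∑ l, digExp k row s l = ∑ l : Fin k, dig row s l := rfl
    simp only [pointEntry, e4, e5]
    split_ifs with h
    · rw [Finset.sum_range_succ, if_neg (lt_irrefl _), coeff_shift_polyOf, e6,
        sub_eq_add_neg (_ : F) (_ * _)]
      congr 1
      refine Finset.sum_congr rfl fun x hx => ?_
      rw [if_pos (Finset.mem_range.1 hx), mul_comm]
      rfl
    · simp
  constructor
  · intro h e he
    have hes := lt_of_sum_lt he
    have := h _ (radix_lt hes)
    rw [h1 _ (radix_lt hes), digExp_radix hes, if_pos he] at this
    exact sub_eq_zero.1 this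
  · intro h row hrow
    rw [h1 row hrow]
    split_ifs with hs
    · rw [h _ hs, show radix s (digExp k row s) = row from radix_dig hrow, sub_self]
    · rfl

end systems

/-! ### Terms for digits, finite sums and tables -/

/-- The power of a term with a fixed exponent. -/
def NTm.pow (b : NTm) : ℕ → NTm
  | 0 => .const 1
  | i + 1 => .mul (NTm.pow b i) b

/-- The digit number `i` of `x` in base `b`. -/
def NTm.dig (x b : NTm) (i : ℕ) : NTm := .mod (.div x (b.pow i)) b

/-- A sum of fixed length. -/
def NTm.sumFin {k : ℕ} (f : Fin k → NTm) : NTm := (List.ofFn f).foldr NTm.add (.const 0)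

/-- A product of fixed length. -/
def FTm.prodFin {k : ℕ} (f : Fin k → FTm) : FTm := (List.ofFn f).foldr FTm.mul .one

/-- Branching on a comparison. -/
def NTm.iteLt (a b x y : NTm) : NTm := .ite (.lt a b) x y

/-- Branching on a comparison. -/
def FTm.iteLt (a b : NTm) (x y : FTm) : FTm := .ite (.lt a b) x y

section terms

variable {F : Type u} [Field F] {k : ℕ} (ρ : ℕ → ℕ) (μ : Mem F)

@[simp] theorem NTm.eval_pow (b : NTm) (i : ℕ) : (b.pow i).eval ρ μ = b.eval ρ μ ^ i := by
  induction i with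
  | zero => simp [NTm.pow]
  | succ i ih => simp [NTm.pow, ih, pow_succ]

@[simp] theorem NTm.eval_dig (x b : NTm) (i : ℕ) :
    (x.dig b i).eval ρ μ = MultCode.dig (x.eval ρ μ) (b.eval ρ μ) i := by
  simp [NTm.dig, MultCode.dig]

@[simp] theorem NTm.eval_sumFin (f : Fin k → NTm) :
    (NTm.sumFin f).eval ρ μ = ∑ i, (f i).eval ρ μ := by
  have h : ∀ l : List NTm, (l.foldr NTm.add (.const 0)).eval ρ μ =
      (l.map fun a => a.eval ρ μ).sum := by
    intro l
    induction l with
    | nil => simp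
    | cons a l ih => simp [ih]
  rw [NTm.sumFin, h, List.map_ofFn, List.sum_ofFn]
  rfl

@[simp] theorem FTm.eval_prodFin (f : Fin k → FTm) :
    (FTm.prodFin f).eval ρ μ = ∏ i, (f i).eval ρ μ := by
  have h : ∀ l : List FTm, (l.foldr FTm.mul .one).eval ρ μ =
      (l.map fun a => a.eval ρ μ).prod := by
    intro l
    induction l with
    | nil => simp
    | cons a l ih => simp [ih]
  rw [FTm.prodFin, h, List.map_ofFn, List.prod_ofFn]
  rfl

@[simp] theorem NTm.eval_iteLt (a b x y : NTm) : (NTm.iteLt a b x y).eval ρ μ =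
    if a.eval ρ μ < b.eval ρ μ then x.eval ρ μ else y.eval ρ μ := by
  by_cases h : a.eval ρ μ < b.eval ρ μ <;> simp [NTm.iteLt, h]

@[simp] theorem FTm.eval_iteLt (a b : NTm) (x y : FTm) : (FTm.iteLt a b x y).eval ρ μ =
    if a.eval ρ μ < b.eval ρ μ then x.eval ρ μ else y.eval ρ μ := by
  by_cases h : a.eval ρ μ < b.eval ρ μ <;> simp [FTm.iteLt, h]

end terms

/-! ### The decoder -/

/-- The first four variables hold the parameters `s`, `d`, `n` and `t`. -/
structure Params (ρ : ℕ → ℕ) (s d n t : ℕ) : Prop where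
  zero : ρ 0 = s
  one : ρ 1 = d
  two : ρ 2 = n
  three : ρ 3 = t

theorem Params.update {ρ : ℕ → ℕ} {s d n t : ℕ} (h : Params ρ s d n t) {v i : ℕ} (hv : 4 ≤ v) :
    Params (Function.update ρ v i) s d n t := by
  have h' : ∀ w < 4, Function.update ρ v i w = ρ w := fun w hw => by simp [show w ≠ v by omega]
  exact ⟨(h' 0 (by norm_num)).trans h.zero, (h' 1 (by norm_num)).trans h.one,
    (h' 2 (by norm_num)).trans h.two, (h' 3 (by norm_num)).trans h.three⟩

theorem Params.congr {ρ ρ' : ℕ → ℕ} {s d n t : ℕ} (h : Params ρ s d n t)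
    (h' : ∀ w < 4, ρ' w = ρ w) : Params ρ' s d n t :=
  ⟨(h' 0 (by norm_num)).trans h.zero, (h' 1 (by norm_num)).trans h.one,
    (h' 2 (by norm_num)).trans h.two, (h' 3 (by norm_num)).trans h.three⟩

theorem Params.isParam {F : Type u} [Field F] {ρ : ℕ → ℕ} {s d n t x : ℕ} (h : Params ρ s d n t)
    {N : NTm} (hN : ∀ ρ', Params ρ' s d n t → ∀ μ' : Mem F, N.eval ρ' μ' = x) :
    N.IsParam F ρ x :=
  fun ρ' μ' h' => hN ρ' (h.congr h') μ'

/-- The number of exponents in each variable of the polynomials of the interpolation step. -/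
def boxSize (M s n : ℕ) : ℕ := n * s / M + 1

/-- The term for `boxSize`. -/
def boxTm (M : ℕ) : NTm := .add (.div (.mul (.var 2) (.var 0)) (.const M)) (.const 1)

/-- The term for `d + 1`. -/
def degTm : NTm := .add (.var 1) (.const 1)

/-- Table lookup for the coefficient of `y ^ e` in `(a + y) ^ u`, where `a` is element number `l` of
`S`, or `1` for `l = n`. -/
def powTm (u l e : NTm) : FTm :=
  .load 3 (.add (.mul (.add (.mul u (.add (.var 2) (.const 1))) l) (.var 0)) e)

/-- Compute the table. -/
def tableCmd (M : ℕ) : Cmd :=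
  let s := NTm.var 0
  let n := NTm.add (.var 2) (.const 1)
  let x := NTm.var 4
  let U := NTm.add (.add (boxTm M) (.var 1)) (.add (.mul (.const 2) s) (.const 1))
  let l := NTm.mod (.div x s) n
  .loop 4 (.mul (.mul U n) s) (.set 3 x
    (.ite (.div x (.mul n s))
      (.add (.mul (.iteLt l (.var 2) (.load 0 l) .one) (.load 3 (.sub x (.mul n s))))
        (.ite (.mod x s) (.load 3 (.sub (.sub x (.mul n s)) (.const 1))) .zero))
      (.ite (.mod x s) .zero .one)))

section decoder

variable {F : Type u} [Field F] {k : ℕ} {ρ : ℕ → ℕ} {μ : Mem F} {s d n t M : ℕ} {pts wd : ℕ → F}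

theorem Params.eval_boxTm (h : Params ρ s d n t) : (boxTm M).eval ρ μ = boxSize M s n := by
  simp [boxTm, boxSize, h.zero, h.two]

theorem Params.eval_degTm (h : Params ρ s d n t) : degTm.eval ρ μ = d + 1 := by
  simp [degTm, h.one]

/-- The memory holds the points, the received word and the table. -/
structure Ready (M s d n : ℕ) (pts wd : ℕ → F) (μ : Mem F) : Prop where
  zero : μ 0 = pts
  one : μ 1 = wd
  table : ∀ u < boxSize M s n + d + (2 * s + 1), ∀ l ≤ n, ∀ e < s,
    μ 3 ((u * (n + 1) + l) * s + e) = powCoeff (if l < n then pts l else 1) u e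

theorem Ready.congr {μ' : Mem F} (h : Ready M s d n pts wd μ) (h0 : μ' 0 = μ 0) (h1 : μ' 1 = μ 1)
    (h3 : μ' 3 = μ 3) : Ready M s d n pts wd μ' :=
  ⟨h0.trans h.zero, h1.trans h.one, fun u hu l hl e he => by rw [h3, h.table u hu l hl e he]⟩

theorem powCoeff_zero_left (a : F) (e : ℕ) : powCoeff a 0 e = if e = 0 then 1 else 0 := by
  rcases e with _ | e <;> simp [powCoeff]

/-- Pascal's rule for `(a + y) ^ (u + 1)`. It yields binomial coefficients and powers in the field
by additions and multiplications only. -/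
theorem powCoeff_succ (a : F) (u e : ℕ) :
    powCoeff a (u + 1) e = a * powCoeff a u e + if e = 0 then 0 else powCoeff a u (e - 1) := by
  rw [powCoeff_eq, powCoeff_eq, pow_succ, mul_add, Polynomial.coeff_add, Polynomial.coeff_mul_C]
  rcases e with _ | e
  · simp [mul_comm]
  · simp [powCoeff_eq, mul_comm, add_comm]

/-- Cell `(u * (n + 1) + l) * s + e` belongs to the power `u`, the point `l` and the exponent `e`.
Its predecessor for `u - 1` lies `(n + 1) * s` cells earlier, the one with `e - 1` in addition one
more cell earlier, so filling in increasing order realises Pascal's rule. -/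
theorem ready_tableCmd (hρ : Params ρ s d n t) (hs : 0 < s) (h0 : μ 0 = pts) (h1 : μ 1 = wd) :
    Ready M s d n pts wd ((tableCmd M).run ρ μ) := by
  set U := boxSize M s n + d + (2 * s + 1) with hU
  have hfst : ∀ u l e : ℕ, l ≤ n → e < s → ((u * (n + 1) + l) * s + e) / ((n + 1) * s) = u := by
    intro u l e hl he
    rw [mul_comm (n + 1) s, ← Nat.div_div_eq_div_mul, mul_add_div_eq he,
      mul_add_div_eq (Nat.lt_succ_of_le hl)]
  have hsnd : ∀ u l e : ℕ, l ≤ n → e < s → ((u * (n + 1) + l) * s + e) / s % (n + 1) = l := by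
    intro u l e hl he
    rw [mul_add_div_eq he, mul_add_mod_eq (Nat.lt_succ_of_le hl)]
  have key := run_fill (ρ := ρ) (μ := μ) (v := 4) (N := .mul (.mul (.add (.add (boxTm M) (.var 1))
      (.add (.mul (.const 2) (.var 0)) (.const 1))) (.add (.var 2) (.const 1))) (.var 0)) (a := 3)
    (idx := .var 4) (val := (.ite (.div (.var 4) (.mul (.add (.var 2) (.const 1)) (.var 0)))
      (.add (.mul (.iteLt (.mod (.div (.var 4) (.var 0)) (.add (.var 2) (.const 1))) (.var 2)
        (.load 0 (.mod (.div (.var 4) (.var 0)) (.add (.var 2) (.const 1)))) .one)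
          (.load 3 (.sub (.var 4) (.mul (.add (.var 2) (.const 1)) (.var 0)))))
        (.ite (.mod (.var 4) (.var 0)) (.load 3 (.sub (.sub (.var 4)
          (.mul (.add (.var 2) (.const 1)) (.var 0))) (.const 1))) .zero))
      (.ite (.mod (.var 4) (.var 0)) .zero .one))) (n := U * (n + 1) * s)
    (by simp [hρ.eval_boxTm, hρ.zero, hρ.one, hρ.two, hU]) id
    (fun x => powCoeff (if x / s % (n + 1) < n then pts (x / s % (n + 1)) else 1)
      (x / ((n + 1) * s)) (x % s))
    (fun i _ μ' _ => by simp) (fun i _ j hj => hj.ne) (fun x hx μ' h2 h3 _ => by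
      have hρ' := hρ.update (v := 4) (i := x) le_rfl
      simp only [FTm.eval_ite, FTm.eval_iteLt, FTm.eval_add, FTm.eval_mul, FTm.eval_load,
        FTm.eval_one, FTm.eval_zero, NTm.eval_div, NTm.eval_mul, NTm.eval_add, NTm.eval_mod,
        NTm.eval_sub, NTm.eval_const, NTm.eval_var, hρ'.zero, hρ'.two, Function.update_self]
      rw [h2 0 (by norm_num), h0]
      have hpos : 0 < (n + 1) * s := by positivity
      by_cases h4 : x / ((n + 1) * s) = 0
      · rw [if_pos h4, h4, powCoeff_zero_left]
      rw [if_neg h4]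
      have hle : (n + 1) * s ≤ x := by
        by_contra hlt
        exact h4 (Nat.div_eq_of_lt (not_le.1 hlt))
      obtain ⟨w, rfl⟩ := Nat.exists_eq_add_of_le hle
      have e1 : ((n + 1) * s + w) / ((n + 1) * s) = w / ((n + 1) * s) + 1 := by
        rw [add_comm, Nat.add_div_right _ hpos]
      have e2 : ((n + 1) * s + w) % s = w % s := by
        rw [add_comm, Nat.add_mul_mod_self_right]
      have e3 : ((n + 1) * s + w) / s % (n + 1) = w / s % (n + 1) := by
        rw [add_comm, Nat.add_mul_div_right _ _ hs, Nat.add_mod_right]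
      have e4 := h3 w (by omega)
      have e5 : w % s ≠ 0 → μ' 3 (w - 1) = powCoeff (if w / s % (n + 1) < n then
          pts (w / s % (n + 1)) else 1) (w / ((n + 1) * s)) (w % s - 1) := by
        intro hw
        have h6 : w - 1 = w / s * s + (w % s - 1) := by
          have := Nat.div_add_mod w s
          rw [mul_comm] at this
          omega
        have h7 : w % s - 1 < s := by have := Nat.mod_lt w hs; omega
        have h8 : (w - 1) / s = w / s := by rw [h6, mul_add_div_eq h7]
        have h9 : (w - 1) % s = w % s - 1 := by rw [h6, mul_add_mod_eq h7]
        have := h3 (w - 1) (by omega)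
        rwa [id, h8, h9, mul_comm (n + 1) s, ← Nat.div_div_eq_div_mul, h8,
          Nat.div_div_eq_div_mul, mul_comm s] at this
      simp only [id] at e4
      simp only [Nat.add_sub_cancel_left, e1, e2, e3, powCoeff_succ, e4]
      split_ifs <;> simp_all)
  have hrun : (tableCmd M).run ρ μ 0 = μ 0 ∧ (tableCmd M).run ρ μ 1 = μ 1 :=
    ⟨key.1 0 (by norm_num), key.1 1 (by norm_num)⟩
  refine ⟨hrun.1.trans h0, hrun.2.trans h1, fun u hu l hl e he => ?_⟩
  have hlt : (u * (n + 1) + l) * s + e < U * (n + 1) * s :=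
    calc (u * (n + 1) + l) * s + e < (u * (n + 1) + l + 1) * s := by rw [add_mul _ 1]; omega
      _ ≤ ((u + 1) * (n + 1)) * s := Nat.mul_le_mul_right _ (by rw [add_mul u 1]; omega)
      _ ≤ _ := Nat.mul_le_mul_right _ (Nat.mul_le_mul_right _ hu)
  refine (key.2.1 _ hlt).trans ?_
  rw [hfst u l e hl he, hsnd u l e hl he, mul_add_mod_eq he]

end decoder

-- Terms for the entries of the linear systems

/-- The number `∑ l, f l * b ^ l`. -/
def NTm.radix {k : ℕ} (b : NTm) (f : Fin k → NTm) : NTm := .sumFin fun l => .mul (f l) (b.pow l)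

/-- The term for `interpEntry`; row and column are in variables `6` and `7`. -/
def interpTm (m M : ℕ) {k : ℕ} (i : Fin k) : FTm :=
  let s := NTm.var 0
  let q := s.pow k
  let e : ℕ → NTm := ((NTm.var 6).mod q).dig s
  let pt := (NTm.var 6).div q
  let b := boxTm M
  let u := (NTm.var 7).mod (b.pow k)
  let j := (NTm.var 7).div (b.pow k)
  let y := NTm.var 8
  .iteLt (.add (.sumFin fun l : Fin k => e l) (.const m)) s
    (.sum 8 q (.ite (.sumFin fun l : Fin k => .lt (e l) (y.dig s l)) .zero
      (.mul (.prodFin fun l : Fin k => powTm (u.dig b l) (pt.dig (.var 2) l)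
          (.sub (e l) (y.dig s l)))
        (.mul (powTm (.add (y.dig s i) j) (.var 2) j)
          (.load 1 (.add (.mul pt q) (.add y (.mul j (s.pow i)))))))))
    .zero

/-- The term for `degreeEntry`; row and column are in variables `6` and `7`. -/
def degreeTm (k : ℕ) : FTm :=
  .ite (.add (.lt (.var 7) (.var 6)) (.lt (.var 6) (.var 7))) .zero
    (.iteLt (.var 1) (.sumFin fun l : Fin k => (NTm.var 6).dig degTm l) .one .zero)

/-- The term for `solveEntry`; row and column are in variables `6` and `7`, and the solution of the
interpolation step in array `10 + i`. -/
def solveTm (m M : ℕ) {k : ℕ} (i : Fin k) : FTm :=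
  let b := boxTm M
  let r : Fin k → NTm := fun l =>
    .add ((NTm.var 6).dig (.add b (.var 1)) l) (if l = i then .var 8 else .const 0)
  let w : ℕ → NTm := (NTm.var 7).dig degTm
  .iteLt (.var 7) (degTm.pow k)
    (.sum 8 (.const (m + 1))
      (.ite (.sumFin fun l : Fin k => .add (.lt (r l) (w l))
          (.iteLt (.sub (r l) (w l)) b (.const 0) (.const 1))) .zero
        (.mul (.load (10 + i) (.add (.mul (.var 8) (b.pow k)) (b.radix fun l => .sub (r l) (w l))))
          (powTm (w i) (.var 2) (.var 8)))))
    .zero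

/-- The term for `pointEntry`; row and column are in variables `6` and `7`. -/
def pointTm (k : ℕ) (pt : NTm) : FTm :=
  let row := NTm.var 6
  let q := (NTm.var 0).pow k
  .iteLt (.sumFin fun l : Fin k => row.dig (.var 0) l) (.var 0)
    (.iteLt (.var 7) (degTm.pow k)
      (.prodFin fun l : Fin k => powTm ((NTm.var 7).dig degTm l) (pt.dig (.var 2) l)
        (row.dig (.var 0) l))
      (.sub .zero (.load 1 (.add (.mul pt q) row))))
    .zero

section decoder

variable {F : Type u} [Field F] {k : ℕ} {ρ : ℕ → ℕ} {μ : Mem F} {s d n t M : ℕ} {pts wd : ℕ → F}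

@[simp] theorem NTm.eval_radix (b : NTm) (f : Fin k → NTm) :
    (b.radix f).eval ρ μ = MultCode.radix (b.eval ρ μ) fun l => (f l).eval ρ μ := by
  simp [NTm.radix, MultCode.radix]

theorem boxSize_pos : 0 < boxSize M s n := Nat.succ_pos _

theorem eval_powTm (hρ : Params ρ s d n t) (hμ : Ready M s d n pts wd μ) {u l e : NTm}
    (hu : u.eval ρ μ < boxSize M s n + d + (2 * s + 1)) (hl : l.eval ρ μ ≤ n)
    (he : e.eval ρ μ < s) : (powTm u l e).eval ρ μ =
      powCoeff (if l.eval ρ μ < n then pts (l.eval ρ μ) else 1) (u.eval ρ μ) (e.eval ρ μ) := by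
  simp only [powTm, FTm.eval_load, NTm.eval_add, NTm.eval_mul, NTm.eval_var, NTm.eval_const,
    hρ.zero, hρ.two]
  exact hμ.table _ hu _ hl _ he

/-- The point is that all lookups stay inside the table: `hx` gives `j ≤ m < s`, and the power in
the binomial factor is at most `(s - 1) + m < 2 * s`. -/
theorem eval_interpTm {m : ℕ} {i : Fin k} (hρ : Params ρ s d n t) (hμ : Ready M s d n pts wd μ)
    (hm : m < s) (hn : 0 < n) (hx : ρ 7 < (m + 1) * boxSize M s n ^ k) :
    (interpTm m M i).eval ρ μ = interpEntry m s n (boxSize M s n) i pts wd (ρ 6) (ρ 7) := by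
  have hs : 0 < s := by omega
  have hj : ρ 7 / boxSize M s n ^ k ≤ m := Nat.lt_succ_iff.1 (Nat.div_lt_of_lt_mul (by
    rwa [mul_comm] at hx))
  simp only [interpTm, interpEntry, FTm.eval_iteLt, NTm.eval_add, NTm.eval_sumFin, NTm.eval_const,
    NTm.eval_dig, NTm.eval_mod, NTm.eval_var, NTm.eval_pow, hρ.zero, FTm.eval_sum, FTm.eval_zero]
  refine if_congr Iff.rfl (Finset.sum_congr rfl fun y _ => ?_) rfl
  have hρ' := hρ.update (v := 8) (i := y) (by norm_num)
  have h6 : Function.update ρ 8 y 6 = ρ 6 := by simp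
  have h7 : Function.update ρ 8 y 7 = ρ 7 := by simp
  have h8 : Function.update ρ 8 y 8 = y := by simp
  rw [FTm.eval_ite]
  simp only [NTm.eval_lt, NTm.eval_sumFin, NTm.eval_dig, NTm.eval_mod, NTm.eval_var, NTm.eval_pow,
    hρ'.zero, h6, h8, FTm.eval_zero]
  by_cases hc : (∑ l : Fin k, if dig (ρ 6 % s ^ k) s l < dig y s l then 1 else 0) = 0
  · have hy := dig_lt (x := y) i hs
    rw [if_pos hc, if_pos hc, FTm.eval_mul, FTm.eval_mul, FTm.eval_prodFin, eval_powTm hρ' hμ]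
    · congr 1
      · refine Finset.prod_congr rfl fun l _ => ?_
        have h1 := dig_lt (x := ρ 7 % boxSize M s n ^ k) (b := boxSize M s n) l boxSize_pos
        have h2 := dig_lt (x := ρ 6 / s ^ k) l hn
        have h3 := dig_lt (x := ρ 6 % s ^ k) l hs
        rw [eval_powTm hρ' hμ] <;>
          simp only [NTm.eval_dig, NTm.eval_div, NTm.eval_mod, NTm.eval_sub, NTm.eval_var,
            NTm.eval_pow, hρ'.zero, hρ'.two, hρ'.eval_boxTm, h6, h7, h8]
        · rw [if_pos h2]
        all_goals omega
      · simp only [NTm.eval_dig, NTm.eval_div, NTm.eval_add, NTm.eval_mul, NTm.eval_var,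
          NTm.eval_pow, hρ'.zero, hρ'.two, hρ'.eval_boxTm, h6, h7, h8, FTm.eval_load, hμ.one,
          lt_irrefl, if_false]
    all_goals simp only [NTm.eval_dig, NTm.eval_div, NTm.eval_add, NTm.eval_var, NTm.eval_pow,
      hρ'.zero, hρ'.two, hρ'.eval_boxTm, h7, h8]
    all_goals omega
  · rw [if_neg hc, if_neg hc]

theorem eval_degreeTm (hρ : Params ρ s d n t) :
    (degreeTm k).eval ρ μ = (degreeEntry k d (ρ 6) (ρ 7) : F) := by
  simp [degreeTm, degreeEntry, hρ.one, hρ.eval_degTm]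

theorem eval_solveTm {m : ℕ} {i : Fin k} (hρ : Params ρ s d n t) (hμ : Ready M s d n pts wd μ)
    (hm : m < s) : (solveTm m M i).eval ρ μ =
      solveEntry m (boxSize M s n) d i (μ (10 + i)) (ρ 6) (ρ 7) := by
  simp only [solveTm, solveEntry, FTm.eval_iteLt, NTm.eval_var, NTm.eval_pow, FTm.eval_sum,
    FTm.eval_zero, hρ.eval_degTm, NTm.eval_const]
  refine if_congr Iff.rfl (Finset.sum_congr rfl fun j hj => ?_) rfl
  have hρ' := hρ.update (v := 8) (i := j) (by norm_num)
  have h6 : Function.update ρ 8 j 6 = ρ 6 := by simp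
  have h7 : Function.update ρ 8 j 7 = ρ 7 := by simp
  have h8 : Function.update ρ 8 j 8 = j := by simp
  have hδ : ∀ l : Fin k, (if l = i then NTm.var 8 else .const 0).eval (Function.update ρ 8 j) μ =
      if l = i then j else 0 := by
    intro l
    split_ifs <;> simp
  have hw : dig (ρ 7) (d + 1) i < d + 1 := dig_lt _ (Nat.succ_pos d)
  have hjm := Finset.mem_range.1 hj
  rw [FTm.eval_ite, FTm.eval_mul, eval_powTm hρ' hμ]
  · simp only [NTm.eval_lt, NTm.eval_sumFin, NTm.eval_dig, NTm.eval_add, NTm.eval_sub, NTm.eval_var,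
      NTm.eval_pow, NTm.eval_mul, NTm.eval_iteLt, NTm.eval_const, FTm.eval_load, NTm.eval_radix,
      hρ'.one, hρ'.two, h6, h7, h8, hδ, hρ'.eval_boxTm, hρ'.eval_degTm, FTm.eval_zero, lt_irrefl,
      if_false]
  all_goals simp only [NTm.eval_dig, NTm.eval_var, h7, h8, hρ'.two, hρ'.eval_degTm]
  all_goals omega

theorem eval_pointTm {pt : NTm} {p : ℕ} (hρ : Params ρ s d n t) (hμ : Ready M s d n pts wd μ)
    (hs : 0 < s) (hn : 0 < n) (hp : pt.eval ρ μ = p) :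
    (pointTm k pt).eval ρ μ = pointEntry k s n d pts wd p (ρ 6) (ρ 7) := by
  have e : ∀ l : Fin k, (powTm ((NTm.var 7).dig degTm l) (pt.dig (.var 2) l)
        ((NTm.var 6).dig (.var 0) l)).eval ρ μ =
      powCoeff (pts (dig p n l)) (dig (ρ 7) (d + 1) l) (dig (ρ 6) s l) := by
    intro l
    have h1 := dig_lt (x := ρ 7) (b := d + 1) l d.succ_pos
    have h2 := dig_lt (x := p) l hn
    have h3 := dig_lt (x := ρ 6) l hs
    rw [eval_powTm hρ hμ] <;>
      simp only [NTm.eval_dig, NTm.eval_var, hρ.zero, hρ.two, hρ.eval_degTm, hp]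
    · rw [if_pos h2]
    · omega
    · omega
    · exact h3
  simp only [pointTm, pointEntry, FTm.eval_iteLt, NTm.eval_sumFin, NTm.eval_dig, NTm.eval_var,
    hρ.zero, NTm.eval_pow, hρ.eval_degTm, FTm.eval_prodFin, FTm.eval_sub, FTm.eval_zero,
    FTm.eval_load, NTm.eval_add, NTm.eval_mul, hp, hμ.one, e]

end decoder

-- Solving the linear systems

/-- Run finitely many commands. -/
def Cmd.seqFin {k : ℕ} (f : Fin k → Cmd) : Cmd := (List.ofFn f).foldr Cmd.seq .skip

/-- Write a vector into array `c` that is orthogonal to the rows of finitely many matrices. -/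
noncomputable def kerSystem {α : Type} [Fintype α] (N : NTm) (R : α → NTm) (ent : α → FTm) (c : ℕ) :
    Cmd :=
  .seq (kerInit N) (.seq ((Finset.univ (α := α)).toList.foldr
    (fun a p => .seq (kerRows (R a) N (ent a)) p) .skip) (kerPick N c))

section system

variable {F : Type u} [Field F] {k : ℕ} {ρ : ℕ → ℕ} {μ : Mem F}

theorem run_seqFin (f : Fin k → Cmd) (P : ℕ → Mem F → Prop) (h0 : P 0 μ)
    (h : ∀ (i : Fin k) (μ' : Mem F), P i μ' → P (i + 1) ((f i).run ρ μ')) :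
    P k ((Cmd.seqFin f).run ρ μ) := by
  induction k generalizing μ P with
  | zero => simpa [Cmd.seqFin, Cmd.run] using h0
  | succ k ih =>
    have := ih (μ := (f 0).run ρ μ) (fun i => f i.succ) (fun j => P (j + 1)) (h 0 μ h0)
      fun i μ' h' => h i.succ μ' h'
    rw [Cmd.seqFin, List.ofFn_succ, List.foldr_cons, Cmd.run]
    exact this

theorem kerSystem_writes {α : Type} [Fintype α] (N : NTm) (R : α → NTm) (ent : α → FTm) {b c : ℕ}
    (hb : b ∈ (kerSystem N R ent c).writes) : b = 4 ∨ b = 5 ∨ b = 6 ∨ b = c := by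
  have h : ∀ l : List α, b ∈ (l.foldr (fun a p => Cmd.seq (kerRows (R a) N (ent a)) p) .skip).writes →
      b = 4 ∨ b = 5 ∨ b = 6 := by
    intro l
    induction l with
    | nil => exact fun h => h.elim
    | cons a l ih =>
      rintro (h | h)
      · rw [kerRows_writes] at h
        simp only [Set.mem_union, Set.mem_singleton_iff] at h
        tauto
      · exact ih h
  rcases hb with hb | hb | hb
  · exact Or.inl hb
  · have := h _ hb
    tauto
  · exact Or.inr (Or.inr (Or.inr hb))

/-- Elimination leaves vectors that span the common kernel of all matrices, so the chosen one is a
solution, and a nonzero one if there is any. -/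
theorem kerSystem_spec {α : Type} [Fintype α] {N : NTm} {n : ℕ} (hN : N.IsParam F ρ n)
    {R : α → NTm} {r : α → ℕ} (hR : ∀ a, (R a).IsParam F ρ (r a)) {ent : α → FTm}
    (M : α → ℕ → ℕ → F)
    (hent : ∀ a, ∀ μ' : Mem F, (∀ b, b ≠ 4 → b ≠ 5 → b ≠ 6 → μ' b = μ b) → ∀ i < r a, ∀ j x, x < n →
      (ent a).eval (Function.update (Function.update (Function.update ρ 6 i) 4 j) 7 x) μ' = M a i x)
    {c : ℕ} (hc : c ≠ 4) {v : ℕ → F} (hv : (kerSystem N R ent c).run ρ μ c = v) :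
    (∀ a, ∀ i < r a, ∑ x ∈ Finset.range n, M a i x * v x = 0) ∧
      ((∃ w : ℕ → F, (∃ x < n, w x ≠ 0) ∧
        ∀ a, ∀ i < r a, ∑ x ∈ Finset.range n, M a i x * w x = 0) → ∃ x < n, v x ≠ 0) := by
  have key : ∀ (l : List α) (μ' : Mem F), (∀ b, b ≠ 4 → b ≠ 5 → b ≠ 6 → μ' b = μ b) →
      basisSpan ((l.foldr (fun a p => Cmd.seq (kerRows (R a) N (ent a)) p) .skip).run ρ μ') n =
        basisSpan μ' n ⊓ ⨅ a ∈ l, matKer n (r a) (M a) := by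
    intro l
    induction l with
    | nil => intro μ' _; simp [Cmd.run]
    | cons a l ih =>
      intro μ' h'
      rw [List.foldr_cons, Cmd.run, ih, basisSpan_kerRows hN (hR a) μ' (M a), inf_assoc]
      · congr 1
        simp [iInf_or, iInf_inf_eq]
      · exact fun μ'' h'' => hent a μ'' fun b h4 h5 h6 => (h'' b h4 h5 h6).trans (h' b h4 h5 h6)
      · intro b h4 h5 h6
        rw [Cmd.run_of_notMem_writes, h' b h4 h5 h6]
        simp [kerRows_writes, h4, h5, h6]
  have h1 := key (Finset.univ (α := α)).toList ((kerInit N).run ρ μ) fun b h4 _ _ =>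
    Cmd.run_of_notMem_writes _ (by simp [kerInit_writes, h4])
  rw [basisSpan_kerInit hN, top_inf_eq] at h1
  have h2 := kerPick_spec hc hN (((Finset.univ (α := α)).toList.foldr
    (fun a p => Cmd.seq (kerRows (R a) N (ent a)) p) .skip).run ρ ((kerInit N).run ρ μ))
  simp only [h1] at h2
  have h3 : ∀ w : ℕ → F, (fun x : Fin n => w x) ∈ (⨅ a ∈ (Finset.univ (α := α)).toList,
      matKer n (r a) (M a)) ↔ ∀ a, ∀ i < r a, ∑ x ∈ Finset.range n, M a i x * w x = 0 := by
    intro w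
    simp [Submodule.mem_iInf, mem_matKer, Finset.sum_range]
  have hv' : (kerPick N c).run ρ (((Finset.univ (α := α)).toList.foldr
    (fun a p => Cmd.seq (kerRows (R a) N (ent a)) p) .skip).run ρ ((kerInit N).run ρ μ)) c = v := hv
  rw [hv', h3] at h2
  refine ⟨h2.1, ?_⟩
  rintro ⟨w, ⟨x, hx, hwx⟩, hw⟩
  have h4 := h2.2 fun hbot => ?_
  · obtain ⟨y, hy⟩ := Function.ne_iff.1 h4
    exact ⟨y, y.2, hy⟩
  · have := (h3 w).2 hw
    rw [hbot, Submodule.mem_bot] at this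
    exact hwx (congrFun this ⟨x, hx⟩)

end system

/-- Write the solution of the interpolation step for direction `i` into array `10 + i`. -/
noncomputable def interpCmd (m M : ℕ) {k : ℕ} (i : Fin k) : Cmd :=
  kerSystem (α := Unit) (.mul (.const (m + 1)) ((boxTm M).pow k))
    (fun _ => .mul ((NTm.var 2).pow k) ((NTm.var 0).pow k)) (fun _ => interpTm m M i) (10 + i)

/-- The index set of the conditions on the polynomials: degree, differential equations, values. -/
abbrev CondIdx (k r : ℕ) : Type := Unit ⊕ (Fin k ⊕ Fin r)

/-- Write a solution of the linear system for the points given by the digits of variable `9` into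
array `7`. -/
noncomputable def solveCmd (m M k r : ℕ) : Cmd :=
  kerSystem (α := CondIdx k r) (.add (degTm.pow k) (.const 1))
    (Sum.elim (fun _ => degTm.pow k) (Sum.elim (fun _ => (NTm.add (boxTm M) (.var 1)).pow k)
      fun _ => (NTm.var 0).pow k))
    (Sum.elim (fun _ => degreeTm k) (Sum.elim (fun i => solveTm m M i)
      fun l => pointTm k ((NTm.var 9).dig ((NTm.var 2).pow k) l))) 7

section decoder

variable {F : Type u} [Field F] {k : ℕ} {ρ : ℕ → ℕ} {μ : Mem F} {s d n t M : ℕ} {pts wd : ℕ → F}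

theorem exists_kernel_vector {n R : ℕ} (h : R < n) (M : ℕ → ℕ → F) : ∃ w : ℕ → F,
    (∃ x < n, w x ≠ 0) ∧ ∀ i < R, ∑ x ∈ Finset.range n, M i x * w x = 0 := by
  obtain ⟨w, hw, hne⟩ := Submodule.exists_mem_ne_zero_of_ne_bot (matKer_ne_bot h M)
  rw [mem_matKer] at hw
  obtain ⟨y, hy⟩ := Function.ne_iff.1 hne
  refine ⟨fun x => if hx : x < n then w ⟨x, hx⟩ else 0, ⟨y, y.2, by simpa using hy⟩, fun i hi => ?_⟩
  rw [← hw i hi, Finset.sum_range]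
  simp

/-- By `hlt` there are more unknowns than equations, so the vector found is nonzero. -/
theorem interpCmd_spec {m : ℕ} {i : Fin k} (hρ : Params ρ s d n t) (hμ : Ready M s d n pts wd μ)
    (hm : m < s) (hn : 0 < n) (hlt : n ^ k * s ^ k < (m + 1) * boxSize M s n ^ k) {q : ℕ → F}
    (hq : (interpCmd m M i).run ρ μ (10 + i) = q) :
    (∀ row < n ^ k * s ^ k, ∑ x ∈ Finset.range ((m + 1) * boxSize M s n ^ k),
      interpEntry m s n (boxSize M s n) i pts wd row x * q x = 0) ∧
      ∃ j ≤ m, interpPoly k (boxSize M s n) q j ≠ 0 := by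
  obtain ⟨h1, h2⟩ := kerSystem_spec (α := Unit) (ρ := ρ) (μ := μ)
    (n := (m + 1) * boxSize M s n ^ k) (r := fun _ => n ^ k * s ^ k)
    (hρ.isParam fun ρ' h' μ' => by simp [h'.eval_boxTm])
    (fun _ => hρ.isParam fun ρ' h' μ' => by simp [h'.two, h'.zero])
    (fun _ => interpEntry m s n (boxSize M s n) i pts wd) (fun _ μ' h' row _ j x hx => by
      have hρ' := ((hρ.update (v := 6) (i := row) (by norm_num)).update (v := 4) (i := j)
        (by norm_num)).update (v := 7) (i := x) (by norm_num)
      rw [eval_interpTm hρ' (hμ.congr (h' 0 (by norm_num) (by norm_num) (by norm_num))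
        (h' 1 (by norm_num) (by norm_num) (by norm_num))
        (h' 3 (by norm_num) (by norm_num) (by norm_num))) hm hn (by simpa using hx)]
      simp) (by omega) hq
  refine ⟨h1 (), ?_⟩
  obtain ⟨w, hw, hw'⟩ := exists_kernel_vector hlt (interpEntry m s n (boxSize M s n) i pts wd)
  obtain ⟨x, hx, hqx⟩ := h2 ⟨w, hw, fun _ => hw'⟩
  have hb : 0 < boxSize M s n ^ k := pow_pos boxSize_pos k
  -- A nonzero entry `q x` is coefficient number `x % b ^ k` of the polynomial number `x / b ^ k`,
  -- where `b` is the box size.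
  refine ⟨x / boxSize M s n ^ k, Nat.lt_succ_iff.1 (Nat.div_lt_of_lt_mul (by
    rwa [mul_comm] at hx)), fun h0 => hqx ?_⟩
  have hmod := Nat.mod_lt x hb
  have := congrArg (MvPolynomial.coeff (digExp k (x % boxSize M s n ^ k) (boxSize M s n))) h0
  rwa [interpPoly, coeff_polyOf_digExp boxSize_pos hmod, MvPolynomial.coeff_zero, mul_comm,
    Nat.div_add_mod] at this

/-- A polynomial of degree at most `d` that solves the differential equations and agrees with the
received word at points that determine it is found by solving a linear system. -/
theorem candidate_eq {m r : ℕ} {Q : Fin k → ℕ → MvPolynomial (Fin k) F} {p : Fin r → Fin k → Fin n}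
    (hdet : ∀ g ∈ solutions m d Q, (∀ l, ∀ e : Fin k →₀ ℕ, ∑ i, e i < s →
      (shift (fun i => pts (p l i)) g).coeff e = 0) → g = 0) {f : MvPolynomial (Fin k) F}
    (hf : f ∈ solutions m d Q) (hfp : ∀ l, AgreesAt s n pts wd f (p l)) {v : ℕ → F}
    (hv : polyOf k (d + 1) v ∈ solutions m d Q) (hvp : ∀ l, ∀ e : Fin k →₀ ℕ, ∑ i, e i < s →
      (shift (fun i => pts (p l i)) (polyOf k (d + 1) v)).coeff e =
        wd (radix n (fun i => (p l i : ℕ)) * s ^ k + radix s e) * v ((d + 1) ^ k))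
    (hne : ∃ x < (d + 1) ^ k + 1, v x ≠ 0) :
    polyOf k (d + 1) (fun x => v x * (v ((d + 1) ^ k))⁻¹) = f := by
  -- The difference of both sides is a solution of the differential equations and vanishes to order
  -- `s` at points that determine solutions.
  have h1 : polyOf k (d + 1) v = v ((d + 1) ^ k) • f := by
    refine sub_eq_zero.1 (hdet _ (Submodule.sub_mem _ hv (Submodule.smul_mem _ _ hf)) fun l e he => ?_)
    rw [map_sub, map_smul, MvPolynomial.coeff_sub, MvPolynomial.coeff_smul, hvp l e he, ← hfp l e he,
      smul_eq_mul, mul_comm, sub_self]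
  -- Otherwise the polynomial part is zero as well, against the choice of a nonzero vector.
  have h2 : v ((d + 1) ^ k) ≠ 0 := by
    intro h0
    rw [h0, zero_smul] at h1
    obtain ⟨x, hx, hvx⟩ := hne
    rcases Nat.lt_succ_iff_lt_or_eq.1 hx with h | rfl
    · have := congrArg (MvPolynomial.coeff (digExp k x (d + 1))) h1
      rw [coeff_polyOf_digExp d.succ_pos h, MvPolynomial.coeff_zero] at this
      exact hvx this
    · exact hvx h0
  rw [show (fun x => v x * (v ((d + 1) ^ k))⁻¹) = fun x => (v ((d + 1) ^ k))⁻¹ * v x from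
    funext fun x => mul_comm _ _, polyOf_smul, h1, smul_smul, inv_mul_cancel₀ h2, one_smul]

/-- The system is made homogeneous by an unknown multiple of the word. The coefficients of `f`
together with the factor `1` are a nonzero solution, so the vector found is nonzero and
`candidate_eq` applies. Membership in the space of solutions holds for every tuple, determining or
not. -/
theorem solveCmd_spec {m r : ℕ} (hρ : Params ρ s d n t) (hμ : Ready M s d n pts wd μ)
    (hm : m < s) (hn : 0 < n) {p : Fin r → Fin k → Fin n}
    (hp : ∀ l : Fin r, dig (ρ 9) (n ^ k) l = radix n fun i => (p l i : ℕ)) {v : ℕ → F}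
    (hv : (solveCmd m M k r).run ρ μ 7 = v) :
    let Q : Fin k → ℕ → MvPolynomial (Fin k) F := fun i => interpPoly k (boxSize M s n) (μ (10 + i))
    polyOf k (d + 1) v ∈ solutions m d Q ∧
    ∀ f ∈ solutions m d Q, (∀ l, AgreesAt s n pts wd f (p l)) →
      (∀ g ∈ solutions m d Q, (∀ l, ∀ e : Fin k →₀ ℕ, ∑ i, e i < s →
        (shift (fun i => pts (p l i)) g).coeff e = 0) → g = 0) →
      polyOf k (d + 1) (fun x => v x * (v ((d + 1) ^ k))⁻¹) = f := by
  intro Q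
  obtain ⟨h1, h2⟩ := kerSystem_spec (α := CondIdx k r) (ρ := ρ) (μ := μ)
    (n := (d + 1) ^ k + 1) (r := Sum.elim (fun _ => (d + 1) ^ k) (Sum.elim
      (fun _ => (boxSize M s n + d) ^ k) fun _ => s ^ k))
    (R := Sum.elim (fun _ => degTm.pow k) (Sum.elim (fun _ => (NTm.add (boxTm M) (.var 1)).pow k)
      fun _ => (NTm.var 0).pow k))
    (hρ.isParam fun ρ' h' μ' => by simp [h'.eval_degTm])
    (by
      rintro (_ | _ | _)
      · exact hρ.isParam fun ρ' h' μ' => by simp [h'.eval_degTm]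
      · exact hρ.isParam fun ρ' h' μ' => by simp [h'.eval_boxTm, h'.one]
      · exact hρ.isParam fun ρ' h' μ' => by simp [h'.zero])
    (Sum.elim (fun _ => degreeEntry k d) (Sum.elim
      (fun i => solveEntry m (boxSize M s n) d i (μ (10 + i)))
      fun l => pointEntry k s n d pts wd (radix n fun i => (p l i : ℕ))))
    (ent := Sum.elim (fun _ => degreeTm k) (Sum.elim (fun i => solveTm m M i)
      fun l => pointTm k ((NTm.var 9).dig ((NTm.var 2).pow k) l)))
    (by
      intro a μ' h' row _ j x hx
      have hρ' := ((hρ.update (v := 6) (i := row) (by norm_num)).update (v := 4) (i := j)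
        (by norm_num)).update (v := 7) (i := x) (by norm_num)
      have hμ' := hμ.congr (h' 0 (by norm_num) (by norm_num) (by norm_num))
        (h' 1 (by norm_num) (by norm_num) (by norm_num))
        (h' 3 (by norm_num) (by norm_num) (by norm_num))
      rcases a with _ | i | l
      · simp only [Sum.elim_inl]
        rw [eval_degreeTm hρ']
        simp
      · simp only [Sum.elim_inl, Sum.elim_inr]
        rw [eval_solveTm hρ' hμ' hm, h' (10 + i) (by omega) (by omega) (by omega)]
        simp
      · simp only [Sum.elim_inr]
        rw [eval_pointTm hρ' hμ' (by omega) hn (p := radix n fun i => (p l i : ℕ))]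
        · simp
        · simp [hρ.two, ← hp l]) (by norm_num) hv
  have hsys : ∀ w : ℕ → F, (∀ a : CondIdx k r, ∀ row < (Sum.elim (fun _ => (d + 1) ^ k) (Sum.elim
      (fun _ => (boxSize M s n + d) ^ k) fun _ => s ^ k) a : ℕ), ∑ x ∈ Finset.range ((d + 1) ^ k + 1),
      (Sum.elim (fun _ => degreeEntry k d) (Sum.elim
      (fun i => solveEntry m (boxSize M s n) d i (μ (10 + i)))
      fun l => pointEntry k s n d pts wd (radix n fun i => (p l i : ℕ))) a : ℕ → ℕ → F) row x * w x = 0) ↔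
      polyOf k (d + 1) w ∈ solutions m d Q ∧ ∀ l, ∀ e : Fin k →₀ ℕ, ∑ i, e i < s →
      (shift (fun i => pts (p l i)) (polyOf k (d + 1) w)).coeff e =
        wd (radix n (fun i => (p l i : ℕ)) * s ^ k + radix s e) * w ((d + 1) ^ k) := by
    intro w
    rw [mem_solutions]
    simp only [Sum.forall, Sum.elim_inl, Sum.elim_inr, forall_const,
      totalDegree_le_iff_degreeEntry (Nat.le_succ ((d + 1) ^ k)),
      diffOp_eq_zero_iff_solveEntry (Nat.le_succ ((d + 1) ^ k)), pointEntry_iff, and_assoc, Q]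
  rw [hsys] at h1
  refine ⟨h1.1, fun f hf hfp hdet => candidate_eq hdet hf hfp h1.1 h1.2 (h2 ?_)⟩
  have hpoly : polyOf k (d + 1) (fun x => if x < (d + 1) ^ k then f.coeff (digExp k x (d + 1)) else 1) =
      f := by
    rw [polyOf_congr fun x hx => if_pos hx, polyOf_coeff (mem_solutions.1 hf).1]
  refine ⟨fun x => if x < (d + 1) ^ k then f.coeff (digExp k x (d + 1)) else 1,
    ⟨(d + 1) ^ k, Nat.lt_succ_self _, by simp⟩, (hsys _).2 ?_⟩
  rw [hpoly]
  refine ⟨hf, fun l e he => ?_⟩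
  rw [if_neg (lt_irrefl _), mul_one, hfp l e he]

end decoder

-- Testing candidates and enumerating tuples of points

/-- The number of points at which the polynomial with coefficients in array `8` agrees with the
received word. -/
def countTm (k : ℕ) : NTm :=
  let s := NTm.var 0
  let a := NTm.var 6
  let e := NTm.var 8
  .sum 6 ((NTm.var 2).pow k) (.ite (.sum 8 (s.pow k)
    (.iteLt (.sumFin fun l : Fin k => e.dig s l) s
      (.ne (.sum 7 (degTm.pow k) (.mul (.load 8 (.var 7)) (.prodFin fun l : Fin k =>
          powTm ((NTm.var 7).dig degTm l) (a.dig (.var 2) l) (e.dig s l))))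
        (.load 1 (.add (.mul a (s.pow k)) e)))
      (.const 0))) (.const 0) (.const 1))

/-- The number of nonzero cells of array `9` below a bound. -/
def numTm (N : NTm) : NTm := .sum 11 N (.ne (.load 9 (.var 11)) .zero)

/-- Compute the polynomial for the points given by the digits of variable `9`, and append it to the
output if it agrees with the received word at `t` points. -/
noncomputable def bodyCmd (m M k r : ℕ) : Cmd :=
  .seq (solveCmd m M k r)
  (.seq (.loop 10 (degTm.pow k) (.set 8 (.var 10)
    (.mul (.load 7 (.var 10)) (.inv (.load 7 (degTm.pow k))))))
  (.seq (.set 9 (.var 9) (.iteLt (countTm k) (.var 3) .zero .one))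
  (.loop 10 (.mul (degTm.pow k) (.ne (.load 9 (.var 9)) .zero))
    (.set 2 (.add (.mul (numTm (.var 9)) (degTm.pow k)) (.var 10)) (.load 8 (.var 10))))))

/-- The number of tuples of `r` points. -/
def tuplesTm (k r : ℕ) : NTm := ((NTm.var 2).pow k).pow r

/-- The decoder. -/
noncomputable def decoderCmd (m M k r : ℕ) : Cmd :=
  .seq (tableCmd M) (.seq (.seqFin fun i : Fin k => interpCmd m M i)
    (.loop 9 (tuplesTm k r) (bodyCmd m M k r)))

section decoder

variable {F : Type u} [Field F] {k : ℕ} {ρ : ℕ → ℕ} {μ : Mem F} {s d n t M : ℕ} {pts wd : ℕ → F}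

open Classical in
/-- The number of grid points at which the encoding of `f` agrees with the received word. -/
noncomputable def agreeCount (s n : ℕ) (pts wd : ℕ → F) (f : MvPolynomial (Fin k) F) : ℕ :=
  Finset.card {p : Fin k → Fin n | AgreesAt s n pts wd f p}

open Classical in
/-- The number of nonzero values of `a` below `N`. -/
noncomputable def numNonzero (a : ℕ → F) (N : ℕ) : ℕ := Finset.card {j ∈ Finset.range N | a j ≠ 0}

theorem numNonzero_succ (a : ℕ → F) (N : ℕ) [Decidable (a N = 0)] :
    numNonzero a (N + 1) = numNonzero a N + if a N = 0 then 0 else 1 := by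
  classical
  rw [numNonzero, numNonzero, Finset.range_add_one, Finset.filter_insert]
  by_cases h : a N = 0
  · simp [h]
  · rw [if_pos h, Finset.card_insert_of_notMem (by simp), if_neg h]

theorem numNonzero_congr {a a' : ℕ → F} {N : ℕ} (h : ∀ j < N, a j = a' j) :
    numNonzero a N = numNonzero a' N := by
  classical
  rw [numNonzero, numNonzero]
  congr 1
  exact Finset.filter_congr fun j hj => by rw [h j (Finset.mem_range.1 hj)]

theorem eval_numTm {N : NTm} : (numTm N).eval ρ μ = numNonzero (μ 9) (N.eval ρ μ) := by
  classical
  rw [numTm, numNonzero, NTm.eval_sum, Finset.card_filter]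
  refine Finset.sum_congr rfl fun j _ => ?_
  rw [NTm.eval_ne]
  simp

theorem eval_countTm (hρ : Params ρ s d n t) (hμ : Ready M s d n pts wd μ) (hs : 0 < s) :
    (countTm k).eval ρ μ = agreeCount s n pts wd (polyOf k (d + 1) (μ 8)) := by
  classical
  rw [countTm, agreeCount, Finset.card_filter]
  simp only [NTm.eval_sum, NTm.eval_pow, NTm.eval_var, hρ.two]
  rw [sum_range_pow]
  refine Finset.sum_congr rfl fun p _ => ?_
  have hρ₁ := hρ.update (v := 6) (i := radix n fun i => (p i : ℕ)) (by norm_num)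
  rw [NTm.eval_ite, NTm.eval_sum]
  simp only [NTm.eval_pow, NTm.eval_var, NTm.eval_const, hρ₁.zero]
  refine if_congr ?_ rfl rfl
  have hX : ∀ y, (NTm.iteLt (.sumFin fun l : Fin k => (NTm.var 8).dig (.var 0) l) (.var 0)
      (.ne (.sum 7 (degTm.pow k) (.mul (.load 8 (.var 7)) (.prodFin fun l : Fin k =>
          powTm ((NTm.var 7).dig degTm l) ((NTm.var 6).dig (.var 2) l) ((NTm.var 8).dig (.var 0) l))))
        (.load 1 (.add (.mul (.var 6) ((NTm.var 0).pow k)) (.var 8)))) (.const 0)).eval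
      (Function.update (Function.update ρ 6 (radix n fun i => (p i : ℕ))) 8 y) μ =
      if ∑ l, digExp k y s l < s then
        if (shift (fun i => pts (p i)) (polyOf k (d + 1) (μ 8))).coeff (digExp k y s) =
          wd (radix n (fun i => (p i : ℕ)) * s ^ k + y) then 0 else 1
      else 0 := by
    intro y
    have hρ₂ := hρ₁.update (v := 8) (i := y) (by norm_num)
    have e5 : ∑ l, digExp k y s l = ∑ l : Fin k, dig y s l := rfl
    simp only [NTm.eval_iteLt, NTm.eval_sumFin, NTm.eval_dig, NTm.eval_var, hρ₂.zero, e5,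
      NTm.eval_const, Function.update_self]
    refine if_congr Iff.rfl ?_ rfl
    rw [NTm.eval_ne]
    refine if_congr (Eq.congr ?_ ?_) rfl rfl
    · rw [coeff_shift_polyOf, FTm.eval_sum, NTm.eval_pow, hρ₂.eval_degTm]
      refine Finset.sum_congr rfl fun x _ => ?_
      have hρ₃ := hρ₂.update (v := 7) (i := x) (by norm_num)
      rw [FTm.eval_mul, FTm.eval_prodFin]
      congr 1
      refine Finset.prod_congr rfl fun l _ => ?_
      · have h1 := dig_lt (x := x) (b := d + 1) l d.succ_pos
        have h2 : dig (radix n fun i => (p i : ℕ)) n l = p l := dig_radix (fun i => (p i).2) l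
        have h3 := dig_lt (x := y) l hs
        have h6 : Function.update (Function.update (Function.update ρ 6
          (radix n fun i => (p i : ℕ))) 8 y) 7 x 6 = radix n fun i => (p i : ℕ) := by simp
        have h8 : Function.update (Function.update (Function.update ρ 6
          (radix n fun i => (p i : ℕ))) 8 y) 7 x 8 = y := by simp
        have h9 := (p l).2
        rw [eval_powTm hρ₃ hμ] <;>
          simp only [NTm.eval_dig, NTm.eval_var, hρ₃.zero, hρ₃.two, hρ₃.eval_degTm, h6, h8, h2,
            Function.update_self]
        · rw [if_pos h9, digExp_apply]
        all_goals omega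
    · simp [hμ.one, hρ.zero]
  rw [Finset.sum_congr rfl fun y _ => hX y, Finset.sum_eq_zero_iff]
  constructor
  · intro h e he
    have hes := lt_of_sum_lt he
    have := h (radix s e) (Finset.mem_range.2 (radix_lt hes))
    rw [digExp_radix hes, if_pos he] at this
    by_contra hne
    rw [if_neg fun h => hne h.symm] at this
    exact one_ne_zero this
  · intro h y hy
    have hr : radix s (digExp k y s) = y := radix_dig (Finset.mem_range.1 hy)
    split_ifs with h1 h2
    · rfl
    · have := h _ h1
      rw [hr] at this
      exact absurd this.symm h2
    · rfl

/-- Commands have no natural number counters, so the position of the next output is recomputed as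
the number of flags set so far. The flag is also a factor of the length of the copying loop, and a
rejected candidate is not copied. The candidate always lies in the space of solutions, which gives
soundness; the clause on determining tuples gives completeness. -/
theorem body_spec {m r : ℕ} (hρ : Params ρ s d n t) (hμ : Ready M s d n pts wd μ)
    (hm : m < s) (hn : 0 < n) {μ' : Mem F} (hμ' : (bodyCmd m M k r).run ρ μ = μ')
    {Q : Fin k → ℕ → MvPolynomial (Fin k) F}
    (hQ : ∀ i : Fin k, interpPoly k (boxSize M s n) (μ (10 + i)) = Q i) :
    (∀ b, b = 0 ∨ b = 1 ∨ b = 3 ∨ 10 ≤ b → μ' b = μ b) ∧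
    (∀ j, j ≠ ρ 9 → μ' 9 j = μ 9 j) ∧ ∃ g ∈ solutions m d Q,
      (∀ p : Fin r → Fin k → Fin n,
        (∀ l : Fin r, dig (ρ 9) (n ^ k) l = radix n fun i => (p l i : ℕ)) →
        ∀ f ∈ solutions m d Q, (∀ l, AgreesAt s n pts wd f (p l)) →
        (∀ g ∈ solutions m d Q, (∀ l, ∀ e : Fin k →₀ ℕ, ∑ i, e i < s →
          (shift (fun i => pts (p l i)) g).coeff e = 0) → g = 0) → g = f) ∧
      (μ' 9 (ρ 9) = if t ≤ agreeCount s n pts wd g then 1 else 0) ∧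
      (t ≤ agreeCount s n pts wd g →
        polyOf k (d + 1) (fun x => μ' 2 (numNonzero (μ 9) (ρ 9) * (d + 1) ^ k + x)) = g) ∧
      ∀ j < numNonzero (μ 9) (ρ 9), ∀ x < (d + 1) ^ k,
        μ' 2 (j * (d + 1) ^ k + x) = μ 2 (j * (d + 1) ^ k + x) := by
  classical
  obtain rfl : (fun i => interpPoly k (boxSize M s n) (μ (10 + (i : Fin k)))) = Q := funext hQ
  set μ₁ := (solveCmd m M k r).run ρ μ with hμ₁
  have f₁ : ∀ b, b ≠ 4 → b ≠ 5 → b ≠ 6 → b ≠ 7 → μ₁ b = μ b := fun b h4 h5 h6 h7 =>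
    Cmd.run_of_notMem_writes _ fun h => by
      have := kerSystem_writes _ _ _ h
      tauto
  obtain ⟨f₂, g₂⟩ := run_fill_id (ρ := ρ) (μ := μ₁) (v := 10) (N := degTm.pow k) (a := 8)
    (n := (d + 1) ^ k) (val := .mul (.load 7 (.var 10)) (.inv (.load 7 (degTm.pow k))))
    (by simp [hρ.eval_degTm]) (fun x => μ₁ 7 x * (μ₁ 7 ((d + 1) ^ k))⁻¹) fun x _ μ' h' _ => by
      have hρ' := hρ.update (v := 10) (i := x) (by norm_num)
      simp [hρ'.eval_degTm, h' 7 (by norm_num)]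
  set μ₂ := (Cmd.loop 10 (degTm.pow k) (.set 8 (.var 10)
    (.mul (.load 7 (.var 10)) (.inv (.load 7 (degTm.pow k)))))).run ρ μ₁ with hμ₂
  have hμ₂' : Ready M s d n pts wd μ₂ :=
    hμ.congr ((f₂ 0 (by norm_num)).trans (f₁ 0 (by norm_num) (by norm_num) (by norm_num) (by norm_num)))
      ((f₂ 1 (by norm_num)).trans (f₁ 1 (by norm_num) (by norm_num) (by norm_num) (by norm_num)))
      ((f₂ 3 (by norm_num)).trans (f₁ 3 (by norm_num) (by norm_num) (by norm_num) (by norm_num)))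
  set g := polyOf k (d + 1) (μ₂ 8) with hg
  have hgv : g = polyOf k (d + 1) fun x => μ₁ 7 x * (μ₁ 7 ((d + 1) ^ k))⁻¹ :=
    polyOf_congr g₂
  set flag : F := if t ≤ agreeCount s n pts wd g then 1 else 0 with hflag
  set μ₃ := (Cmd.set 9 (.var 9) (.iteLt (countTm k) (.var 3) .zero .one)).run ρ μ₂ with hμ₃
  have h₃ : μ₃ = Mem.set μ₂ 9 (ρ 9) flag := by
    rw [hμ₃, Cmd.run, NTm.eval_var, FTm.eval_iteLt, eval_countTm hρ hμ₂' (by omega),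
      NTm.eval_var, hρ.three, FTm.eval_zero, FTm.eval_one, hflag, ← hg]
    congr 1
    split_ifs with h1 h2 h2
    · omega
    · rfl
    · rfl
    · omega
  have h₃9 : ∀ j, j ≠ ρ 9 → μ₃ 9 j = μ 9 j := fun j hj => by
    rw [h₃, Mem.set, Function.update_self, Function.update_of_ne hj, f₂ 9 (by norm_num),
      f₁ 9 (by norm_num) (by norm_num) (by norm_num) (by norm_num)]
  have h₃9' : μ₃ 9 (ρ 9) = flag := by rw [h₃, Mem.set, Function.update_self, Function.update_self]
  have f₃ : ∀ b, b ≠ 9 → μ₃ b = μ₂ b := fun b hb => by rw [h₃, Mem.set, Function.update_of_ne hb]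
  have hnum : numNonzero (μ₃ 9) (ρ 9) = numNonzero (μ 9) (ρ 9) :=
    numNonzero_congr fun j hj => h₃9 j hj.ne
  obtain ⟨f₄, g₄, k₄⟩ := run_fill (ρ := ρ) (μ := μ₃) (v := 10)
    (N := .mul (degTm.pow k) (.ne (.load 9 (.var 9)) .zero)) (a := 2)
    (n := (d + 1) ^ k * if flag = 0 then 0 else 1)
    (idx := .add (.mul (numTm (.var 9)) (degTm.pow k)) (.var 10)) (val := .load 8 (.var 10))
    (by simp [hρ.eval_degTm, h₃9']) (fun x => numNonzero (μ 9) (ρ 9) * (d + 1) ^ k + x) (μ₂ 8)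
    (fun x _ μ' h' => by
      have hρ' := hρ.update (v := 10) (i := x) (by norm_num)
      simp [hρ'.eval_degTm, eval_numTm, h' 9 (by norm_num), hnum])
    (fun i _ j hj => by omega)
    (fun x _ μ' h' _ _ => by simp [h' 8 (by norm_num), f₃ 8 (by norm_num)])
  have hrun : (bodyCmd m M k r).run ρ μ = (Cmd.loop 10 (.mul (degTm.pow k) (.ne (.load 9 (.var 9)) .zero))
    (.set 2 (.add (.mul (numTm (.var 9)) (degTm.pow k)) (.var 10)) (.load 8 (.var 10)))).run ρ μ₃ := rfl
  rw [← hrun, hμ'] at f₄ g₄ k₄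
  have hsolve := fun (p : Fin r → Fin k → Fin n) hp => solveCmd_spec (r := r) hρ hμ hm hn (p := p) hp rfl
  refine ⟨?_, ?_, g, ?_, ?_, ?_, ?_, ?_⟩
  · intro b hb
    rw [f₄ b (by omega), f₃ b (by omega), f₂ b (by omega),
      f₁ b (by omega) (by omega) (by omega) (by omega)]
  · intro j hj
    rw [f₄ 9 (by norm_num), h₃9 j hj]
  -- Every number codes some tuple of points, by its digits in base `n ^ k` and their digits in base
  -- `n`.
  · have hp : ∀ l : Fin r, dig (ρ 9) (n ^ k) l = radix n fun i : Fin k =>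
        ((⟨dig (dig (ρ 9) (n ^ k) l) n i, dig_lt _ hn⟩ : Fin n) : ℕ) := fun l =>
      (radix_dig (dig_lt _ (pow_pos hn k))).symm
    have := (hsolve _ hp).1
    rw [hgv, show (fun x => μ₁ 7 x * (μ₁ 7 ((d + 1) ^ k))⁻¹) =
      fun x => (μ₁ 7 ((d + 1) ^ k))⁻¹ * μ₁ 7 x from funext fun x => mul_comm _ _, polyOf_smul]
    exact Submodule.smul_mem _ _ this
  · intro p hp f hf hfp hdet
    rw [hgv]
    exact (hsolve p hp).2 f hf hfp hdet
  · rw [f₄ 9 (by norm_num), h₃9', hflag]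
  · intro ht
    refine polyOf_congr fun x hx => g₄ x ?_
    rw [hflag, if_pos ht, if_neg one_ne_zero, mul_one]
    exact hx
  · intro j hj x hx
    rw [k₄, f₃ 2 (by norm_num), f₂ 2 (by norm_num),
      f₁ 2 (by norm_num) (by norm_num) (by norm_num) (by norm_num)]
    intro y _ h
    have h1 : (j + 1) * (d + 1) ^ k ≤ numNonzero (μ 9) (ρ 9) * (d + 1) ^ k :=
      Nat.mul_le_mul_right _ hj
    rw [add_mul, one_mul] at h1
    omega

/-- The polynomials that are output agree with the received word at `t` points, and all polynomials
with this property that are determined by their values at `r` points of agreement are output. -/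
theorem decoderCmd_spec {m r : ℕ} (hρ : Params ρ s d n t) (h0 : μ 0 = pts) (h1 : μ 1 = wd)
    (hm : m < s) (hn : 0 < n) (hlt : n ^ k * s ^ k < (m + 1) * boxSize M s n ^ k)
    {μ' : Mem F} (hμ' : (decoderCmd m M k r).run ρ μ = μ') :
    ∃ q : Fin k → ℕ → F, (∀ i, ∀ row < n ^ k * s ^ k,
      ∑ x ∈ Finset.range ((m + 1) * boxSize M s n ^ k),
        interpEntry m s n (boxSize M s n) i pts wd row x * q i x = 0) ∧
    (∀ i, ∃ j ≤ m, interpPoly k (boxSize M s n) (q i) j ≠ 0) ∧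
    let V := solutions m d fun i => interpPoly k (boxSize M s n) (q i)
    let N := (numTm (tuplesTm k r)).eval ρ μ'
    let out := fun j => polyOf k (d + 1) fun x => μ' 2 (j * (d + 1) ^ k + x)
    (∀ j < N, out j ∈ V ∧ t ≤ agreeCount s n pts wd (out j)) ∧
    ∀ p : Fin r → Fin k → Fin n, ∀ f ∈ V, (∀ l, AgreesAt s n pts wd f (p l)) →
      (∀ g ∈ V, (∀ l, ∀ e : Fin k →₀ ℕ, ∑ i, e i < s →
        (shift (fun i => pts (p l i)) g).coeff e = 0) → g = 0) →
      t ≤ agreeCount s n pts wd f → ∃ j < N, out j = f := by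
  classical
  set μ₁ := (tableCmd M).run ρ μ with hμ₁
  have r₁ : Ready M s d n pts wd μ₁ := ready_tableCmd hρ (by omega) h0 h1
  set μ₂ := (Cmd.seqFin fun i : Fin k => interpCmd m M i).run ρ μ₁ with hμ₂
  have hw : ∀ (i : Fin k) b, b ≠ 4 → b ≠ 5 → b ≠ 6 → b ≠ 10 + (i : ℕ) →
      b ∉ (interpCmd m M i).writes := fun i b h4 h5 h6 hb h => by
    have := kerSystem_writes _ _ _ h
    tauto
  have h₂ := run_seqFin (ρ := ρ) (μ := μ₁) (fun i : Fin k => interpCmd m M i)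
    (fun i ν => Ready M s d n pts wd ν ∧ ∀ j : Fin k, (j : ℕ) < i →
      (∀ row < n ^ k * s ^ k, ∑ x ∈ Finset.range ((m + 1) * boxSize M s n ^ k),
        interpEntry m s n (boxSize M s n) j pts wd row x * ν (10 + j) x = 0) ∧
      ∃ l ≤ m, interpPoly k (boxSize M s n) (ν (10 + j)) l ≠ 0)
    ⟨r₁, fun j hj => absurd hj (Nat.not_lt_zero _)⟩ (by
      rintro i ν ⟨rν, hν⟩
      refine ⟨rν.congr ?_ ?_ ?_, fun j hj => ?_⟩
      · exact Cmd.run_of_notMem_writes _ (hw i 0 (by norm_num) (by norm_num) (by norm_num) (by omega))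
      · exact Cmd.run_of_notMem_writes _ (hw i 1 (by norm_num) (by norm_num) (by norm_num) (by omega))
      · exact Cmd.run_of_notMem_writes _ (hw i 3 (by norm_num) (by norm_num) (by norm_num) (by omega))
      · rcases Nat.lt_succ_iff_lt_or_eq.1 hj with h | h
        · rw [Cmd.run_of_notMem_writes _ (hw i (10 + j) (by omega) (by omega) (by omega) (by omega))]
          exact hν j h
        · obtain rfl : j = i := Fin.ext h
          exact interpCmd_spec hρ rν hm hn hlt rfl)
  rw [← hμ₂] at h₂
  obtain ⟨r₂, h₂⟩ := h₂
  refine ⟨fun i => μ₂ (10 + i), fun i => (h₂ i i.2).1, fun i => (h₂ i i.2).2, ?_⟩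
  intro V N out
  have hrun : (Cmd.loop 9 (tuplesTm k r) (bodyCmd m M k r)).run ρ μ₂ = μ' := hμ'
  -- After `τ` tuples, all stored polynomials are correct, and every wanted `f` with a determining
  -- tuple of agreement among these has been stored. Only flags below `τ` are counted, so the
  -- initial contents of array `9` do not matter.
  have key := run_loop (ρ := ρ) (μ := μ₂) 9 (tuplesTm k r) (bodyCmd m M k r) (n := (n ^ k) ^ r)
    (by simp [tuplesTm, hρ.two]) (fun τ ν => Ready M s d n pts wd ν ∧
      (∀ i : Fin k, ν (10 + i) = μ₂ (10 + i)) ∧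
      (∀ j < numNonzero (ν 9) τ, (polyOf k (d + 1) fun x => ν 2 (j * (d + 1) ^ k + x)) ∈ V ∧
        t ≤ agreeCount s n pts wd (polyOf k (d + 1) fun x => ν 2 (j * (d + 1) ^ k + x))) ∧
      ∀ τ' < τ, ∀ p : Fin r → Fin k → Fin n,
        (∀ l : Fin r, dig τ' (n ^ k) l = radix n fun i => (p l i : ℕ)) →
        ∀ f ∈ V, (∀ l, AgreesAt s n pts wd f (p l)) →
        (∀ g ∈ V, (∀ l, ∀ e : Fin k →₀ ℕ, ∑ i, e i < s →
          (shift (fun i => pts (p l i)) g).coeff e = 0) → g = 0) →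
        t ≤ agreeCount s n pts wd f →
        ∃ j < numNonzero (ν 9) τ, (polyOf k (d + 1) fun x => ν 2 (j * (d + 1) ^ k + x)) = f)
    ⟨r₂, fun _ => rfl, fun j hj => by simp [numNonzero] at hj, fun τ' hτ' => by omega⟩ (by
      rintro τ - ν ⟨rν, hq, hA, hB⟩
      have hρ' := hρ.update (v := 9) (i := τ) (by norm_num)
      obtain ⟨b1, b2, g, hg, b3, b4, b5, b6⟩ := body_spec (r := r) hρ' rν hm hn rfl
        (Q := fun i => interpPoly k (boxSize M s n) (μ₂ (10 + i))) fun i => by rw [hq i]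
      rw [Function.update_self] at b2 b4 b5 b6
      simp only [Function.update_self] at b3
      set ν' := (bodyCmd m M k r).run (Function.update ρ 9 τ) ν with hν'
      have hnum : numNonzero (ν' 9) (τ + 1) = numNonzero (ν 9) τ +
          if t ≤ agreeCount s n pts wd g then 1 else 0 := by
        rw [numNonzero_succ, numNonzero_congr fun j hj => b2 j hj.ne, b4]
        by_cases ht : t ≤ agreeCount s n pts wd g
        · rw [if_pos ht, if_pos ht, if_neg one_ne_zero]
        · rw [if_neg ht, if_neg ht, if_pos rfl]
      have hold : ∀ j < numNonzero (ν 9) τ, (polyOf k (d + 1) fun x => ν' 2 (j * (d + 1) ^ k + x)) =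
          polyOf k (d + 1) fun x => ν 2 (j * (d + 1) ^ k + x) :=
        fun j hj => polyOf_congr fun x hx => b6 j hj x hx
      refine ⟨rν.congr (b1 0 (by norm_num)) (b1 1 (by norm_num)) (b1 3 (by norm_num)),
        fun i => (b1 _ (by omega)).trans (hq i), fun j hj => ?_, fun τ' hτ' p hp f hf hfp hdet ht => ?_⟩
      · rcases Nat.lt_or_ge j (numNonzero (ν 9) τ) with h | h
        · rw [hold j h]
          exact hA j h
        · have ht : t ≤ agreeCount s n pts wd g := by
            by_contra hc
            rw [hnum, if_neg hc] at hj
            omega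
          rw [hnum, if_pos ht] at hj
          obtain rfl : j = numNonzero (ν 9) τ := by omega
          rw [b5 ht]
          exact ⟨hg, ht⟩
      · rcases Nat.lt_succ_iff_lt_or_eq.1 hτ' with h | rfl
        · obtain ⟨j, hj, hjf⟩ := hB τ' h p hp f hf hfp hdet ht
          exact ⟨j, hj.trans_le (hnum ▸ Nat.le_add_right _ _), (hold j hj).trans hjf⟩
        · obtain rfl := b3 p hp f hf hfp hdet
          exact ⟨numNonzero (ν 9) τ', by rw [hnum, if_pos ht]; omega, b5 ht⟩)
  rw [hrun] at key
  have hN : N = numNonzero (μ' 9) ((n ^ k) ^ r) := by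
    rw [show N = (numTm (tuplesTm k r)).eval ρ μ' from rfl, eval_numTm]
    simp [tuplesTm, hρ.two]
  rw [hN]
  refine ⟨key.2.2.1, fun p f hf hfp hdet ht => ?_⟩
  have hlt' : ∀ l : Fin r, radix n (fun i => (p l i : ℕ)) < n ^ k := fun l =>
    radix_lt fun i => (p l i).2
  -- The number under which the tuple `p` is enumerated.
  exact key.2.2.2 (radix (n ^ k) fun l : Fin r => radix n fun i => (p l i : ℕ)) (radix_lt hlt') p
    (fun l => dig_radix hlt' l) f hf hfp hdet ht

end decoder

-- Choice of parameters and correctness of the decoder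

section final

variable {F : Type u} [Field F] {k : ℕ} {s d n t M m : ℕ} {pts wd : ℕ → F} {ε : ℝ}

theorem one_sub_relDist : 1 - relDist s d n = (d : ℝ) / (s * n) := by
  rw [relDist, sub_sub_cancel]

/-- Raised to the power `k`, with `m + 1 = M ^ k`, this says that the interpolation system has more
unknowns than equations. -/
theorem lt_mul_boxSize (hM : 0 < M) : n * s < M * boxSize M s n := by
  rw [boxSize, mul_add, mul_one]
  exact Nat.lt_mul_div_succ (n * s) hM

/-- The numerical condition for a polynomial that solves the differential equations at many points
to solve them identically. -/
theorem degree_lt_of_agreement (hε₀ : 0 < ε) (hε₁ : ε < 1) (hM : 2 * k ≤ ε * M) (hM₀ : 0 < M)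
    (hs : 4 * m < ε * s) (hms : m < s) (hd : d < s * n) {c : ℕ}
    (hc : ((d : ℝ) / (s * n) + ε) * (n : ℝ) ^ k ≤ c) :
    (k * (boxSize M s n - 1) + d) * n ^ k < (s - m) * c * n := by
  have hs0 : 0 < s := by omega
  have hn0 : 0 < n := Nat.pos_of_ne_zero fun h => by simp [h] at hd
  have hsr : (0 : ℝ) < s := by exact_mod_cast hs0
  have hnr : (0 : ℝ) < n := by exact_mod_cast hn0
  have hMr : (0 : ℝ) < M := by exact_mod_cast hM₀
  have hmr : (0 : ℝ) ≤ m := Nat.cast_nonneg m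
  have hdr : (d : ℝ) < s * n := by exact_mod_cast hd
  have hmsr : (m : ℝ) < s := by exact_mod_cast hms
  have hN : (0 : ℝ) < (n : ℝ) ^ k := pow_pos hnr k
  set x : ℝ := (d : ℝ) / (s * n) with hx
  have hxd : (d : ℝ) = x * (s * n) := by rw [hx, div_mul_cancel₀ _ (by positivity)]
  have hx1 : x < 1 := by rw [hx, div_lt_one (by positivity)]; exact hdr
  -- By the choice of `M`, the coefficients of the operator spend at most half of the surplus `ε * s
  -- * n` on their degree.
  have hb : (k : ℝ) * ((boxSize M s n - 1 : ℕ) : ℝ) ≤ ε / 2 * (s * n) := by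
    rw [boxSize, Nat.add_sub_cancel]
    have h1 : ((n * s / M : ℕ) : ℝ) ≤ (n * s) / M := by exact_mod_cast Nat.cast_div_le
    calc (k : ℝ) * ((n * s / M : ℕ) : ℝ) ≤ k * ((n * s) / M) :=
          mul_le_mul_of_nonneg_left h1 (Nat.cast_nonneg k)
      _ ≤ (ε * M / 2) * ((n * s) / M) := mul_le_mul_of_nonneg_right (by linarith) (by positivity)
      _ = ε / 2 * (s * n) := by field_simp
  -- The loss of `m` orders of vanishing costs `m * n * (x + ε) ≤ 2 * m * n`, which by `hs` is less
  -- than the other half.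
  have hmain : (k : ℝ) * ((boxSize M s n - 1 : ℕ) : ℝ) + d < (s - m) * n * (x + ε) := by
    have h1 : (m : ℝ) * n * x ≤ m * n := mul_le_of_le_one_right (by positivity) hx1.le
    have h2 : (m : ℝ) * n * ε ≤ m * n := mul_le_of_le_one_right (by positivity) hε₁.le
    have h3 : 4 * (m : ℝ) * n < ε * s * n := mul_lt_mul_of_pos_right hs hnr
    have h4 : ((s : ℝ) - m) * n * (x + ε) = x * (s * n) + ε * s * n - m * n * x - m * n * ε := by ring
    rw [h4, hxd]
    linarith
  have : (((k * (boxSize M s n - 1) + d) * n ^ k : ℕ) : ℝ) < (((s - m) * c * n : ℕ) : ℝ) := by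
    push_cast [Nat.cast_sub hms.le]
    calc ((k : ℝ) * ((boxSize M s n - 1 : ℕ) : ℝ) + d) * (n : ℝ) ^ k
        < (s - m) * n * (x + ε) * (n : ℝ) ^ k := mul_lt_mul_of_pos_right hmain hN
      _ = (s - m) * n * ((x + ε) * (n : ℝ) ^ k) := by ring
      _ ≤ (s - m) * n * c := mul_le_mul_of_nonneg_left hc (by
          have : (0 : ℝ) < s - m := by linarith
          positivity)
      _ = (s - m) * c * n := by ring
  exact_mod_cast this

/-- The threshold is an input variable, and the running time is bounded in terms of all input
variables, so it has to be polynomially bounded too. -/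
theorem threshold_le (hε₁ : ε < 1) (hd : d < s * n) :
    ⌈(1 - relDist s d n + ε) * (n : ℝ) ^ k⌉₊ ≤ 2 * n ^ k := by
  rw [Nat.ceil_le, one_sub_relDist]
  push_cast
  refine mul_le_mul_of_nonneg_right ?_ (by positivity)
  have : (d : ℝ) / (s * n) ≤ 1 := div_le_one_of_le₀ (by exact_mod_cast hd.le) (by positivity)
  linarith

variable {S : Finset F} (enum : Fin S.card ≃ S) (P : Word k s S)

theorem view_inputState_zero (i : Fin S.card) : view (inputState d t enum P) 0 i = enum i := by
  change (inputState d t enum P).fld 0 i = _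
  simp only [inputState, if_true]
  exact (Fin.val_injective (n := S.card)).extend_apply _ _ i

theorem view_inputState_one (p : Fin k → Fin S.card) (e : Exps k s) :
    view (inputState d t enum P) 1 (wordCell k s S.card (p, e)) = P (fun i => enum (p i)) e := by
  change (inputState d t enum P).fld 1 _ = _
  simp only [inputState, one_ne_zero, if_false, if_true]
  exact (wordCell_injective k s S.card).extend_apply _ _ (p, e)

theorem agreesAt_iff (f : MvPolynomial (Fin k) F) (p : Fin k → Fin S.card) :
    AgreesAt s S.card (view (inputState d t enum P) 0) (view (inputState d t enum P) 1) f p ↔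
      enc s S f (fun i => enum (p i)) = P fun i => enum (p i) := by
  have h : ∀ e : Exps k s, enc s S f (fun i => enum (p i)) e =
      (shift (fun i => view (inputState d t enum P) 0 (p i)) f).coeff e.1 := fun e => by
    rw [enc_apply]
    simp only [view_inputState_zero]
  rw [funext_iff]
  constructor
  · intro hf e
    rw [h, ← hf e.1 e.2]
    exact view_inputState_one enum P p e
  · intro hf e he
    have := hf ⟨e, he⟩
    rw [h] at this
    rw [this]
    exact view_inputState_one enum P p ⟨e, he⟩

theorem agreeCount_eq (f : MvPolynomial (Fin k) F) :
    agreeCount s S.card (view (inputState d t enum P) 0) (view (inputState d t enum P) 1) f =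
      Set.ncard {a : Fin k → S | enc s S f a = P a} := by
  classical
  have hinj : Function.Injective fun (p : Fin k → Fin S.card) i => enum (p i) := fun p q h =>
    funext fun i => enum.injective (congrFun h i)
  rw [agreeCount, ← Set.ncard_coe_finset, ← Set.ncard_image_of_injective _ hinj]
  congr 1
  ext a
  simp only [Set.mem_image, Finset.mem_coe, Finset.mem_filter, Finset.mem_univ, true_and,
    agreesAt_iff, Set.mem_ofPred_eq]
  constructor
  · rintro ⟨p, hp, rfl⟩
    exact hp
  · intro ha
    refine ⟨fun i => enum.symm (a i), ?_, ?_⟩ <;> simp [ha]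

/-- The number of points of agreement is an integer, so rounding up the threshold loses nothing. -/
theorem threshold_le_iff (hn : 0 < S.card) (f : MvPolynomial (Fin k) F) {x : ℝ} :
    ⌈x * (S.card : ℝ) ^ k⌉₊ ≤
      agreeCount s S.card (view (inputState d t enum P) 0) (view (inputState d t enum P) 1) f ↔
      x ≤ agreement (enc s S f) P := by
  have hN : (0 : ℝ) < (S.card : ℝ) ^ k := pow_pos (by exact_mod_cast hn) k
  rw [Nat.ceil_le, agreeCount_eq, agreement, le_div_iff₀ hN]

/-- A polynomial that vanishes with high multiplicity at many points of agreement is zero. -/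
theorem eq_zero_of_agreement_points {f g : MvPolynomial (Fin k) F} {D l : ℕ}
    (hg : g.totalDegree ≤ D) {pts wd : ℕ → F} (hpts : ∀ i : Fin S.card, pts i = enum i)
    (hv : ∀ p : Fin k → Fin S.card, AgreesAt s S.card pts wd f p → ∀ e : Fin k →₀ ℕ,
      ∑ i, e i < l → (shift (fun i => pts (p i)) g).coeff e = 0)
    (h : D * S.card ^ k < l * agreeCount s S.card pts wd f * S.card) : g = 0 := by
  classical
  have hinj : Function.Injective fun (p : Fin k → Fin S.card) i => enum (p i) := fun p q h =>
    funext fun i => enum.injective (congrFun h i)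
  refine eq_zero_of_vanish hg (Finset.image (fun p i => enum (p i))
    {p : Fin k → Fin S.card | AgreesAt s S.card pts wd f p}) ?_ ?_ (l := l)
  · intro a ha e he
    obtain ⟨p, hp, rfl⟩ := Finset.mem_image.1 ha
    have := hv p (Finset.mem_filter.1 hp).2 e he
    simpa only [hpts] using this
  · rwa [Finset.card_image_of_injective _ hinj]

/-- By `h` and the multiplicity count, a solution of degree at most `d` that vanishes to order `s`
at all points of agreement is zero. The bound on the dimension reduces these points to `r` of them.
-/
theorem exists_determining_points {m r : ℕ} (hF : ringChar F = 0 ∨ d < ringChar F)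
    {Q : Fin k → ℕ → MvPolynomial (Fin k) F} (hQ : ∀ i, ∃ j ≤ m, Q i j ≠ 0)
    (hr : (m + 1) ^ k = r) {pts wd : ℕ → F} (hpts : ∀ i : Fin S.card, pts i = enum i)
    {f : MvPolynomial (Fin k) F}
    (h : d * S.card ^ k < s * agreeCount s S.card pts wd f * S.card) :
    ∃ p : Fin r → Fin k → Fin S.card, (∀ l, AgreesAt s S.card pts wd f (p l)) ∧
      ∀ g ∈ solutions m d Q, (∀ l, ∀ e : Fin k →₀ ℕ, ∑ i, e i < s →
        (shift (fun i => pts (p l i)) g).coeff e = 0) → g = 0 := by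
  classical
  have hA : {p : Fin k → Fin S.card | AgreesAt s S.card pts wd f p}.Nonempty := by
    by_contra hc
    have : agreeCount s S.card pts wd f = 0 := by
      rw [agreeCount, Finset.card_eq_zero, Finset.filter_eq_empty_iff]
      exact fun p _ hp => hc ⟨p, hp⟩
    simp [this] at h
  obtain ⟨p, hp, hdet⟩ := exists_determining
    (fun p : Fin k → Fin S.card => LinearMap.pi fun e : Exps k s =>
      MvPolynomial.lcoeff F e.1 ∘ₗ (shift fun i => pts (p i)).toLinearMap)
    {p | AgreesAt s S.card pts wd f p} hA r (solutions m d Q)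
    (hr ▸ finrank_solutions_le hF hQ) fun g hg hv =>
      eq_zero_of_agreement_points enum (mem_solutions.1 hg).1 hpts
        (fun p hp e he => congrFun (hv p hp) ⟨e, he⟩) h
  exact ⟨p, hp, fun g hg hv => hdet g hg fun l => funext fun e => hv l e.1 e.2⟩

end final

section final

variable {F : Type u} [Field F] {k : ℕ} {s d M m : ℕ} {ε : ℝ}

/-- The decoder outputs exactly the polynomials whose encodings are close to the received word. -/
theorem decoderCmd_correct (hk : 1 ≤ k) (hε₀ : 0 < ε) (hε₁ : ε < 1) (hM : 2 * k ≤ ε * M)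
    (hm : m + 1 = M ^ k) (hs : 4 * m < ε * s) (hms : m < s)
    (hF : ringChar F = 0 ∨ d < ringChar F) {S : Finset F} (hd : d < s * S.card)
    (enum : Fin S.card ≃ S) (P : Word k s S) {ρ : ℕ → ℕ} {t : ℕ}
    (ht : ⌈(1 - relDist s d S.card + ε) * (S.card : ℝ) ^ k⌉₊ = t) (hρ : Params ρ s d S.card t)
    {μ' : Mem F}
    (hμ' : (decoderCmd m M k ((m + 1) ^ k)).run ρ (view (inputState d t enum P)) = μ')
    (f : MvPolynomial (Fin k) F) :
    (∃ j < (numTm (tuplesTm k ((m + 1) ^ k))).eval ρ μ',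
      (polyOf k (d + 1) fun x => μ' 2 (j * (d + 1) ^ k + x)) = f) ↔
      f.totalDegree ≤ d ∧ 1 - relDist s d S.card + ε ≤ agreement (enc s S f) P := by
  have hM₀ : 0 < M := Nat.pos_of_ne_zero fun h => by
    rw [h, zero_pow (by omega)] at hm
    omega
  have hn : 0 < S.card := Nat.pos_of_ne_zero fun h => by simp [h] at hd
  have hlt : S.card ^ k * s ^ k < (m + 1) * boxSize M s S.card ^ k := by
    rw [hm, ← mul_pow, ← mul_pow]
    exact Nat.pow_lt_pow_left (lt_mul_boxSize hM₀) (by omega)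
  obtain ⟨q, hq, hQ, hsound, hcomplete⟩ := decoderCmd_spec (r := (m + 1) ^ k) hρ
    (μ := view (inputState d t enum P)) rfl rfl hms hn hlt hμ'
  have hclose : ∀ g : MvPolynomial (Fin k) F, t ≤ agreeCount s S.card
      (view (inputState d t enum P) 0) (view (inputState d t enum P) 1) g ↔
      1 - relDist s d S.card + ε ≤ agreement (enc s S g) P := fun g => by
    rw [← threshold_le_iff (d := d) (t := t) enum P hn, ht]
  constructor
  · rintro ⟨j, hj, rfl⟩
    exact ⟨(mem_solutions.1 (hsound j hj).1).1, (hclose _).1 (hsound j hj).2⟩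
  · rintro ⟨hfd, hfa⟩
    rw [← hclose] at hfa
    have hc : ((d : ℝ) / (s * S.card) + ε) * (S.card : ℝ) ^ k ≤ (agreeCount s S.card
        (view (inputState d t enum P) 0) (view (inputState d t enum P) 1) f : ℝ) := by
      rw [← one_sub_relDist, ← Nat.ceil_le, ht]
      exact hfa
    -- This is used for the operators, with multiplicity `s - m`; the weaker inequality that follows
    -- is used for differences in the space of solutions, with multiplicity `s`.
    have h1 := degree_lt_of_agreement hε₀ hε₁ hM hM₀ hs hms hd hc
    have h2 : d * S.card ^ k < s * agreeCount s S.card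
        (view (inputState d t enum P) 0) (view (inputState d t enum P) 1) f * S.card :=
      calc d * S.card ^ k ≤ (k * (boxSize M s S.card - 1) + d) * S.card ^ k :=
            Nat.mul_le_mul_right _ (Nat.le_add_left _ _)
        _ < _ := h1
        _ ≤ _ := Nat.mul_le_mul_right _ (Nat.mul_le_mul_right _ (Nat.sub_le _ _))
    have hfV : f ∈ solutions m d fun i => interpPoly k (boxSize M s S.card) (q i) := by
      refine mem_solutions.2 ⟨hfd, fun i => ?_⟩
      refine eq_zero_of_agreement_points enum
        (totalDegree_diffOp_le (fun j _ => totalDegree_polyOf_le _ _) hfd)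
        (view_inputState_zero enum P) (fun p hp e he => ?_) h1
      exact coeff_shift_diffOp_eq_zero (hq i) hp (by omega)
    -- The tuple depends on `f`, which is why the decoder tries all tuples.
    obtain ⟨p, hp, hdet⟩ := exists_determining_points enum hF hQ rfl (view_inputState_zero enum P) h2
    exact hcomplete p f hfV hp hdet hfa

end final

end MultCode

-- The main theorem

open MultCode in
theorem theorem1p2 (ε : ℝ) (hε₀ : 0 < ε) (hε₁ : ε < 1) (k : ℕ) (hk : 1 ≤ k) :
    ∃ (s₀ C : ℕ) (decoder : MultCode.Prog),
      ∀ s : ℕ, s₀ ≤ s → ∀ (d : ℕ) (F : Type u) [Field F], (ringChar F = 0 ∨ d < ringChar F) →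
      ∀ S : Finset F, d < s * S.card → ∀ (enum : Fin S.card ≃ S) (P : MultCode.Word k s S),
        (∃ (σ : MultCode.State F) (T : ℕ),
          MultCode.Exec decoder
            (MultCode.inputState d
              ⌈(1 - MultCode.relDist s d S.card + ε) * (S.card : ℝ) ^ k⌉₊ enum P) σ T ∧
          T ≤ C * (s * S.card) ^ C ∧
          (MultCode.outputList k d σ).length ≤ C * (s * S.card) ^ C ∧
          ∀ f : MvPolynomial (Fin k) F,
            f ∈ MultCode.outputList k d σ ↔
              f.totalDegree ≤ d ∧
                1 - MultCode.relDist s d S.card + ε ≤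
                  MultCode.agreement (MultCode.enc s S f) P) ∧
        {c ∈ MultCode.code k s d S |
          1 - MultCode.relDist s d S.card + ε ≤ MultCode.agreement c P}.Finite ∧
        {c ∈ MultCode.code k s d S |
          1 - MultCode.relDist s d S.card + ε ≤ MultCode.agreement c P}.ncard ≤
            C * (s * S.card) ^ C := by
  set M := ⌈2 * k / ε⌉₊ with hMdef
  have hM : 2 * k ≤ ε * M := by
    have := Nat.le_ceil (2 * k / ε)
    rwa [div_le_iff₀ hε₀, mul_comm (M : ℝ)] at this
  have hM₀ : 0 < M := Nat.ceil_pos.2 (by positivity)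
  -- Chosen so that the number `m + 1` of unknown polynomials is `M ^ k`, which compensates the
  -- factor `M` by which the box is smaller than `n * s` in each variable.
  set m := M ^ k - 1 with hmdef
  have hm : m + 1 = M ^ k := Nat.sub_add_cancel (Nat.one_le_pow _ _ hM₀)
  obtain ⟨p, e, hp⟩ := exists_prog.{u} (decoderCmd m M k ((m + 1) ^ k))
    (numTm (tuplesTm k ((m + 1) ^ k)))
  -- The first constant gives `4 * m < ε * s` and also `s ≥ 2`, as the compiler needs a base of at
  -- least `2`. The second one arises because all inputs are at most `(s * |S|) ^ (k + 1)` and the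
  -- program takes at most the power `e` of that.
  refine ⟨⌈4 * m / ε⌉₊ + 2, (k + 1) * e + 1, p, fun s hs d F _ hF S hd enum P => ?_⟩
  have hs' : 4 * m < ε * s := by
    have h1 : 4 * m / ε < s :=
      (Nat.le_ceil _).trans_lt (by exact_mod_cast (by omega : ⌈4 * m / ε⌉₊ < s))
    rwa [div_lt_iff₀ hε₀, mul_comm (s : ℝ)] at h1
  have hms : m < s := by
    have hsr : ε * s ≤ s := mul_le_of_le_one_left (Nat.cast_nonneg s) hε₁.le
    have hmr : (0 : ℝ) ≤ m := Nat.cast_nonneg m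
    have : (m : ℝ) < s := by linarith
    exact_mod_cast this
  have hn : 0 < S.card := Nat.pos_of_ne_zero fun h => by simp [h] at hd
  set t := ⌈(1 - relDist s d S.card + ε) * (S.card : ℝ) ^ k⌉₊ with ht
  set Y := s * S.card with hY
  have hsY : s ≤ Y := Nat.le_mul_of_pos_right s hn
  have hnY : S.card ≤ Y := Nat.le_mul_of_pos_left _ (by omega)
  have hY2 : 2 ≤ Y := by omega
  have hYX : Y ≤ Y ^ (k + 1) := Nat.le_self_pow (by omega) Y
  have htX : t ≤ Y ^ (k + 1) :=
    calc t ≤ 2 * S.card ^ k := threshold_le hε₁ hd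
      _ ≤ Y * Y ^ k := Nat.mul_le_mul hY2 (Nat.pow_le_pow_left hnY k)
      _ = Y ^ (k + 1) := (pow_succ' Y k).symm
  have hC : (Y ^ (k + 1)) ^ e ≤ ((k + 1) * e + 1) * Y ^ ((k + 1) * e + 1) :=
    calc (Y ^ (k + 1)) ^ e = Y ^ ((k + 1) * e) := (pow_mul Y (k + 1) e).symm
      _ ≤ Y ^ ((k + 1) * e + 1) := Nat.pow_le_pow_right (by omega) (Nat.le_succ _)
      _ ≤ _ := Nat.le_mul_of_pos_left _ (Nat.succ_pos _)
  have hvars : ∀ v, (inputState d t enum P).nat 0 v ≤ Y ^ (k + 1) := by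
    intro v
    simp only [inputState, if_true]
    split_ifs <;> omega
  have hρ : Params ((inputState d t enum P).nat 0) s d S.card t := by
    constructor <;> simp [inputState]
  obtain ⟨σ, T, hexec, hT, hview, hcount, hcount'⟩ :=
    hp F (inputState d t enum P) (Y ^ (k + 1)) (hY2.trans hYX) hvars
  have hmem : ∀ f : MvPolynomial (Fin k) F, f ∈ outputList k d σ ↔
      f.totalDegree ≤ d ∧ 1 - relDist s d S.card + ε ≤ agreement (enc s S f) P := by
    intro f
    rw [← decoderCmd_correct hk hε₀ hε₁ hM hm hs' hms hF hd enum P rfl hρ hview.symm f, outputList,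
      List.mem_map, ← hcount]
    refine exists_congr fun j => ?_
    rw [List.mem_range]
    rfl
  have hlen : (outputList k d σ).length ≤ ((k + 1) * e + 1) * Y ^ ((k + 1) * e + 1) := by
    rw [outputList, List.length_map, List.length_range]
    exact hcount'.trans hC
  -- Every close codeword is the encoding of an output polynomial, so the length of the output
  -- bounds their number even over an infinite field.
  have hsub : {c ∈ code k s d S | 1 - relDist s d S.card + ε ≤ agreement c P} ⊆
      enc s S '' {f | f ∈ outputList k d σ} := by
    rintro _ ⟨⟨f, hf, rfl⟩, hfa⟩
    exact ⟨f, (hmem f).2 ⟨hf, hfa⟩, rfl⟩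
  have hfin : {f | f ∈ outputList k d σ}.Finite := List.finite_toSet _
  refine ⟨⟨σ, T, hexec, hT.trans hC, hlen, hmem⟩, (hfin.image _).subset hsub, ?_⟩
  refine (Set.ncard_le_ncard hsub (hfin.image _)).trans ((Set.ncard_image_le hfin).trans
    (le_trans ?_ hlen))
  classical
  rw [show {f | f ∈ outputList k d σ} = ((outputList k d σ).toFinset : Set _) by ext; simp,
    Set.ncard_coe_finset]
  exact List.toFinset_card_le _
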